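/- Let $d\ge 5$ and $2\le r\le d-3$ be integers, $X=\{x_1,\dots,x_d\}$, let $X^\ell$ be the set of words of length $\ell$ over $X$, and let $\Omega_\ell=\mathrm{Alt}(X^\ell)$ for $\ell\ge 1$. For $\ell\le k$ let $\iota_{\ell,k}\colon\Omega_\ell\to\Omega_k$ be given by $\iota_{\ell,k}(\sigma)(vw)=\sigma(v)w$ ($v\in X^\ell$, $w\in X^{k-\ell}$). Let $B=\mathrm{Alt}(\{x_1,\dots,x_r\}\times X)$ and, for $\ell\ge2$, let $\varphi_\ell\colon B\to\Omega_\ell$ be the homomorphism for which $\varphi_\ell(c)$ maps $x_d^{\ell-2}xy$ to $x_d^{\ell-2}c(xy)$ for $x\in\{x_1,\dots,x_r\}$, $y\in X$, and fixes all other words. In the profinite group $P=\prod_{\ell\ge1}\Omega_\ell$ (product topology, finite factors discrete) put $\Delta_1(\omega)=(\iota_{1,\ell}(\omega))_{\ell\ge1}$ for $\omega\in\Omega_1$ and $\tilde c=\bigl(\prod_{k=2}^{\ell}\iota_{k,\ell}(\varphi_k(c))\bigr)_{\ell\ge1}$ for $c\in B$ (the factors commute), and let $$G_{\mathcal A(d,r)}=\langle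 \Delta_1(\omega),\ \tilde c \mid \omega\in\Omega_1,\ c\in B\rangle\le P .$$ Let $\delta=(x_1,x_d)(x_2,x_{d-1})\in\mathrm{Alt}(X)$, let $\varepsilon=(\varepsilon_\ell)_{\ell\ge1}\in P$ with $\varepsilon_\ell=\delta\times\dots\times\delta$ acting letterwise on $X^\ell$ (so $\varepsilon^2=1$), and write $g^\varepsilon=\varepsilon^{-1}g\varepsilon$. Put $$N=\langle G_{\mathcal A(d,r)},\,G_{\mathcal A(d,r)}^{\varepsilon}\rangle\le P ,$$ and let $\tau$ be the automorphism $g\mapsto g^\varepsilon$ of $N$. Then: 1. $N$ can be generated by $4$ elements and is residually finite. 2. The continuous homomorphism $\widehat N\to P$ induced by the inclusion $N\subseteq P$ is an isomorphism of profinite groups. 3. $\tau$ is not an inner automorphism of $N$, but the induced automorphism $\widehat\tau$ of $\widehat N$ is inner: it is $x\mapsto\gamma^{-1}x\gamma$ for an element $\gamma\in\widehat N$ whose image in $P$ is $\varepsilon$. 4. $G=N\rtimes\langle\tau\rangle$ with its normal subgroup $N$ is a counterexample to the question of Goldstein and Guralnick: $G$ is finitely generated and residually finite, $N$ is a finitely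 generated normal subgroup of $G$, the image of $\widehat N$ in $\widehat G$ is a direct factor of $\widehat G$ (with closed complement), but $N$ is not a direct factor of $G$. 5. The group $N\rtimes\langle\tau\rangle$ is amenable. -/

import Mathlib

noncomputable section

namespace AltTelescope

/-! ### Alternating groups on sets of words -/

/-- A homomorphism between symmetric groups on finite sets maps even permutations to even
permutations. -/
theorem map_mem_alternatingGroup {α β : Type*} [Fintype α] [DecidableEq α] [Fintype β]
    [DecidableEq β] (f : Equiv.Perm α →* Equiv.Perm β) {σ : Equiv.Perm α}
    (hσ : σ ∈ alternatingGroup α) : f σ ∈ alternatingGroup β := by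
  rw [Equiv.Perm.mem_alternatingGroup] at hσ ⊢
  by_cases hs : Function.Surjective (Equiv.Perm.sign.comp f)
  · have h := DFunLike.congr_fun (Equiv.Perm.eq_sign_of_surjective_hom hs) σ
    rw [hσ] at h
    exact h
  · rcases Int.units_eq_one_or (Equiv.Perm.sign (f σ)) with h | h
    · exact h
    · refine (hs fun u => ?_).elim
      rcases Int.units_eq_one_or u with rfl | rfl
      · exact ⟨1, map_one _⟩
      · exact ⟨σ, h⟩

/-- The restriction of a homomorphism of symmetric groups to the alternating groups. -/
def altMap {α β : Type*} [Fintype α] [DecidableEq α] [Fintype β] [DecidableEq β]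
    (f : Equiv.Perm α →* Equiv.Perm β) : alternatingGroup α →* alternatingGroup β :=
  (f.comp (alternatingGroup α).subtype).codRestrict (alternatingGroup β)
    fun σ => map_mem_alternatingGroup f σ.2

/-- The alphabet `X = {x_1, …, x_d}` is `Fin d`, with `x_i` the element `i - 1`; a word of length
`l` is a map `Fin l → Fin d`. -/
abbrev Word (d l : ℕ) : Type := Fin l → Fin d

/-- `Ω_l = Alt(X^l)`. -/
def Omega (d l : ℕ) : Type := alternatingGroup (Word d l)

instance (d l : ℕ) : Group (Omega d l) := inferInstanceAs (Group (alternatingGroup (Word d l)))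

instance (d l : ℕ) : Finite (Omega d l) := inferInstanceAs (Finite (alternatingGroup (Word d l)))

/-- The finite group `Ω_l` carries the discrete topology. -/
instance (d l : ℕ) : TopologicalSpace (Omega d l) := ⊥

instance (d l : ℕ) : DiscreteTopology (Omega d l) := ⟨rfl⟩

/-- `σ` applied to the prefix of length `l` of a word of length `k ≥ l`: the word `v w` with
`v ∈ X^l` is sent to `σ(v) w`. -/
def prefixFun {d l k : ℕ} (h : l ≤ k) (σ : Equiv.Perm (Word d l)) (w : Word d k) : Word d k :=
  fun j => if hj : (j : ℕ) < l then σ (fun i => w (Fin.castLE h i)) ⟨j, hj⟩ else w j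

theorem prefixFun_mul {d l k : ℕ} (h : l ≤ k) (σ τ : Equiv.Perm (Word d l)) (w : Word d k) :
    prefixFun h (σ * τ) w = prefixFun h σ (prefixFun h τ w) := by
  funext j
  by_cases hj : (j : ℕ) < l
  · simp [prefixFun, hj]
  · simp [prefixFun, hj]

theorem prefixFun_one {d l k : ℕ} (h : l ≤ k) (w : Word d k) :
    prefixFun h (1 : Equiv.Perm (Word d l)) w = w := by
  funext j
  by_cases hj : (j : ℕ) < l
  · simp only [prefixFun, hj, dif_pos, Equiv.Perm.one_apply]
    rfl
  · simp [prefixFun, hj]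

/-- The homomorphism `Sym(X^l) → Sym(X^k)`, `σ ↦ (v w ↦ σ(v) w)`. -/
def prefixHom {d l k : ℕ} (h : l ≤ k) : Equiv.Perm (Word d l) →* Equiv.Perm (Word d k) where
  toFun σ :=
    { toFun := prefixFun h σ
      invFun := prefixFun h σ⁻¹
      left_inv := fun w => by rw [← prefixFun_mul, inv_mul_cancel, prefixFun_one]
      right_inv := fun w => by rw [← prefixFun_mul, mul_inv_cancel, prefixFun_one] }
  map_one' := Equiv.ext fun w => prefixFun_one h w
  map_mul' σ τ := Equiv.ext fun w => prefixFun_mul h σ τ w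

/-- The transition map `ι_{l,k} : Ω_l → Ω_k`. -/
def iota {d l k : ℕ} (h : l ≤ k) : Omega d l →* Omega d k := altMap (prefixHom h)

/-! ### The telescope `𝒜(d, r)` and its group -/

/-- The group `B = Alt({x_1, …, x_r} × X)`. -/
abbrev BGroup (d r : ℕ) : Type := alternatingGroup {p : Fin d × Fin d // (p.1 : ℕ) < r}

section

variable {d : ℕ} (hd : 5 ≤ d)

/-- The last letter `x_d`. -/
def lastLetter : Fin d := ⟨d - 1, by omega⟩

/-- The injection `(x, y) ↦ x_d^k x y` of `{x_1, …, x_r} × X` into `X^(k+2)`. -/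
def spine (r k : ℕ) : {p : Fin d × Fin d // (p.1 : ℕ) < r} ↪ Word d (k + 2) where
  toFun p := Fin.append (fun _ : Fin k => lastLetter hd) ![p.1.1, p.1.2]
  inj' p q h := by
    have h0 := congrFun h (Fin.natAdd k 0)
    have h1 := congrFun h (Fin.natAdd k 1)
    simp only [Fin.append_right] at h0 h1
    exact Subtype.ext (Prod.ext h0 h1)

/-- The homomorphism `φ_{k+2} : B → Ω_{k+2}`: the permutation `φ_{k+2}(c)` sends `x_d^k x y` to
`x_d^k c(x y)` for `x ∈ {x_1, …, x_r}`, `y ∈ X`, and fixes all other words. -/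
def phi (r k : ℕ) : BGroup d r →* Omega d (k + 2) :=
  altMap (Equiv.Perm.viaEmbeddingHom (spine hd r k))

/-- The profinite group `P = ∏_{l ≥ 1} Ω_l` with the product topology;
the coordinate with index `n` is `Ω_{n+1}`. -/
abbrev PGroup (d : ℕ) : Type := ∀ n : ℕ, Omega d (n + 1)

/-- `Δ_1(ω) = (ω, ι_{1,2}(ω), ι_{1,3}(ω), …)`. -/
def Delta (ω : Omega d 1) : PGroup d := fun n => iota (Nat.le_add_left 1 n) ω

/-- The element `c̃ = c̃^[1]` of `P`, whose coordinate in `Ω_l` is `∏_{k=2}^{l} ι_{k,l}(φ_k(c))`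
(the factors commute pairwise). -/
def tilde (r : ℕ) (c : BGroup d r) : PGroup d := fun n =>
  (List.ofFn fun k : Fin n => iota (Nat.succ_le_succ k.2 : (k : ℕ) + 2 ≤ n + 1)
    (phi hd r k c)).prod

/-- The group `G_{𝒜(d,r)} = ⟨Δ_1(Ω_1), C^[1]⟩ ≤ P` of the telescope `𝒜(d,r)`. -/
def telescopeGroup (r : ℕ) : Subgroup (PGroup d) :=
  Subgroup.closure (Set.range Delta ∪ Set.range (tilde hd r))

/-! ### The involution `ε` and the group `N` -/

/-- `δ = (x_1, x_d)(x_2, x_{d-1})`. -/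
def delta : Equiv.Perm (Fin d) :=
  Equiv.swap ⟨0, by omega⟩ ⟨d - 1, by omega⟩ * Equiv.swap ⟨1, by omega⟩ ⟨d - 2, by omega⟩

theorem delta_mem : delta hd ∈ alternatingGroup (Fin d) := by
  rw [Equiv.Perm.mem_alternatingGroup, delta, map_mul, Equiv.Perm.sign_swap,
    Equiv.Perm.sign_swap]
  · rfl
  · simp only [ne_eq, Fin.mk.injEq]; omega
  · simp only [ne_eq, Fin.mk.injEq]; omega

theorem delta_mul_delta : delta hd * delta hd = 1 := by
  have h : Commute (Equiv.swap (⟨0, by omega⟩ : Fin d) ⟨d - 1, by omega⟩)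
      (Equiv.swap ⟨1, by omega⟩ ⟨d - 2, by omega⟩) := by
    apply Equiv.Perm.Disjoint.commute
    intro x
    by_cases hx : x = ⟨0, by omega⟩ ∨ x = ⟨d - 1, by omega⟩
    · right
      apply Equiv.swap_apply_of_ne_of_ne <;> rcases hx with rfl | rfl <;>
        simp only [ne_eq, Fin.mk.injEq] <;> omega
    · left
      push Not at hx
      exact Equiv.swap_apply_of_ne_of_ne hx.1 hx.2
  rw [delta, h.symm.mul_mul_mul_comm, Equiv.swap_mul_self, Equiv.swap_mul_self, one_mul]

/-- The homomorphism `Sym(X) → Sym(X^l)`, `σ ↦ σ × ⋯ × σ`. -/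
def diagHom (d l : ℕ) : Equiv.Perm (Fin d) →* Equiv.Perm (Word d l) where
  toFun σ := Equiv.piCongrRight fun _ => σ
  map_one' := rfl
  map_mul' _ _ := rfl

/-- `ε = (ε_1, ε_2, ε_3, …) ∈ P` with `ε_l = δ × ⋯ × δ`. -/
def eps : PGroup d := fun n => altMap (diagHom d (n + 1)) ⟨delta hd, delta_mem hd⟩

theorem eps_mul_eps : eps hd * eps hd = 1 := by
  funext n
  have h : (⟨delta hd, delta_mem hd⟩ * ⟨delta hd, delta_mem hd⟩ : alternatingGroup (Fin d)) = 1 :=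
    Subtype.ext (delta_mul_delta hd)
  exact (map_mul (altMap (diagHom d (n + 1))) _ _).symm.trans
    ((congrArg _ h).trans (map_one _))

/-- Conjugation `g ↦ g^ε = ε⁻¹ g ε` on `P`. -/
def conjEps : MulAut (PGroup d) := MulAut.conj (eps hd)⁻¹

theorem conjEps_conjEps (g : PGroup d) : conjEps hd (conjEps hd g) = g := by
  rw [← MulAut.mul_apply, conjEps, ← map_mul, ← mul_inv_rev, eps_mul_eps, inv_one, map_one,
    MulAut.one_apply]

/-- The group `N = ⟨G, G^ε⟩ ≤ P` with `G = G_{𝒜(d,r)}`. -/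
def N (r : ℕ) : Subgroup (PGroup d) :=
  telescopeGroup hd r ⊔ (telescopeGroup hd r).map (conjEps hd).toMonoidHom

theorem conjEps_mem (r : ℕ) {g : PGroup d} (hg : g ∈ N hd r) : conjEps hd g ∈ N hd r := by
  have h : (N hd r).map (conjEps hd).toMonoidHom ≤ N hd r := by
    rw [N, Subgroup.map_sup]
    refine sup_le le_sup_right ?_
    rw [Subgroup.map_map]
    refine le_trans ?_ le_sup_left
    rintro _ ⟨x, hx, rfl⟩
    have : conjEps hd (conjEps hd x) ∈ telescopeGroup hd r := by
      rw [conjEps_conjEps]; exact hx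
    exact this
  exact h ⟨g, hg, rfl⟩

/-- The automorphism `τ` of `N` induced by conjugation with `ε`. -/
def tau (r : ℕ) : MulAut (N hd r) where
  toFun g := ⟨conjEps hd g, conjEps_mem hd r g.2⟩
  invFun g := ⟨conjEps hd g, conjEps_mem hd r g.2⟩
  left_inv g := Subtype.ext (conjEps_conjEps hd g)
  right_inv g := Subtype.ext (conjEps_conjEps hd g)
  map_mul' g h := Subtype.ext (map_mul (conjEps hd) (g : PGroup d) h)

/-- The continuous homomorphism `N̂ → P` induced by the inclusion `N → P`. -/
def completionToP (r : ℕ) :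
    ProfiniteGrp.profiniteCompletion.obj (GrpCat.of (N hd r)) ⟶ ProfiniteGrp.of (PGroup d) :=
  ProfiniteGrp.ProfiniteCompletion.lift (GrpCat.ofHom (N hd r).subtype)

/-- The semidirect product `N ⋊ ⟨τ⟩`. -/
abbrev Semi (r : ℕ) : Type :=
  N hd r ⋊[(Subgroup.zpowers (tau hd r)).subtype] Subgroup.zpowers (tau hd r)

end

end AltTelescope

/-! ### Direct factors, amenability, and the question of Goldstein and Guralnick -/

/-- `H` is a direct factor of `G`: `G` is the internal direct product of `H` and some subgroup. -/
def IsDirectFactor {G : Type*} [Group G] (H : Subgroup G) : Prop :=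
  ∃ K : Subgroup G, H.Normal ∧ K.Normal ∧ IsCompl H K

/-- `H` is a direct factor of the topological group `G`: both factors are closed. -/
def IsClosedDirectFactor {G : Type*} [Group G] [TopologicalSpace G] (H : Subgroup G) : Prop :=
  IsClosed (H : Set G) ∧
    ∃ K : Subgroup G, IsClosed (K : Set G) ∧ H.Normal ∧ K.Normal ∧ IsCompl H K

/-- The map on profinite completions induced by a group homomorphism. -/
def profiniteMap {G H : Type} [Group G] [Group H] (f : G →* H) :
    ProfiniteGrp.profiniteCompletion.obj (GrpCat.of G) ⟶
      ProfiniteGrp.profiniteCompletion.obj (GrpCat.of H) :=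
  ProfiniteGrp.profiniteCompletion.map (GrpCat.ofHom f)

/-- The pair `N ≤ G` answers the question of Goldstein and Guralnick in the negative: `G` is
finitely generated and residually finite, `N` is a finitely generated normal subgroup, the image
of `N̂` in `Ĝ` is a direct factor of `Ĝ`, but `N` is not a direct factor of `G`. -/
structure IsGoldsteinGuralnickCounterexample {G : Type} [Group G] (N : Subgroup G) : Prop where
  fg : Group.FG G
  residuallyFinite : Group.ResiduallyFinite G
  fg_subgroup : N.FG
  normal : N.Normal
  isClosedDirectFactor : IsClosedDirectFactor (profiniteMap N.subtype).hom.toMonoidHom.range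
  not_isDirectFactor : ¬ IsDirectFactor N

/-- A discrete group is amenable if it carries a left-invariant finitely additive probability
measure defined on all subsets. -/
def IsAmenable (G : Type*) [Group G] : Prop :=
  ∃ μ : Set G → ℝ, (∀ A, 0 ≤ μ A) ∧ μ Set.univ = 1 ∧
    (∀ A B, Disjoint A B → μ (A ∪ B) = μ A + μ B) ∧ ∀ (g : G) (A : Set G), μ ((fun x => g * x) '' A) = μ A

end

/-! The argument rests on the self-similarity of the spine x_d, x_d x_d, …: the part of `c̃` from
place k on, written c̃^[k], is a copy of `c̃` beneath the prefix x_d^k. Once `toSeq` embeds P in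
sequences of permutations of infinite words, the transition maps disappear and most relations follow
from disjointness of supports.

Completion. As r ≤ d-3, at least three letters lie outside {x_1, …, x_r}, so an even permutation
(`rotor`) moves the words below x_d^(k+1) away without touching those moved by φ_(k+2). In the
commutator of c̃^[k] with a conjugate of c̃'^[k] only φ_(k+2)([c,c']) survives
(`commutator_tildeFrom`). Since B is perfect, and Ω_(k+2) is simple and generated by Ω_(k+1) and
φ_(k+2)(B), the group G^[k] contains Δ_(k+1)(Ω_(k+2)) (`deltaFrom_succ_mem`), hence a whole factor
Ω_(k+1). So G contains every factor and is dense in P. Conversely, a homomorphism to a finite group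
kills Δ_k(Ω_k) for large k by cardinality, which forces the images of the c̃^[k] to commute, hence
to be trivial. This is the congruence subgroup property, and N̂ = P follows.

Counterexample. N has trivial centralizer in P, so if τ were inner then ε would lie in N. Elements
of N alter tails of x_2 or x_(d-1) only within a bounded distance, whereas ε alters arbitrarily many
letters (`eps_notMem_N`). In the completion ε is available: the map N ⋊ ⟨τ⟩ → P with τ ↦ ε extends
to the completion, restricts to an isomorphism on N̂, and its kernel is the complement.

Generators. Ω_1, B and a large alternating group in level two commute inside P. Their product is
two-generated by a Goursat argument, and it generates N together with its ε-conjugate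
(`N_eq_seedHom`).

Amenability. Left multiplication by a generator carries a family of permutations with labels ξ v ∈ B
below the words v of length M+3 to a family of the same kind, up to elements of finite level
(`Absorbs`): the words are permuted and the label over x_d^(M+3) is translated. Labels are drawn
independently, from a law interpolating between the point mass at 1 and the uniform law according to
the length of the terminal run of v. At x_d^(M+3) the law is uniform, so the translation is
invisible; the permutation changes run lengths by at most 2 on O(M) words, which costs O(M^(-1/2))
in total variation. -/

open Equiv

namespace AltTelescope

/-! ### Generation of alternating groups by three-cycles -/

section ThreeCycles

variable {α : Type*} [DecidableEq α]

/-- The three-cycle `a ↦ b ↦ c ↦ a`. -/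
def threeCycle (a b c : α) : Perm α := swap a b * swap b c

theorem conj_threeCycle (g : Perm α) (a b c : α) :
    g * threeCycle a b c * g⁻¹ = threeCycle (g a) (g b) (g c) := by
  simp only [threeCycle, swap_apply_apply]
  group

theorem threeCycle_rotate {a b c : α} (hab : a ≠ b) (hac : a ≠ c) (hbc : b ≠ c) :
    threeCycle b c a = threeCycle a b c := by
  ext x
  simp only [threeCycle, Perm.mul_apply, swap_apply_def]
  grind

theorem threeCycle_inv (a b c : α) : (threeCycle a b c)⁻¹ = threeCycle c b a := by
  simp [threeCycle, swap_comm]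

theorem threeCycle_apply_of_ne {a b c x : α} (ha : x ≠ a) (hb : x ≠ b) (hc : x ≠ c) :
    threeCycle a b c x = x := by
  simp [threeCycle, swap_apply_of_ne_of_ne, *]

theorem threeCycle_apply_fst {a b c : α} (hab : a ≠ b) (hac : a ≠ c) :
    threeCycle a b c a = b := by
  simp [threeCycle, swap_apply_of_ne_of_ne, *]

theorem threeCycle_apply_snd {a b c : α} (hac : a ≠ c) (hbc : b ≠ c) :
    threeCycle a b c b = c := by
  simp [threeCycle, swap_apply_of_ne_of_ne, hac.symm, hbc.symm]

theorem sign_threeCycle [Fintype α] {a b c : α} (hab : a ≠ b) (hbc : b ≠ c) :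
    Perm.sign (threeCycle a b c) = 1 := by
  simp [threeCycle, *]

theorem IsThreeCycle.exists_eq_threeCycle [Fintype α] {σ : Perm α} (h : σ.IsThreeCycle) :
    ∃ a b c, a ≠ b ∧ a ≠ c ∧ b ≠ c ∧ σ = threeCycle a b c := by
  have h3 := h.card_support
  obtain ⟨a, ha⟩ : σ.support.Nonempty := by
    rw [← Finset.card_pos]; omega
  have h1 := h.nodup_iff_mem_support.2 ha
  have h2 := h.eq_swap_mul_swap_iff_mem_support.2 ha
  simp only [List.nodup_cons, List.mem_cons, List.not_mem_nil, or_false, not_or, not_false_eq_true,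
    List.nodup_nil, and_true] at h1
  exact ⟨a, σ a, σ (σ a), h1.1.1, h1.1.2, h1.2, h2⟩

theorem alternatingGroup_le_of_threeCycles [Fintype α] {H : Subgroup (Perm α)}
    (h : ∀ a b c, a ≠ b → a ≠ c → b ≠ c → threeCycle a b c ∈ H) : alternatingGroup α ≤ H := by
  rw [← Perm.closure_three_cycles_eq_alternating, Subgroup.closure_le]
  intro σ hσ
  obtain ⟨a, b, c, hab, hac, hbc, rfl⟩ := IsThreeCycle.exists_eq_threeCycle hσ
  exact h a b c hab hac hbc

/-- The points `a`, `b`, `c` are distinct and `H` contains the three-cycle on them. -/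
def HasThreeCycle (H : Subgroup (Perm α)) (a b c : α) : Prop :=
  (a ≠ b ∧ a ≠ c ∧ b ≠ c) ∧ threeCycle a b c ∈ H

variable {H : Subgroup (Perm α)} {a b c e : α}

theorem HasThreeCycle.rotate (h : HasThreeCycle H a b c) : HasThreeCycle H b c a := by
  obtain ⟨⟨hab, hac, hbc⟩, h⟩ := h
  exact ⟨⟨hbc, hab.symm, hac.symm⟩, by rwa [threeCycle_rotate hab hac hbc]⟩

theorem HasThreeCycle.reverse (h : HasThreeCycle H a b c) : HasThreeCycle H c b a := by
  obtain ⟨⟨hab, hac, hbc⟩, h⟩ := h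
  exact ⟨⟨hbc.symm, hac.symm, hab.symm⟩, by rw [← threeCycle_inv]; exact H.inv_mem h⟩

theorem HasThreeCycle.swap (h : HasThreeCycle H a b c) : HasThreeCycle H b a c :=
  h.reverse.rotate

/-- Two three-cycles sharing two points generate the other three-cycles on the four points. -/
theorem HasThreeCycle.shared (h : HasThreeCycle H a b c) (h' : HasThreeCycle H b c e)
    (hae : a ≠ e) : HasThreeCycle H a c e := by
  obtain ⟨⟨hab, hac, hbc⟩, h⟩ := h
  obtain ⟨⟨-, hbe, hce⟩, h'⟩ := h'
  have := H.mul_mem (H.mul_mem h' h) (H.inv_mem h')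
  rw [conj_threeCycle, threeCycle_apply_of_ne hab hac hae, threeCycle_apply_fst hbc hbe,
    threeCycle_apply_snd hbe hce] at this
  exact ⟨⟨hac, hae, hce⟩, this⟩

theorem HasThreeCycle.conj (h : HasThreeCycle H a b c) {g : Perm α} (hg : g ∈ H) :
    HasThreeCycle H (g a) (g b) (g c) := by
  obtain ⟨⟨hab, hac, hbc⟩, h⟩ := h
  refine ⟨⟨g.injective.ne hab, g.injective.ne hac, g.injective.ne hbc⟩, ?_⟩
  rw [← conj_threeCycle]
  exact H.mul_mem (H.mul_mem hg h) (H.inv_mem hg)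

/-- If `H` contains all the three-cycles `(o i j)`, then it contains all three-cycles. -/
theorem HasThreeCycle.of_base (o : α) (h : ∀ i j, i ≠ o → j ≠ o → i ≠ j → HasThreeCycle H o i j)
    (hab : a ≠ b) (hac : a ≠ c) (hbc : b ≠ c) : HasThreeCycle H a b c := by
  by_cases ha : a = o
  · subst ha; exact h _ _ hab.symm hac.symm hbc
  by_cases hb : b = o
  · subst hb; exact (h _ _ hab hbc.symm hac).swap
  by_cases hc : c = o
  · subst hc; exact (h _ _ hac hbc hab).rotate
  exact (h a b ha hb hab).swap.shared (h b c hb hc hbc) hac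

/-- The cycles (o, f i, f j) and (o, f j, f (j+1)) share o and f j, so `shared` extends the chain by
one point. -/
theorem HasThreeCycle.of_chain {n : ℕ} {f : ℕ → α} {o : α}
    (hf : ∀ i j, i < j → j < n → f i ≠ f j)
    (h : ∀ i, i + 1 < n → HasThreeCycle H o (f i) (f (i + 1))) {i j : ℕ} (hij : i < j)
    (hj : j < n) : HasThreeCycle H o (f i) (f j) := by
  induction j, hij using Nat.le_induction with
  | base => exact h i hj
  | succ j hij ih =>
    exact ((ih (by omega)).rotate.shared (h j hj).swap (hf _ _ (by omega) hj)).swap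

theorem alternatingGroup_le_of_chain [Fintype α] {n : ℕ} {f : ℕ → α} {o : α}
    (hf : ∀ i j, i < j → j < n → f i ≠ f j) (hsurj : ∀ x, x ≠ o → ∃ i < n, f i = x)
    (h : ∀ i, i + 1 < n → HasThreeCycle H o (f i) (f (i + 1))) : alternatingGroup α ≤ H := by
  refine alternatingGroup_le_of_threeCycles fun a b c hab hac hbc =>
    (HasThreeCycle.of_base o (fun x y hx hy hxy => ?_) hab hac hbc).2
  obtain ⟨i, hi, rfl⟩ := hsurj x hx
  obtain ⟨j, hj, rfl⟩ := hsurj y hy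
  rcases lt_trichotomy i j with hij | rfl | hij
  · exact HasThreeCycle.of_chain hf h hij hj
  · exact absurd rfl hxy
  · exact (HasThreeCycle.of_chain hf h hij hi).swap.rotate

end ThreeCycles

/-! ### Two-generation of alternating groups -/

/-- A group generated by at most two elements. -/
def IsTwoGenerated (G : Type*) [Group G] : Prop := ∃ a b : G, Subgroup.closure {a, b} = ⊤

theorem IsTwoGenerated.of_mulEquiv {G G' : Type*} [Group G] [Group G'] (e : G ≃* G')
    (h : IsTwoGenerated G) : IsTwoGenerated G' := by
  obtain ⟨a, b, h⟩ := h
  refine ⟨e a, e b, ?_⟩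
  have := congrArg (Subgroup.map e.toMonoidHom) h
  rw [MonoidHom.map_closure, Set.image_pair, Subgroup.map_top_of_surjective _ e.surjective] at this
  exact this

theorem isTwoGenerated_of_le {α : Type*} [Fintype α] [DecidableEq α] {x y : Perm α}
    (hx : x ∈ alternatingGroup α) (hy : y ∈ alternatingGroup α)
    (h : alternatingGroup α ≤ Subgroup.closure {x, y}) : IsTwoGenerated (alternatingGroup α) := by
  refine ⟨⟨x, hx⟩, ⟨y, hy⟩, ?_⟩
  apply Subgroup.map_injective (alternatingGroup α).subtype_injective
  rw [MonoidHom.map_closure, Set.image_pair, ← MonoidHom.range_eq_map, Subgroup.range_subtype]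
  refine le_antisymm ?_ h
  rw [Subgroup.closure_le]
  rintro _ (rfl | rfl) <;> assumption

/-- For an even number of points: a rotation of odd length, hence even, fixes `none`, and its powers
conjugate one three-cycle through `none` into a chain based there. -/
theorem isTwoGenerated_alternatingGroup_option {m : ℕ} (hm : Odd m) (hm3 : 3 ≤ m) :
    IsTwoGenerated (alternatingGroup (Option (Fin m))) := by
  obtain ⟨m, rfl⟩ : ∃ k, m = k + 1 := ⟨m - 1, by omega⟩
  have hm' : Even m := by rcases hm with ⟨k, hk⟩; exact ⟨k, by omega⟩
  set C : Perm (Option (Fin (m + 1))) := optionCongr (finRotate (m + 1)) with hC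
  let f : ℕ → Option (Fin (m + 1)) := fun i => some (Fin.ofNat (m + 1) i)
  have hne : ∀ i j, i < j → j < m + 1 → f i ≠ f j := by
    intro i j hij hj h
    simp only [f, Option.some.injEq, Fin.ext_iff, Fin.val_ofNat] at h
    rw [Nat.mod_eq_of_lt (by omega), Nat.mod_eq_of_lt (by omega)] at h
    omega
  have hCf : ∀ i, C (f i) = f (i + 1) := by
    intro i
    simp only [hC, f, optionCongr_apply, Option.map_some, finRotate_apply, Option.some.injEq]
    ext
    simp [Fin.val_add]
  set t := threeCycle none (f 0) (f 1) with ht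
  set H := Subgroup.closure {t, C} with hH
  have htH : t ∈ H := Subgroup.subset_closure (by simp)
  have hCH : C ∈ H := Subgroup.subset_closure (by simp)
  refine isTwoGenerated_of_le (x := t) (y := C) ?_ ?_ ?_
  · rw [Perm.mem_alternatingGroup, ht]
    exact sign_threeCycle (by simp [f]) (hne 0 1 (by omega) (by omega))
  · rw [Perm.mem_alternatingGroup, hC, optionCongr_sign, sign_finRotate]
    simpa using hm'.neg_one_pow
  · refine alternatingGroup_le_of_chain (n := m + 1) (f := f) (o := none) hne ?_ ?_
    · rintro (_ | x) hx
      · exact absurd rfl hx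
      · exact ⟨x, x.2, by simp [f]⟩
    · intro i
      induction i with
      | zero => exact fun _ => ⟨⟨by simp [f], by simp [f], hne 0 1 (by omega) (by omega)⟩, htH⟩
      | succ i ih =>
        intro hi
        have := (ih (by omega)).conj hCH
        rwa [hCf, hCf] at this

/-- For an odd number of points the full rotation is even. It conjugates (0 1 2) into the
three-cycles on consecutive points, which `shared` turns into a chain based at 0. -/
theorem isTwoGenerated_alternatingGroup_fin {m : ℕ} (hm : Odd m) (hm3 : 3 ≤ m) :
    IsTwoGenerated (alternatingGroup (Fin m)) := by
  obtain ⟨m, rfl⟩ : ∃ k, m = k + 1 := ⟨m - 1, by omega⟩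
  have hm' : Even m := by rcases hm with ⟨k, hk⟩; exact ⟨k, by omega⟩
  set C : Perm (Fin (m + 1)) := finRotate (m + 1) with hC
  let f : ℕ → Fin (m + 1) := fun i => Fin.ofNat (m + 1) i
  have hne : ∀ i j, i < j → j < m + 1 → f i ≠ f j := by
    intro i j hij hj h
    simp only [f, Fin.ext_iff, Fin.val_ofNat] at h
    rw [Nat.mod_eq_of_lt (by omega), Nat.mod_eq_of_lt (by omega)] at h
    omega
  have hCf : ∀ i, C (f i) = f (i + 1) := by
    intro i
    simp only [hC, f, finRotate_apply]
    ext
    simp [Fin.val_add]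
  set t := threeCycle (f 0) (f 1) (f 2) with ht
  set H := Subgroup.closure {t, C} with hH
  have htH : t ∈ H := Subgroup.subset_closure (by simp)
  have hCH : C ∈ H := Subgroup.subset_closure (by simp)
  have key : ∀ i, i + 2 < m + 1 → HasThreeCycle H (f i) (f (i + 1)) (f (i + 2)) := by
    intro i
    induction i with
    | zero =>
      exact fun _ => ⟨⟨hne _ _ (by omega) (by omega), hne _ _ (by omega) (by omega),
        hne _ _ (by omega) (by omega)⟩, htH⟩
    | succ i ih =>
      intro hi
      have := (ih (by omega)).conj hCH
      rwa [hCf, hCf, hCf] at this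
  refine isTwoGenerated_of_le (x := t) (y := C) ?_ ?_ ?_
  · rw [Perm.mem_alternatingGroup, ht]
    exact sign_threeCycle (hne 0 1 (by omega) (by omega)) (hne 1 2 (by omega) (by omega))
  · rw [Perm.mem_alternatingGroup, hC, sign_finRotate]
    simpa using hm'.neg_one_pow
  · refine alternatingGroup_le_of_chain (n := m) (f := fun i => f (i + 1)) (o := f 0)
      (fun i j hij hj => hne _ _ (by omega) (by omega)) ?_ ?_
    · intro x hx
      have hx0 : (x : ℕ) ≠ 0 := fun h0 => hx (by ext; simpa [f] using h0)
      exact ⟨x - 1, by omega, by simp [f, Nat.sub_add_cancel (Nat.one_le_iff_ne_zero.2 hx0)]⟩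
    · intro i
      induction i with
      | zero => exact fun _ => key 0 (by omega)
      | succ i ih =>
        intro hi
        exact (ih (by omega)).shared (key (i + 1) (by omega)) (hne _ _ (by omega) (by omega))

/-- Isomorphic finite sets have isomorphic alternating groups. -/
theorem IsTwoGenerated.of_equiv {α β : Type*} [Fintype α] [DecidableEq α] [Fintype β]
    [DecidableEq β] (e : α ≃ β) (h : IsTwoGenerated (alternatingGroup α)) :
    IsTwoGenerated (alternatingGroup β) :=
  h.of_mulEquiv e.altCongrHom

theorem isTwoGenerated_alternatingGroup {α : Type*} [Fintype α] [DecidableEq α]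
    (h : 3 ≤ Nat.card α) : IsTwoGenerated (alternatingGroup α) := by
  rw [Nat.card_eq_fintype_card] at h
  rcases Nat.even_or_odd (Fintype.card α) with he | ho
  · have h4 : 4 ≤ Fintype.card α := by rcases he with ⟨k, hk⟩; omega
    refine (isTwoGenerated_alternatingGroup_option (m := Fintype.card α - 1) ?_
      (by omega)).of_equiv (Fintype.equivOfCardEq ?_)
    · exact Nat.Even.sub_odd (by omega) he odd_one
    · simp; omega
  · exact (isTwoGenerated_alternatingGroup_fin ho h).of_equiv (Fintype.equivFin α).symm

/-! ### Products of simple groups, perfect groups -/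

/-- A subgroup of `A × B` projecting onto both factors is everything if `B` is simple and larger
than `A`. -/
theorem eq_top_of_map_fst_snd {A B : Type*} [Group A] [Group B] [Finite A] [Finite B]
    [IsSimpleGroup B] (hcard : Nat.card A < Nat.card B) {H : Subgroup (A × B)}
    (h1 : H.map (MonoidHom.fst A B) = ⊤) (h2 : H.map (MonoidHom.snd A B) = ⊤) : H = ⊤ := by
  -- Goursat: the slice H ∩ (1 × B) is normalized by the projection of H to B. If it were trivial, H
  -- would embed in A while mapping onto B.
  have hnormal : (H.comap (MonoidHom.inr A B)).Normal := by
    refine ⟨fun b hb g => ?_⟩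
    obtain ⟨⟨a, g'⟩, hg, rfl : g' = g⟩ : g ∈ H.map (MonoidHom.snd A B) := h2 ▸ Subgroup.mem_top g
    have := H.mul_mem (H.mul_mem hg hb) (H.inv_mem hg)
    simpa [Subgroup.mem_comap] using this
  rcases hnormal.eq_bot_or_eq_top with h | h
  · exfalso
    have hinj : Function.Injective ((MonoidHom.fst A B).comp H.subtype) := by
      rw [injective_iff_map_eq_one]
      rintro ⟨⟨a, b⟩, hab⟩ (rfl : a = 1)
      have : b ∈ H.comap (MonoidHom.inr A B) := hab
      rw [h, Subgroup.mem_bot] at this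
      subst this
      rfl
    have hsurj : Function.Surjective ((MonoidHom.snd A B).comp H.subtype) := by
      intro b
      obtain ⟨x, hx, rfl⟩ : b ∈ H.map (MonoidHom.snd A B) := h2 ▸ Subgroup.mem_top b
      exact ⟨⟨x, hx⟩, rfl⟩
    have := Nat.card_le_card_of_injective _ hinj
    have := Nat.card_le_card_of_surjective _ hsurj
    omega
  · rw [eq_top_iff]
    rintro ⟨a, b⟩ -
    obtain ⟨⟨a', b'⟩, hg, rfl : a' = a⟩ : a ∈ H.map (MonoidHom.fst A B) := h1 ▸ Subgroup.mem_top a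
    have hb : b'⁻¹ * b ∈ H.comap (MonoidHom.inr A B) := h ▸ Subgroup.mem_top _
    have := H.mul_mem hg hb
    simpa using this

theorem closure_pair_prod_eq_top {A B : Type*} [Group A] [Group B] [Finite A] [Finite B]
    [IsSimpleGroup B] (hcard : Nat.card A < Nat.card B) {a a' : A} {b b' : B}
    (ha : Subgroup.closure {a, a'} = ⊤) (hb : Subgroup.closure {b, b'} = ⊤) :
    Subgroup.closure {(a, b), (a', b')} = ⊤ := by
  apply eq_top_of_map_fst_snd hcard
  · rw [MonoidHom.map_closure, Set.image_pair]; exact ha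
  · rw [MonoidHom.map_closure, Set.image_pair]; exact hb

/-- A homomorphism with commuting values is trivial on a perfect group. -/
theorem map_eq_one_of_commute {A B : Type*} [Group A] [Group B] (hA : commutator A = ⊤)
    (f : A →* B) (h : ∀ x y, f x * f y = f y * f x) (x : A) : f x = 1 := by
  have : commutator A ≤ f.ker := by
    rw [commutator_def, Subgroup.commutator_le]
    intro x _ y _
    rw [MonoidHom.mem_ker, map_commutatorElement, commutatorElement_eq_one_iff_mul_comm]
    exact h x y
  exact this (hA ▸ Subgroup.mem_top x)

/-- A homomorphism from a simple group to a smaller finite group is trivial. -/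
theorem map_eq_one_of_card_lt {A B : Type*} [Group A] [Group B] [IsSimpleGroup A] [Finite B]
    (f : A →* B) (h : Nat.card B < Nat.card A) (x : A) : f x = 1 := by
  rcases f.normal_ker.eq_bot_or_eq_top with h' | h'
  · have := Nat.card_le_card_of_injective f ((MonoidHom.ker_eq_bot_iff f).1 h')
    omega
  · exact (h' ▸ Subgroup.mem_top x : x ∈ f.ker)

/-! ### Supports of permutations -/

/-- The group of the permutations that fix every point outside `S`. -/
def supportedOn {α : Type*} (S : Set α) : Subgroup (Perm α) where
  carrier := {f | ∀ w, w ∉ S → f w = w}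
  one_mem' _ _ := rfl
  mul_mem' {f g} hf hg w hw := by rw [Perm.mul_apply, hg w hw, hf w hw]
  inv_mem' {f} hf w hw := by rw [Perm.inv_eq_iff_eq]; exact (hf w hw).symm

theorem supportedOn_mono {α : Type*} {S T : Set α} (h : S ⊆ T) : supportedOn S ≤ supportedOn T :=
  fun _ hf w hw => hf w fun h' => hw (h h')

theorem mem_of_mem_supportedOn {α : Type*} {S : Set α} {f : Perm α} (hf : f ∈ supportedOn S)
    {w : α} (hw : w ∈ S) : f w ∈ S := by
  by_contra h
  rw [f.injective (hf _ h)] at h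
  exact h hw

theorem commute_of_supportedOn {α : Type*} {S T : Set α} (h : Disjoint S T) {f g : Perm α}
    (hf : f ∈ supportedOn S) (hg : g ∈ supportedOn T) : f * g = g * f := by
  ext w
  rw [Set.disjoint_left] at h
  rw [Perm.mul_apply, Perm.mul_apply]
  by_cases hS : w ∈ S
  · rw [hg w (h hS), hg _ (h (mem_of_mem_supportedOn hf hS))]
  · rw [hf w hS]
    by_cases hT : w ∈ T
    · rw [hf _ fun h' => h h' (mem_of_mem_supportedOn hg hT)]
    · rw [hg w hT, hf w hS]

theorem conj_mem_supportedOn {α : Type*} {S T : Set α} {f g : Perm α} (hf : f ∈ supportedOn S)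
    (h : ∀ w ∈ S, g w ∈ T) : g * f * g⁻¹ ∈ supportedOn T := by
  intro w hw
  have h1 : f (g.symm w) = g.symm w := hf _ fun h' => hw (by simpa using h _ h')
  change g (f (g.symm w)) = w
  rw [h1, apply_symm_apply]

end AltTelescope

open Equiv

namespace AltTelescope

/-! ### Infinite words -/

/-- Infinite words over `Fin d`. -/
abbrev InfWord (d : ℕ) : Type := ℕ → Fin d

section Words

variable {d : ℕ}

/-- The prefix of length `l`. -/
def pre (l : ℕ) (w : InfWord d) : Word d l := fun i => w i

/-- The word without its first `l` letters. -/
def drop (l : ℕ) (w : InfWord d) : InfWord d := fun i => w (l + i)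

/-- Concatenation of a finite and an infinite word. -/
def app {l : ℕ} (v : Word d l) (u : InfWord d) : InfWord d :=
  fun i => if h : i < l then v ⟨i, h⟩ else u (i - l)

theorem app_of_lt {l : ℕ} (v : Word d l) (u : InfWord d) {i : ℕ} (h : i < l) :
    app v u i = v ⟨i, h⟩ := dif_pos h

theorem app_of_le {l : ℕ} (v : Word d l) (u : InfWord d) {i : ℕ} (h : l ≤ i) :
    app v u i = u (i - l) := dif_neg (not_lt.2 h)

@[simp] theorem pre_app {l : ℕ} (v : Word d l) (u : InfWord d) : pre l (app v u) = v := by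
  funext i
  exact app_of_lt v u i.2

@[simp] theorem drop_app {l : ℕ} (v : Word d l) (u : InfWord d) : drop l (app v u) = u := by
  funext i
  simp [drop, app]

@[simp] theorem app_pre_drop (l : ℕ) (w : InfWord d) : app (pre l w) (drop l w) = w := by
  funext i
  by_cases h : i < l
  · rw [app_of_lt _ _ h]; rfl
  · rw [app_of_le _ _ (by omega), drop]; congr 1; omega

/-- The action on the prefixes of length `l`. -/
def act (d l : ℕ) : Perm (Word d l) →* Perm (InfWord d) where
  toFun σ :=
    { toFun := fun w => app (σ (pre l w)) (drop l w)
      invFun := fun w => app (σ⁻¹ (pre l w)) (drop l w)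
      left_inv := fun w => by simp
      right_inv := fun w => by simp }
  map_one' := by ext1 w; simp
  map_mul' σ τ := by ext1 w; simp

theorem act_apply {l : ℕ} (σ : Perm (Word d l)) (w : InfWord d) :
    act d l σ w = app (σ (pre l w)) (drop l w) := rfl

theorem act_app {l : ℕ} (σ : Perm (Word d l)) (v : Word d l) (u : InfWord d) :
    act d l σ (app v u) = app (σ v) u := by simp [act_apply]

theorem act_apply_of_le {l : ℕ} (σ : Perm (Word d l)) (w : InfWord d) {i : ℕ} (h : l ≤ i) :
    act d l σ w i = w i := by
  rw [act_apply, app_of_le _ _ h, drop]; congr 1; omega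

theorem pre_act {l : ℕ} (σ : Perm (Word d l)) (w : InfWord d) :
    pre l (act d l σ w) = σ (pre l w) := by simp [act_apply]

/-- The reason for passing to infinite words: the transition maps become the identity there. -/
theorem act_prefixHom {l k : ℕ} (h : l ≤ k) (σ : Perm (Word d l)) :
    act d k (prefixHom h σ) = act d l σ := by
  ext1 w
  funext i
  by_cases hk : i < k
  · rw [act_apply, app_of_lt _ _ hk]
    change prefixFun h σ (pre k w) ⟨i, hk⟩ = _
    by_cases hl : i < l
    · rw [act_apply, app_of_lt _ _ hl]
      simp only [prefixFun, hl, dif_pos]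
      rfl
    · rw [act_apply_of_le _ _ (by omega)]
      simp only [prefixFun, hl, dif_neg, not_false_eq_true]
      rfl
  · rw [act_apply_of_le _ _ (by omega), act_apply_of_le _ _ (by omega)]

theorem act_injective [Nonempty (Fin d)] (l : ℕ) : Function.Injective (act d l) := by
  intro σ τ h
  obtain ⟨x⟩ := ‹Nonempty (Fin d)›
  ext1 v
  have := congrArg (pre l) (DFunLike.congr_fun h (app v fun _ => x))
  simpa [pre_act] using this

/-- The permutation `v u ↦ v F(v)(u)` with `v` of length `m`. -/
def graft (d m : ℕ) : (Word d m → Perm (InfWord d)) →* Perm (InfWord d) where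
  toFun F :=
    { toFun := fun w => app (pre m w) (F (pre m w) (drop m w))
      invFun := fun w => app (pre m w) ((F (pre m w))⁻¹ (drop m w))
      left_inv := fun w => by simp
      right_inv := fun w => by simp }
  map_one' := by ext1 w; simp
  map_mul' F F' := by ext1 w; simp

theorem graft_apply {m : ℕ} (F : Word d m → Perm (InfWord d)) (w : InfWord d) :
    graft d m F w = app (pre m w) (F (pre m w) (drop m w)) := rfl

theorem graft_app {m : ℕ} (F : Word d m → Perm (InfWord d)) (v : Word d m) (u : InfWord d) :
    graft d m F (app v u) = app v (F v u) := by simp [graft_apply]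

theorem graft_mem_supportedOn {m : ℕ} {F : Word d m → Perm (InfWord d)} {S : Set (Word d m)}
    (hF : ∀ v, v ∉ S → F v = 1) : graft d m F ∈ supportedOn (pre m ⁻¹' S) := by
  intro w hw
  rw [graft_apply, hF _ hw, Perm.one_apply, app_pre_drop]

theorem act_mul_graft {m : ℕ} (σ : Perm (Word d m)) (F : Word d m → Perm (InfWord d)) :
    act d m σ * graft d m F = graft d m (fun v => F (σ⁻¹ v)) * act d m σ := by
  ext1 w
  simp [act_apply, graft_apply]

theorem pre_eq_const_iff {m : ℕ} {w : InfWord d} {x : Fin d} :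
    (pre m w = fun _ => x) ↔ ∀ i < m, w i = x :=
  ⟨fun h i hi => congrFun h ⟨i, hi⟩, fun h => funext fun i => h i i.2⟩

/-- The permutation group of a coordinate of `P`. -/
def toPerm (d l : ℕ) : Omega d l →* Perm (Word d l) := (alternatingGroup (Word d l)).subtype

theorem toPerm_injective (d l : ℕ) : Function.Injective (toPerm d l) := Subtype.val_injective

/-- The embedding of `P` into the group of sequences of permutations of infinite words. -/
def toSeq (d : ℕ) : PGroup d →* (ℕ → Perm (InfWord d)) where
  toFun g n := act d (n + 1) (toPerm d (n + 1) (g n))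
  map_one' := by funext n; simp
  map_mul' g h := by funext n; simp

theorem toSeq_apply (g : PGroup d) (n : ℕ) :
    toSeq d g n = act d (n + 1) (toPerm d (n + 1) (g n)) := rfl

theorem toSeq_injective [Nonempty (Fin d)] : Function.Injective (toSeq d) := fun _ _ e =>
  funext fun n => toPerm_injective _ _ (act_injective _ (congrFun e n))

theorem act_iota {l k : ℕ} (h : l ≤ k) (ω : Omega d l) :
    act d k (toPerm d k (iota h ω)) = act d l (toPerm d l ω) := act_prefixHom h _

end Words

/-! ### The permutations `φ_k(c)` and their products -/

section Spine

variable {d : ℕ} (hd : 5 ≤ d) (r : ℕ)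

noncomputable section

/-- The permutation of infinite words given by `φ_{k+2}(c)`. -/
def phiPerm (k : ℕ) : BGroup d r →* Perm (InfWord d) :=
  (act d (k + 2)).comp ((toPerm d (k + 2)).comp (phi hd r k))

/-- The infinite words with prefix `x_d^k`. -/
def spineSet (k : ℕ) : Set (InfWord d) := {w | ∀ i < k, w i = lastLetter hd}

/-- The infinite words with prefix `x_d^k x`, `x ∈ {x_1, …, x_r}`. -/
def phiSet (k : ℕ) : Set (InfWord d) := {w | w ∈ spineSet hd k ∧ (w k : ℕ) < r}

theorem phi_apply_spine (k : ℕ) (c : BGroup d r) (p : {p : Fin d × Fin d // (p.1 : ℕ) < r}) :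
    toPerm d (k + 2) (phi hd r k c) (spine hd r k p) = spine hd r k ((c : Perm _) p) :=
  Perm.viaEmbedding_apply _ _ _

theorem phi_apply_of_notMem (k : ℕ) (c : BGroup d r) {v : Word d (k + 2)}
    (hv : v ∉ Set.range (spine hd r k)) : toPerm d (k + 2) (phi hd r k c) v = v :=
  Perm.viaEmbedding_apply_of_notMem _ _ _ hv

theorem spine_apply_eq_append (k : ℕ) (p : {p : Fin d × Fin d // (p.1 : ℕ) < r}) :
    spine hd r k p = Fin.append (fun _ : Fin k => lastLetter hd) ![p.1.1, p.1.2] := rfl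

theorem spine_apply_of_lt (k : ℕ) (p : {p : Fin d × Fin d // (p.1 : ℕ) < r}) {i : ℕ} (hi : i < k) :
    spine hd r k p ⟨i, by omega⟩ = lastLetter hd := by
  have : (⟨i, by omega⟩ : Fin (k + 2)) = Fin.castAdd 2 ⟨i, hi⟩ := rfl
  rw [this, spine_apply_eq_append, Fin.append_left]

theorem spine_apply_fst (k : ℕ) (p : {p : Fin d × Fin d // (p.1 : ℕ) < r}) :
    spine hd r k p ⟨k, by omega⟩ = p.1.1 := by
  have : (⟨k, by omega⟩ : Fin (k + 2)) = Fin.natAdd k 0 := rfl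
  rw [this, spine_apply_eq_append, Fin.append_right]
  rfl

theorem spine_apply_snd (k : ℕ) (p : {p : Fin d × Fin d // (p.1 : ℕ) < r}) :
    spine hd r k p ⟨k + 1, by omega⟩ = p.1.2 := by
  have : (⟨k + 1, by omega⟩ : Fin (k + 2)) = Fin.natAdd k 1 := rfl
  rw [this, spine_apply_eq_append, Fin.append_right]
  rfl

theorem lt_of_mem_phiSet {k : ℕ} {w : InfWord d} (hw : w ∈ phiSet hd r k) : (w k : ℕ) < r := hw.2

theorem pre_eq_spine {k : ℕ} {w : InfWord d} (hw : w ∈ phiSet hd r k) :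
    pre (k + 2) w = spine hd r k ⟨(w k, w (k + 1)), lt_of_mem_phiSet hd r hw⟩ := by
  funext ⟨i, hi⟩
  rcases lt_or_ge i k with h | h
  · rw [spine_apply_of_lt hd r k _ h]; exact hw.1 i h
  · rcases (show i = k ∨ i = k + 1 by omega) with rfl | rfl
    · rw [spine_apply_fst]; rfl
    · rw [spine_apply_snd]; rfl

theorem mem_phiSet_of_pre_eq {k : ℕ} {w : InfWord d} {p : {p : Fin d × Fin d // (p.1 : ℕ) < r}}
    (h : pre (k + 2) w = spine hd r k p) : w ∈ phiSet hd r k := by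
  refine ⟨fun i hi => ?_, ?_⟩
  · have := congrFun h ⟨i, by omega⟩
    rwa [spine_apply_of_lt hd r k _ hi] at this
  · have := congrFun h ⟨k, by omega⟩
    rw [spine_apply_fst] at this
    have h' : w k = p.1.1 := this
    rw [h']; exact p.2

theorem phiPerm_apply_of_notMem {k : ℕ} (c : BGroup d r) {w : InfWord d}
    (hw : w ∉ phiSet hd r k) : phiPerm hd r k c w = w := by
  change act d (k + 2) (toPerm d (k + 2) (phi hd r k c)) w = w
  rw [act_apply, phi_apply_of_notMem, app_pre_drop]
  rintro ⟨p, hp⟩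
  exact hw (mem_phiSet_of_pre_eq hd r hp.symm)

theorem phiPerm_apply {k : ℕ} (c : BGroup d r) {w : InfWord d} (hw : w ∈ phiSet hd r k) :
    phiPerm hd r k c w = app (spine hd r k ((c : Perm _) ⟨(w k, w (k + 1)), lt_of_mem_phiSet hd r hw⟩))
      (drop (k + 2) w) := by
  change act d (k + 2) (toPerm d (k + 2) (phi hd r k c)) w = _
  rw [act_apply, pre_eq_spine hd r hw, phi_apply_spine]

theorem phiPerm_mem_supportedOn (k : ℕ) (c : BGroup d r) :
    phiPerm hd r k c ∈ supportedOn (phiSet hd r k) :=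
  fun _ hw => phiPerm_apply_of_notMem hd r c hw

theorem app_const_mem_phiSet {k j : ℕ} {u : InfWord d} :
    app (fun _ : Fin k => lastLetter hd) u ∈ phiSet hd r (k + j) ↔ u ∈ phiSet hd r j := by
  simp only [phiSet, spineSet, Set.mem_ofPred_eq]
  rw [app_of_le _ _ (by omega), Nat.add_sub_cancel_left]
  refine and_congr_left fun _ => ⟨fun h i hi => ?_, fun h i hi => ?_⟩
  · have := h (k + i) (by omega)
    rwa [app_of_le _ _ (by omega), Nat.add_sub_cancel_left] at this
  · rcases lt_or_ge i k with h' | h'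
    · rw [app_of_lt _ _ h']
    · rw [app_of_le _ _ h']; exact h _ (by omega)

/-- Self-similarity: φ at place k+j is φ at place j, performed beneath x_d^k. -/
theorem phiPerm_eq_graft (k j : ℕ) (c : BGroup d r) :
    phiPerm hd r (k + j) c =
      graft d k (Pi.mulSingle (fun _ => lastLetter hd) (phiPerm hd r j c)) := by
  ext1 w
  by_cases hk : pre k w = fun _ => lastLetter hd
  · obtain ⟨u, rfl⟩ : ∃ u, w = app (fun _ : Fin k => lastLetter hd) u :=
      ⟨drop k w, by rw [← hk, app_pre_drop]⟩
    rw [graft_app, Pi.mulSingle_eq_same]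
    by_cases hu : u ∈ phiSet hd r j
    · have hu' := (app_const_mem_phiSet hd r (k := k)).2 hu
      rw [phiPerm_apply hd r c hu, phiPerm_apply hd r c hu']
      have e : (⟨(app (fun _ : Fin k => lastLetter hd) u (k + j),
          app (fun _ : Fin k => lastLetter hd) u (k + j + 1)), lt_of_mem_phiSet hd r hu'⟩ :
          {p : Fin d × Fin d // (p.1 : ℕ) < r}) = ⟨(u j, u (j + 1)), lt_of_mem_phiSet hd r hu⟩ := by
        apply Subtype.ext
        simp only [Prod.mk.injEq]
        constructor
        · rw [app_of_le _ _ (by omega)]; congr 1; omega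
        · rw [app_of_le _ _ (by omega)]; congr 1; omega
      rw [e]
      generalize ((c : Perm {p : Fin d × Fin d // (p.1 : ℕ) < r}) ⟨(u j, u (j + 1)), lt_of_mem_phiSet hd r hu⟩) = p
      funext i
      rcases lt_or_ge i (k + j + 2) with hi | hi
      · rw [app_of_lt _ _ hi]
        rcases lt_or_ge i k with h1 | h1
        · rw [spine_apply_of_lt _ _ _ _ (by omega), app_of_lt _ _ h1]
        · rw [app_of_le _ _ h1, app_of_lt _ _ (by omega)]
          obtain ⟨i, rfl⟩ := Nat.exists_eq_add_of_le h1
          simp only [Nat.add_sub_cancel_left]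
          rcases lt_or_ge i j with h2 | h2
          · rw [spine_apply_of_lt _ _ _ _ (by omega), spine_apply_of_lt _ _ _ _ h2]
          · rcases (show i = j ∨ i = j + 1 by omega) with rfl | rfl
            · rw [spine_apply_fst, spine_apply_fst]
            · rw [spine_apply_snd]; exact spine_apply_snd _ _ _ _
      · rw [app_of_le _ _ hi, app_of_le _ _ (show k ≤ i by omega), app_of_le _ _ (by omega)]
        simp only [drop]
        rw [app_of_le _ _ (by omega)]
        congr 1; omega
    · rw [phiPerm_apply_of_notMem hd r c hu,
        phiPerm_apply_of_notMem hd r c (mt (app_const_mem_phiSet hd r).1 hu)]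
  · rw [graft_apply, Pi.mulSingle_eq_of_ne hk, Perm.one_apply, app_pre_drop]
    apply phiPerm_apply_of_notMem
    rintro ⟨h, -⟩
    exact hk (pre_eq_const_iff.2 fun i hi => h i (by omega))

/-- The product of the `φ_{k+2}(c)`, `k < n`. -/
def tildePerm (c : BGroup d r) : ℕ → Perm (InfWord d)
  | 0 => 1
  | n + 1 => tildePerm c n * phiPerm hd r n c

theorem toSeq_tilde (c : BGroup d r) (n : ℕ) :
    toSeq d (tilde hd r c) n = tildePerm hd r c n := by
  have h1 : toSeq d (tilde hd r c) n = (List.ofFn fun k : Fin n => phiPerm hd r k c).prod := by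
    rw [toSeq_apply, tilde, map_list_prod, map_list_prod, List.map_ofFn, List.map_ofFn]
    congr 2
    funext k
    exact act_iota _ _
  rw [h1]
  induction n with
  | zero => simp [tildePerm]
  | succ n ih =>
    rw [List.ofFn_succ_last, List.prod_append, tildePerm]
    have := ih (by rw [toSeq_apply, tilde, map_list_prod, map_list_prod, List.map_ofFn,
      List.map_ofFn]; congr 2; funext k; exact act_iota _ _)
    simp only [Fin.val_castSucc, this, List.prod_singleton, Fin.val_last]

theorem spineSet_anti {k l : ℕ} (h : k ≤ l) : spineSet hd l ⊆ spineSet hd k :=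
  fun _ hw i hi => hw i (by omega)

theorem phiSet_subset (k : ℕ) : phiSet hd r k ⊆ spineSet hd k := fun _ hw => hw.1

/-- The letter at position k is one of x_1, …, x_r on one side and x_d on the other. Hence the
factors of `c̃` have disjoint supports. -/
theorem disjoint_phiSet_spineSet (hr : r < d) {k l : ℕ} (h : k < l) :
    Disjoint (phiSet hd r k) (spineSet hd l) := by
  rw [Set.disjoint_left]
  rintro w ⟨-, hw⟩ hw'
  rw [hw' k h] at hw
  simp only [lastLetter] at hw
  omega

/-- The product of the `φ_{j+2}(c)`, `k ≤ j < n`. -/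
def tildeTail (k n : ℕ) (c : BGroup d r) : Perm (InfWord d) :=
  (tildePerm hd r c k)⁻¹ * tildePerm hd r c n

theorem tildeTail_self (k : ℕ) (c : BGroup d r) : tildeTail hd r k k c = 1 :=
  inv_mul_cancel _

theorem tildeTail_succ_right (k n : ℕ) (c : BGroup d r) :
    tildeTail hd r k (n + 1) c = tildeTail hd r k n c * phiPerm hd r n c := by
  rw [tildeTail, tildeTail, tildePerm, mul_assoc]

theorem tildeTail_left (k n : ℕ) (c : BGroup d r) :
    tildeTail hd r k n c = phiPerm hd r k c * tildeTail hd r (k + 1) n c := by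
  rw [tildeTail, tildeTail, tildePerm]; group

theorem tildeTail_mem_supportedOn {k n : ℕ} (h : k ≤ n) (c : BGroup d r) :
    tildeTail hd r k n c ∈ supportedOn (spineSet hd k) := by
  induction n, h using Nat.le_induction with
  | base => rw [tildeTail_self]; exact one_mem _
  | succ n h ih =>
    rw [tildeTail_succ_right]
    exact mul_mem ih (supportedOn_mono ((phiSet_subset hd r n).trans (spineSet_anti hd h))
      (phiPerm_mem_supportedOn hd r n c))

/-- The self-similarity of the φ's, multiplied up: a tail of `c̃` is a truncation of `c̃` beneath
x_d^k, so what holds for `tildePerm` transfers to tails. -/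
theorem tildeTail_eq_graft (k n : ℕ) (c : BGroup d r) :
    tildeTail hd r k (k + n) c =
      graft d k (Pi.mulSingle (fun _ => lastLetter hd) (tildePerm hd r c n)) := by
  induction n with
  | zero => simp [tildeTail_self, tildePerm]
  | succ n ih =>
    rw [← add_assoc, tildeTail_succ_right, ih, phiPerm_eq_graft, ← map_mul, ← Pi.mulSingle_mul,
      tildePerm]

theorem tildePerm_mem_act (n : ℕ) (c : BGroup d r) :
    tildePerm hd r c n ∈ (act d (n + 1)).range := by
  rw [← toSeq_tilde]; exact ⟨_, rfl⟩

theorem phiPerm_mul_tildePerm (hr : r < d) {n k : ℕ} (h : n ≤ k) (c c' : BGroup d r) :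
    phiPerm hd r k c * tildePerm hd r c' n = tildePerm hd r c' n * phiPerm hd r k c := by
  induction n with
  | zero => simp [tildePerm]
  | succ n ih =>
    have : phiPerm hd r n c' * phiPerm hd r k c = phiPerm hd r k c * phiPerm hd r n c' :=
      commute_of_supportedOn ((disjoint_phiSet_spineSet hd r hr (show n < k by omega)).mono_right
        (phiSet_subset hd r k)) (phiPerm_mem_supportedOn hd r n c')
        (phiPerm_mem_supportedOn hd r k c)
    rw [tildePerm, ← mul_assoc, ih (by omega), mul_assoc, ← this, mul_assoc]

theorem tildePerm_mul (hr : r < d) (n : ℕ) (c c' : BGroup d r) :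
    tildePerm hd r (c * c') n = tildePerm hd r c n * tildePerm hd r c' n := by
  induction n with
  | zero => simp [tildePerm]
  | succ n ih =>
    rw [tildePerm, tildePerm, tildePerm, ih, map_mul, mul_assoc, mul_assoc,
      ← mul_assoc (phiPerm hd r n c) (tildePerm hd r c' n),
      phiPerm_mul_tildePerm hd r hr le_rfl, mul_assoc]

theorem nonempty_fin {d : ℕ} (hd : 5 ≤ d) : Nonempty (Fin d) := ⟨lastLetter hd⟩

end

end Spine

end AltTelescope

open Equiv

open scoped commutatorElement

/-! ### The shifted elements Δ_k(ω) and c̃^[k], and their commutators. -/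

namespace AltTelescope

/-- Since q commutes with p' and q', and q' commutes with p, only p and p' interact. -/
theorem commutatorElement_mul_mul {G : Type*} [Group G] {p q p' q' : G}
    (h2 : q * p' = p' * q) (h3 : q * q' = q' * q) (h4 : q' * p = p * q') :
    ⁅p * q, p' * q'⁆ = ⁅p, p'⁆ := by
  have e1 : p * q * (p' * q') = p * p' * (q * q') := by
    rw [mul_assoc, ← mul_assoc q, h2]; group
  have e2 : p' * q' * (p * q) = p' * p * (q * q') := by
    rw [mul_assoc, ← mul_assoc q', h4, h3]; group
  rw [commutatorElement_def, mul_assoc, ← mul_inv_rev, e1, e2, commutatorElement_def]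
  group

theorem exists_alternatingGroup_apply_eq {α : Type*} [Fintype α] [DecidableEq α]
    (h : 4 ≤ Nat.card α) {a b a' b' : α} (hab : a ≠ b) (hab' : a' ≠ b') :
    ∃ σ ∈ alternatingGroup α, σ a = a' ∧ σ b = b' := by
  have h1 := alternatingGroup.isMultiplyPretransitive α
  have h2 : MulAction.IsMultiplyPretransitive (alternatingGroup α) α 2 :=
    MulAction.isMultiplyPretransitive_of_le (n := Nat.card α - 2) (by omega) (by simp)
  obtain ⟨g, hg1, hg2⟩ := (MulAction.is_two_pretransitive_iff).1 h2 hab hab'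
  exact ⟨g, g.2, hg1, hg2⟩

theorem viaEmbedding_threeCycle {α β : Type*} [DecidableEq α] [DecidableEq β] (f : α ↪ β)
    (a b c : α) : (threeCycle a b c).viaEmbedding f = threeCycle (f a) (f b) (f c) := by
  ext x
  by_cases hx : x ∈ Set.range f
  · obtain ⟨x, rfl⟩ := hx
    rw [Perm.viaEmbedding_apply]
    simp only [threeCycle, Perm.mul_apply]
    rw [f.injective.swap_apply, f.injective.swap_apply]
  · rw [Perm.viaEmbedding_apply_of_notMem _ _ _ hx, threeCycle_apply_of_ne] <;>
    · rintro rfl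
      exact hx ⟨_, rfl⟩

section

variable {d : ℕ}

/-- The element of `Ω_l` given by an even permutation. -/
def ofSign {l : ℕ} (σ : Perm (Word d l)) (h : Perm.sign σ = 1) : Omega d l :=
  ⟨σ, Perm.mem_alternatingGroup.2 h⟩

@[simp] theorem toPerm_ofSign {l : ℕ} (σ : Perm (Word d l)) (h : Perm.sign σ = 1) :
    toPerm d l (ofSign σ h) = σ := rfl

theorem card_word (d l : ℕ) : Nat.card (Word d l) = d ^ l := by simp

theorem card_word_ge (hd : 5 ≤ d) (l : ℕ) : 5 ≤ Nat.card (Word d (l + 1)) := by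
  rw [card_word, pow_succ]
  have := Nat.one_le_pow l d (by omega)
  nlinarith

theorem isSimpleGroup_omega (hd : 5 ≤ d) (l : ℕ) : IsSimpleGroup (Omega d (l + 1)) :=
  alternatingGroup.isSimpleGroup (card_word_ge hd l)

/-- The element `(1, …, 1, ω, ι_{k,k+1}(ω), …)` of `P`. -/
def deltaFrom (d k : ℕ) : Omega d (k + 1) →* PGroup d where
  toFun ω n := if h : k ≤ n then iota (Nat.succ_le_succ h) ω else 1
  map_one' := by funext n; split <;> simp
  map_mul' ω ω' := by funext n; simp only [Pi.mul_apply]; split <;> simp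

theorem toSeq_deltaFrom (k : ℕ) (ω : Omega d (k + 1)) (n : ℕ) :
    toSeq d (deltaFrom d k ω) n = if k ≤ n then act d (k + 1) (toPerm d (k + 1) ω) else 1 := by
  rw [toSeq_apply]
  change act d (n + 1) (toPerm d (n + 1)
    (if h : k ≤ n then iota (Nat.succ_le_succ h) ω else 1)) = _
  split
  · rw [act_iota]
  · simp

theorem deltaFrom_zero (ω : Omega d 1) : deltaFrom d 0 ω = Delta ω := by
  funext n
  change (if h : 0 ≤ n then iota (Nat.succ_le_succ h) ω else 1) = _
  rw [dif_pos (Nat.zero_le n)]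
  rfl

/-- The embedding of a factor into `P`. -/
abbrev factor (d k : ℕ) : Omega d (k + 1) →* PGroup d :=
  MonoidHom.mulSingle (fun n : ℕ => Omega d (n + 1)) k

/-- Once Δ_(k+1) of Ω_(k+2) is available in a group, this makes the factor with index k and Δ_k
interchangeable. -/
theorem deltaFrom_eq (hd : 5 ≤ d) (k : ℕ) (ω : Omega d (k + 1)) :
    deltaFrom d k ω = factor d k ω * deltaFrom d (k + 1) (iota (Nat.le_succ _) ω) := by
  have := nonempty_fin hd
  apply toSeq_injective
  funext n
  rw [map_mul, Pi.mul_apply, toSeq_deltaFrom, toSeq_deltaFrom, toSeq_apply]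
  rcases lt_trichotomy n k with h | rfl | h
  · simp [h.not_ge, (show ¬ k + 1 ≤ n by omega), Pi.mulSingle_eq_of_ne h.ne]
  · simp
  · simp [h.le, (show k + 1 ≤ n by omega), Pi.mulSingle_eq_of_ne h.ne', act_iota]

theorem factor_mul_deltaFrom (k : ℕ) (ω : Omega d (k + 1)) (ω' : Omega d (k + 2)) :
    factor d k ω * deltaFrom d (k + 1) ω' = deltaFrom d (k + 1) ω' * factor d k ω := by
  funext n
  by_cases h : n = k
  · subst h
    simp [deltaFrom]
  · simp [Pi.mulSingle_eq_of_ne h]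

end

noncomputable section

variable {d : ℕ} (hd : 5 ≤ d) (r : ℕ)

/-- The element `c̃^[k]` of `P`, with the coordinates `∏_{k ≤ j < n} φ_{j+2}(c)`. -/
def tildeFun (c : BGroup d r) : ℕ → PGroup d
  | 0 => tilde hd r c
  | k + 1 => (deltaFrom d (k + 1) (phi hd r k c))⁻¹ * tildeFun c k

theorem toSeq_tildeFun (c : BGroup d r) (k n : ℕ) :
    toSeq d (tildeFun hd r c k) n = if k ≤ n then tildeTail hd r k n c else 1 := by
  induction k with
  | zero => simp [tildeFun, toSeq_tilde, tildeTail, tildePerm]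
  | succ k ih =>
    rw [tildeFun, map_mul, Pi.mul_apply, ih, map_inv, Pi.inv_apply, toSeq_deltaFrom]
    change (if k + 1 ≤ n then phiPerm hd r k c else 1)⁻¹ * _ = _
    rcases lt_trichotomy n k with h | rfl | h
    · simp [h.not_ge, (show ¬ k + 1 ≤ n by omega)]
    · simp [tildeTail_self]
    · simp [h.le, (show k + 1 ≤ n by omega), tildeTail_left hd r k n c]

theorem tildeTail_mul (hr : r < d) {k n : ℕ} (h : k ≤ n) (c c' : BGroup d r) :
    tildeTail hd r k n (c * c') = tildeTail hd r k n c * tildeTail hd r k n c' := by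
  obtain ⟨n, rfl⟩ := Nat.exists_eq_add_of_le h
  rw [tildeTail_eq_graft, tildeTail_eq_graft, tildeTail_eq_graft, tildePerm_mul hd r hr,
    Pi.mulSingle_mul, map_mul]

/-- The homomorphism `c ↦ c̃^[k]`. -/
def tildeFrom (hr : r < d) (k : ℕ) : BGroup d r →* PGroup d :=
  MonoidHom.mk' (fun c => tildeFun hd r c k) fun c c' => by
    have := nonempty_fin hd
    apply toSeq_injective
    funext n
    rw [map_mul, Pi.mul_apply, toSeq_tildeFun, toSeq_tildeFun, toSeq_tildeFun]
    split
    · rw [tildeTail_mul hd r hr ‹_›]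
    · simp

/-- The word `x_d^k x`. -/
def spineWord (k : ℕ) (x : Fin d) : Word d (k + 1) := fun i => if (i : ℕ) < k then lastLetter hd else x

theorem spineWord_injective (k : ℕ) : Function.Injective (spineWord hd k) := fun x y h => by
  have := congrFun h (Fin.last k)
  simpa [spineWord] using this

theorem pre_eq_spineWord_iff {k : ℕ} {x : Fin d} {w : InfWord d} :
    pre (k + 1) w = spineWord hd k x ↔ w ∈ spineSet hd k ∧ w k = x := by
  constructor
  · intro h
    refine ⟨fun i hi => ?_, ?_⟩
    · have := congrFun h ⟨i, by omega⟩
      simpa [spineWord, hi] using! this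
    · have := congrFun h (Fin.last k)
      simpa [spineWord] using! this
  · rintro ⟨h1, h2⟩
    funext ⟨i, hi⟩
    simp only [spineWord]
    split
    · exact h1 i ‹_›
    · obtain rfl : i = k := by omega
      exact h2

theorem lastLetter_ne {x : ℕ} (hx : x + 1 < d) : lastLetter hd ≠ ⟨x, by omega⟩ := by
  simp only [lastLetter, ne_eq, Fin.mk.injEq]; omega

/-- A rotation of three words `x_d^k x` with `x` not among `x_1, …, x_r`. -/
def rotor (hrd : r + 3 ≤ d) (k : ℕ) : Omega d (k + 1) :=
  ofSign (threeCycle (spineWord hd k (lastLetter hd)) (spineWord hd k ⟨r, by omega⟩)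
    (spineWord hd k ⟨r + 1, by omega⟩)) <| sign_threeCycle
      ((spineWord_injective hd k).ne (lastLetter_ne hd (by omega)))
      ((spineWord_injective hd k).ne (by simp))

theorem act_rotor_mem_supportedOn (hrd : r + 3 ≤ d) (k : ℕ) :
    act d (k + 1) (toPerm d (k + 1) (rotor hd r hrd k)) ∈
      supportedOn {w | w ∈ spineSet hd k ∧ r ≤ (w k : ℕ)} := by
  intro w hw
  have key : ∀ x : Fin d, r ≤ (x : ℕ) → pre (k + 1) w ≠ spineWord hd k x := by
    rintro x hx h
    obtain ⟨h1, rfl⟩ := (pre_eq_spineWord_iff hd).1 h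
    exact hw ⟨h1, hx⟩
  rw [act_apply, rotor, toPerm_ofSign, threeCycle_apply_of_ne, app_pre_drop]
  · exact key _ (by simp only [lastLetter]; omega)
  · exact key _ le_rfl
  · exact key _ (by simp)

theorem act_rotor_apply_mem (hrd : r + 3 ≤ d) (k : ℕ) {w : InfWord d}
    (hw : w ∈ spineSet hd (k + 1)) :
    act d (k + 1) (toPerm d (k + 1) (rotor hd r hrd k)) w ∈
      {w | w ∈ spineSet hd k ∧ (w k : ℕ) = r} := by
  have h1 : pre (k + 1) w = spineWord hd k (lastLetter hd) :=
    (pre_eq_spineWord_iff hd).2 ⟨spineSet_anti hd (Nat.le_succ k) hw, hw k (by omega)⟩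
  have h2 : pre (k + 1) (act d (k + 1) (toPerm d (k + 1) (rotor hd r hrd k)) w) =
      spineWord hd k ⟨r, by omega⟩ := by
    rw [pre_act, h1, rotor, toPerm_ofSign, threeCycle_apply_fst]
    · exact (spineWord_injective hd k).ne (lastLetter_ne hd (by omega))
    · exact (spineWord_injective hd k).ne (lastLetter_ne hd (by omega))
  obtain ⟨h3, h4⟩ := (pre_eq_spineWord_iff hd).1 h2
  exact ⟨h3, by rw [h4]⟩

theorem disjoint_of_letter {k : ℕ} {S T : Set (InfWord d)}
    (h : ∀ w w' : InfWord d, w ∈ S → w' ∈ T → w k ≠ w' k) : Disjoint S T :=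
  Set.disjoint_left.2 fun w hw hw' => h w w hw hw' rfl

variable (hr : r < d)

theorem toSeq_tildeFrom (c : BGroup d r) (k n : ℕ) :
    toSeq d (tildeFrom hd r hr k c) n = if k ≤ n then tildeTail hd r k n c else 1 :=
  toSeq_tildeFun hd r c k n

theorem tildeFrom_zero (c : BGroup d r) : tildeFrom hd r hr 0 c = tilde hd r c := rfl

theorem tildeFrom_eq (k : ℕ) (c : BGroup d r) :
    tildeFrom hd r hr k c =
      deltaFrom d (k + 1) (phi hd r k c) * tildeFrom hd r hr (k + 1) c := by
  change tildeFun hd r c k = _ * ((deltaFrom d (k + 1) (phi hd r k c))⁻¹ * tildeFun hd r c k)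
  group

/-- The commutator formula behind the structure of the telescope group. -/
theorem commutator_tildeFrom (hrd : r + 3 ≤ d) (k : ℕ) (c c' : BGroup d r) :
    ⁅tildeFrom hd r hr k c, deltaFrom d k (rotor hd r hrd k) * tildeFrom hd r hr k c' *
      (deltaFrom d k (rotor hd r hrd k))⁻¹⁆ = deltaFrom d (k + 1) (phi hd r k ⁅c, c'⁆) := by
  have := nonempty_fin hd
  apply toSeq_injective
  funext n
  simp only [commutatorElement_def, map_mul, map_inv, Pi.mul_apply, Pi.inv_apply]
  simp only [← commutatorElement_def, toSeq_deltaFrom, toSeq_tildeFrom]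
  rcases lt_trichotomy n k with h | rfl | h
  · simp [h.not_ge, (show ¬ k + 1 ≤ n by omega)]
  · simp [tildeTail_self]
  simp only [h.le, if_true, (show k + 1 ≤ n by omega)]
  -- Each element is φ_(k+2) times a tail beneath x_d^(k+1). Conjugation by the rotor moves the
  -- second tail beneath x_d^k x_(r+1), so the letter at position k separates the tails from each
  -- other and from the φ's.
  rw [tildeTail_left hd r k n c, tildeTail_left hd r k n c']
  set A := act d (k + 1) (toPerm d (k + 1) (rotor hd r hrd k)) with hA
  have hAsupp := act_rotor_mem_supportedOn hd r hrd k
  have hp := phiPerm_mem_supportedOn hd r k c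
  have hp' := phiPerm_mem_supportedOn hd r k c'
  have hq := tildeTail_mem_supportedOn hd r (show k + 1 ≤ n by omega) c
  have hq' := conj_mem_supportedOn (g := A)
    (tildeTail_mem_supportedOn hd r (show k + 1 ≤ n by omega) c')
    (fun w hw => act_rotor_apply_mem hd r hrd k hw)
  have hphi : ∀ w ∈ phiSet hd r k, (w k : ℕ) < r := fun w hw => hw.2
  have hspine : ∀ w ∈ spineSet hd (k + 1), (w k : ℕ) = d - 1 := fun w hw => by
    rw [hw k (by omega)]; rfl
  -- The rotor moves only words whose letter at position k lies outside x_1, …, x_r.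
  have hAp' : A * phiPerm hd r k c' = phiPerm hd r k c' * A :=
    commute_of_supportedOn (disjoint_of_letter (k := k) fun w w' hw hw' e => by
      have h1 := hw.2
      have h2 := hphi w' hw'
      rw [e] at h1
      omega) hAsupp hp'
  have e : A * (phiPerm hd r k c' * tildeTail hd r (k + 1) n c') * A⁻¹ =
      phiPerm hd r k c' * (A * tildeTail hd r (k + 1) n c' * A⁻¹) := by
    rw [← mul_assoc, hAp']; group
  rw [e, commutatorElement_mul_mul]
  · simp only [commutatorElement_def, ← map_inv, ← map_mul]; rfl
  · refine commute_of_supportedOn (disjoint_of_letter (k := k) fun w w' hw hw' e => ?_) hq hp'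
    have h1 := hspine w hw
    have h2 := hphi w' hw'
    rw [e] at h1
    omega
  · refine commute_of_supportedOn (disjoint_of_letter (k := k) fun w w' hw hw' e => ?_) hq hq'
    have h1 := hspine w hw
    have h2 := hw'.2
    rw [e] at h1
    omega
  · refine commute_of_supportedOn (disjoint_of_letter (k := k) fun w w' hw hw' e => ?_) hq' hp
    have h1 := hw.2
    have h2 := hphi w' hw'
    rw [e] at h1
    omega

/-! ### Generation of `Ω_{k+2}` -/

theorem init_prefixHom {k : ℕ} (σ : Perm (Word d (k + 1))) (v : Word d (k + 2)) :
    Fin.init (prefixHom (Nat.le_succ (k + 1)) σ v) = σ (Fin.init v) := by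
  funext i
  change prefixFun _ σ v i.castSucc = _
  simp only [prefixFun, Fin.val_castSucc, i.2, dif_pos]
  rfl

theorem mem_range_spine {k : ℕ} {v : Word d (k + 2)} {x : Fin d} (hx : (x : ℕ) < r)
    (hv : Fin.init v = spineWord hd k x) : v ∈ Set.range (spine hd r k) := by
  refine ⟨⟨(x, v (Fin.last _)), hx⟩, ?_⟩
  funext ⟨i, hi⟩
  rcases lt_or_ge i (k + 1) with h | h
  · have := congrFun hv ⟨i, h⟩
    simp only [Fin.init, spineWord] at this
    change v ⟨i, hi⟩ = _ at this
    rw [this]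
    split
    · rw [spine_apply_of_lt hd r k _ ‹_›]
    · obtain rfl : i = k := by omega
      rw [spine_apply_fst]
  · obtain rfl : i = k + 1 := by omega
    rw [spine_apply_snd]; rfl

/-- As r ≥ 2, φ(B) contains all three-cycles on the words extending x_d^k x_1 or x_d^k x_2.
Conjugation by Ω_(k+1) reaches any pair of prefixes, and `shared` then links three different
prefixes. -/
theorem eq_top_of_range_le (hr2 : 2 ≤ r) {k : ℕ} {H : Subgroup (Omega d (k + 2))}
    (h1 : (iota (Nat.le_succ (k + 1)) : Omega d (k + 1) →* _).range ≤ H)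
    (h2 : (phi hd r k).range ≤ H) : H = ⊤ := by
  set H' := H.map (toPerm d (k + 2)) with hH'
  have hbase : ∀ a b c, a ∈ Set.range (spine hd r k) → b ∈ Set.range (spine hd r k) →
      c ∈ Set.range (spine hd r k) → a ≠ b → a ≠ c → b ≠ c → HasThreeCycle H' a b c := by
    rintro _ _ _ ⟨p, rfl⟩ ⟨q, rfl⟩ ⟨t, rfl⟩ hab hac hbc
    refine ⟨⟨hab, hac, hbc⟩, ?_⟩
    rw [← viaEmbedding_threeCycle]
    refine ⟨phi hd r k ⟨threeCycle p q t, Perm.mem_alternatingGroup.2 (sign_threeCycle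
      (fun h => hab (by rw [h])) (fun h => hbc (by rw [h])))⟩, h2 ⟨_, rfl⟩, rfl⟩
  have htwo : ∀ u u' a b c, u ≠ u' → (Fin.init a = u ∨ Fin.init a = u') →
      (Fin.init b = u ∨ Fin.init b = u') → (Fin.init c = u ∨ Fin.init c = u') →
      a ≠ b → a ≠ c → b ≠ c → HasThreeCycle H' a b c := by
    intro u u' a b c huu ha hb hc hab hac hbc
    -- Double transitivity of Ω_(k+1) carries the two model prefixes to u and u'.
    obtain ⟨σ, hσ, hσ1, hσ2⟩ := exists_alternatingGroup_apply_eq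
      ((by norm_num : 4 ≤ 5).trans (card_word_ge hd k))
      ((spineWord_injective hd k).ne (show (⟨0, by omega⟩ : Fin d) ≠ ⟨1, by omega⟩ by simp)) huu
    set g := prefixHom (Nat.le_succ (k + 1)) σ with hg
    have hgH : g ∈ H' := ⟨iota (Nat.le_succ (k + 1)) ⟨σ, hσ⟩, h1 ⟨_, rfl⟩, rfl⟩
    have hmem : ∀ a, (Fin.init a = u ∨ Fin.init a = u') → g⁻¹ a ∈ Set.range (spine hd r k) := by
      intro a ha
      have e : Fin.init (g⁻¹ a) = σ⁻¹ (Fin.init a) := by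
        rw [hg, ← map_inv, init_prefixHom]
      rcases ha with ha | ha
      · refine mem_range_spine hd r (x := ⟨0, by omega⟩) (by simp; omega) ?_
        rw [e, ha, ← hσ1]; simp
      · refine mem_range_spine hd r (x := ⟨1, by omega⟩) (by simp; omega) ?_
        rw [e, ha, ← hσ2]; simp
    have := (hbase _ _ _ (hmem a ha) (hmem b hb) (hmem c hc) (g⁻¹.injective.ne hab)
      (g⁻¹.injective.ne hac) (g⁻¹.injective.ne hbc)).conj hgH
    simpa using this
  have htwo' : ∀ u u' a b c, (Fin.init a = u ∨ Fin.init a = u') →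
      (Fin.init b = u ∨ Fin.init b = u') → (Fin.init c = u ∨ Fin.init c = u') →
      a ≠ b → a ≠ c → b ≠ c → HasThreeCycle H' a b c := by
    intro u u' a b c ha hb hc
    by_cases huu : u = u'
    · subst huu
      have : Nontrivial (Word d (k + 1)) :=
        Finite.one_lt_card_iff_nontrivial.1 (by have := card_word_ge hd k; omega)
      obtain ⟨u', hu'⟩ := exists_ne u
      exact htwo u u' a b c hu'.symm (by tauto) (by tauto) (by tauto)
    · exact htwo u u' a b c huu ha hb hc
  have hall : ∀ a b c, a ≠ b → a ≠ c → b ≠ c → HasThreeCycle H' a b c := by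
    intro a b c hab hac hbc
    by_cases e1 : Fin.init a = Fin.init b
    · exact htwo' (Fin.init b) (Fin.init c) a b c (by tauto) (by tauto) (by tauto) hab hac hbc
    by_cases e2 : Fin.init c = Fin.init b
    · exact htwo' (Fin.init b) (Fin.init a) a b c (by tauto) (by tauto) (by tauto) hab hac hbc
    -- The remaining case has b's prefix different from those of a and c. A sibling b' of b gives (a
    -- b' b) and (b' b c), each using at most two prefixes.
    have : Nontrivial (Fin d) := Fin.nontrivial_iff_two_le.2 (by omega)
    obtain ⟨y, hy⟩ := exists_ne (b (Fin.last _))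
    set b' : Word d (k + 2) := Fin.snoc (α := fun _ => Fin d) (Fin.init b) y with hb'
    have hbi : Fin.init b' = Fin.init b := Fin.init_snoc (α := fun _ => Fin d) _ _
    have hbb : b ≠ b' := by
      intro h
      have := congrFun h (Fin.last _)
      rw [hb', Fin.snoc_last] at this
      exact hy this.symm
    have hab' : a ≠ b' := fun h => e1 (by rw [h, hbi])
    have hcb' : c ≠ b' := fun h => e2 (by rw [h, hbi])
    exact (htwo' (Fin.init a) (Fin.init b) a b' b (by tauto) (by tauto) (by tauto) hab' hab
      hbb.symm).shared (htwo' (Fin.init b) (Fin.init c) b' b c (by tauto) (by tauto) (by tauto)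
      hbb.symm hcb'.symm hbc) hac
  have hle := alternatingGroup_le_of_threeCycles fun a b c hab hac hbc => (hall a b c hab hac hbc).2
  rw [eq_top_iff]
  intro ω _
  obtain ⟨ω', hω', e⟩ : toPerm d (k + 2) ω ∈ H' := hle ω.2
  rwa [← toPerm_injective _ _ e]

/-- `{x_1, …, x_r} × X` has `r d` elements. -/
def pairEquiv : {p : Fin d × Fin d // (p.1 : ℕ) < r} ≃ Fin r × Fin d where
  toFun p := (⟨p.1.1, p.2⟩, p.1.2)
  invFun q := ⟨(⟨q.1, by omega⟩, q.2), q.1.2⟩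
  left_inv _ := rfl
  right_inv _ := rfl

include hr in
theorem card_pair : Nat.card {p : Fin d × Fin d // (p.1 : ℕ) < r} = r * d := by
  rw [Nat.card_congr (pairEquiv r hr)]; simp

include hd hr in
theorem card_pair_ge (hr2 : 2 ≤ r) :
    5 ≤ Nat.card {p : Fin d × Fin d // (p.1 : ℕ) < r} := by
  rw [card_pair r hr]; nlinarith

include hd hr in
theorem isSimpleGroup_BGroup (hr2 : 2 ≤ r) :
    IsSimpleGroup (BGroup d r) :=
  alternatingGroup.isSimpleGroup (card_pair_ge hd r hr hr2)

include hd hr in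
theorem commutator_BGroup (hr2 : 2 ≤ r) :
    commutator (BGroup d r) = ⊤ :=
  commutator_alternatingGroup_eq_top (card_pair_ge hd r hr hr2)

theorem phi_injective (k : ℕ) : Function.Injective (phi hd r k) := fun c c' h => by
  have := congrArg (toPerm d (k + 2)) h
  exact Subtype.ext (Perm.viaEmbeddingHom_injective (spine hd r k) this)

/-! ### The groups `G^[k]` -/

/-- The group `G^[k]`, generated by the elements `Δ_k(ω)` and `c̃^[k]`. -/
def telescopeFrom (k : ℕ) : Subgroup (PGroup d) :=
  Subgroup.closure (Set.range (deltaFrom d k) ∪ Set.range (tildeFrom hd r hr k))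

theorem telescopeFrom_zero : telescopeFrom hd r hr 0 = telescopeGroup hd r := by
  have : (deltaFrom d 0 : Omega d 1 → PGroup d) = Delta := funext deltaFrom_zero
  rw [telescopeFrom, telescopeGroup, this]
  rfl

theorem deltaFrom_mem (k : ℕ) (ω : Omega d (k + 1)) :
    deltaFrom d k ω ∈ telescopeFrom hd r hr k := Subgroup.subset_closure (Or.inl ⟨ω, rfl⟩)

theorem tildeFrom_mem (k : ℕ) (c : BGroup d r) :
    tildeFrom hd r hr k c ∈ telescopeFrom hd r hr k := Subgroup.subset_closure (Or.inr ⟨c, rfl⟩)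

variable (hr2 : 2 ≤ r) (hrd : r + 3 ≤ d)

include hr2 hrd in
-- The commutator formula gives the claim for commutators in B, and B is perfect.
theorem deltaFrom_phi_mem (k : ℕ) (c : BGroup d r) :
    deltaFrom d (k + 1) (phi hd r k c) ∈ telescopeFrom hd r hr k := by
  have : commutator (BGroup d r) ≤
      ((telescopeFrom hd r hr k).comap ((deltaFrom d (k + 1)).comp (phi hd r k))) := by
    rw [commutator_def, Subgroup.commutator_le]
    intro x _ y _
    rw [Subgroup.mem_comap, MonoidHom.comp_apply, ← commutator_tildeFrom hd r hr hrd]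
    have h1 := tildeFrom_mem hd r hr k x
    have h2 := mul_mem (mul_mem (deltaFrom_mem hd r hr k (rotor hd r hrd k))
      (tildeFrom_mem hd r hr k y)) (inv_mem (deltaFrom_mem hd r hr k (rotor hd r hrd k)))
    exact mul_mem (mul_mem (mul_mem h1 h2) (inv_mem h1)) (inv_mem h2)
  exact this (commutator_BGroup hd r hr hr2 ▸ Subgroup.mem_top c)

include hr2 hrd in
-- The ω with Δ_(k+1)(ω) in G^[k] form a subgroup containing φ(B) and normalized by ι(Ω_(k+1)).
-- These two generate Ω_(k+2), so the subgroup is normal and nontrivial in a simple group.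
theorem deltaFrom_succ_mem (k : ℕ) (ω : Omega d (k + 2)) :
    deltaFrom d (k + 1) ω ∈ telescopeFrom hd r hr k := by
  set U := (telescopeFrom hd r hr k).comap (deltaFrom d (k + 1)) with hU
  have hphi : (phi hd r k).range ≤ U := by
    rintro _ ⟨c, rfl⟩
    exact deltaFrom_phi_mem hd r hr hr2 hrd k c
  have hconj : ∀ ω : Omega d (k + 1), ∀ u ∈ U,
      iota (Nat.le_succ (k + 1)) ω * u * (iota (Nat.le_succ (k + 1)) ω)⁻¹ ∈ U := by
    intro ω u hu
    have h1 := mul_mem (mul_mem (deltaFrom_mem hd r hr k ω) hu)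
      (inv_mem (deltaFrom_mem hd r hr k ω))
    rw [hU, Subgroup.mem_comap, map_mul, map_mul, map_inv]
    -- Δ_k(ω) conjugates Δ_(k+1)(u) as Δ_(k+1)(ι ω) does, because the coordinate k does not
    -- interfere.
    rw [deltaFrom_eq hd, factor_mul_deltaFrom, mul_assoc _ _ (deltaFrom d (k + 1) u),
      factor_mul_deltaFrom] at h1
    convert h1 using 1
    group
  have hnorm : Subgroup.normalizer (U : Set (Omega d (k + 2))) = ⊤ := by
    apply eq_top_of_range_le hd r hr2
    · rintro _ ⟨ω, rfl⟩
      rw [Subgroup.mem_normalizer_iff]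
      intro u
      refine ⟨hconj ω u, fun h => ?_⟩
      have := hconj ω⁻¹ _ h
      rw [map_inv] at this
      convert this using 1
      group
    · exact hphi.trans Subgroup.le_normalizer
  have hnormal : U.Normal := Subgroup.normalizer_eq_top_iff.1 hnorm
  have := isSimpleGroup_omega hd (k + 1)
  rcases hnormal.eq_bot_or_eq_top with h | h
  · exfalso
    have := isSimpleGroup_BGroup hd r hr hr2
    obtain ⟨c, hc⟩ := exists_ne (1 : BGroup d r)
    have h1 : phi hd r k c ∈ U := hphi ⟨c, rfl⟩
    rw [h, Subgroup.mem_bot, map_eq_one_iff _ (phi_injective hd r k)] at h1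
    exact hc h1
  · exact (h ▸ Subgroup.mem_top ω : ω ∈ U)

include hr2 hrd in
theorem tildeFrom_succ_mem (k : ℕ) (c : BGroup d r) :
    tildeFrom hd r hr (k + 1) c ∈ telescopeFrom hd r hr k := by
  have h := mul_mem (inv_mem (deltaFrom_phi_mem hd r hr hr2 hrd k c)) (tildeFrom_mem hd r hr k c)
  rw [tildeFrom_eq] at h
  convert h using 1
  group

include hr2 hrd in
theorem telescopeFrom_succ_le (k : ℕ) : telescopeFrom hd r hr (k + 1) ≤ telescopeFrom hd r hr k := by
  rw [telescopeFrom, Subgroup.closure_le]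
  rintro _ (⟨ω, rfl⟩ | ⟨c, rfl⟩)
  · exact deltaFrom_succ_mem hd r hr hr2 hrd k ω
  · exact tildeFrom_succ_mem hd r hr hr2 hrd k c

include hr2 hrd in
theorem telescopeFrom_anti : Antitone (telescopeFrom hd r hr) :=
  antitone_nat_of_succ_le (telescopeFrom_succ_le hd r hr hr2 hrd)

include hr2 hrd in
theorem factor_mem (k : ℕ) (ω : Omega d (k + 1)) : factor d k ω ∈ telescopeFrom hd r hr k := by
  have h := mul_mem (deltaFrom_mem hd r hr k ω) (inv_mem (deltaFrom_succ_mem hd r hr hr2 hrd k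
    (iota (Nat.le_succ _) ω)))
  rwa [deltaFrom_eq hd, mul_inv_cancel_right] at h

include hr2 hrd in
theorem telescopeFrom_eq (k : ℕ) :
    telescopeFrom hd r hr k = (factor d k).range ⊔ telescopeFrom hd r hr (k + 1) := by
  apply le_antisymm
  · rw [telescopeFrom, Subgroup.closure_le]
    rintro _ (⟨ω, rfl⟩ | ⟨c, rfl⟩)
    · rw [deltaFrom_eq hd]
      exact mul_mem (Subgroup.mem_sup_left ⟨ω, rfl⟩) (Subgroup.mem_sup_right (deltaFrom_mem hd r hr _ _))
    · rw [tildeFrom_eq]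
      exact Subgroup.mem_sup_right (mul_mem (deltaFrom_mem hd r hr _ _) (tildeFrom_mem hd r hr _ _))
  · refine sup_le ?_ (telescopeFrom_succ_le hd r hr hr2 hrd k)
    rintro _ ⟨ω, rfl⟩
    exact factor_mem hd r hr hr2 hrd k ω

end

end AltTelescope

open Equiv

open scoped commutatorElement

namespace AltTelescope

noncomputable section

variable {d : ℕ} (hd : 5 ≤ d) (r : ℕ)

/-! ### Pointwise description of `c̃` -/

theorem tildePerm_apply_of_notMem {n : ℕ} (c : BGroup d r) {w : InfWord d}
    (hw : ∀ j < n, w ∉ phiSet hd r j) : tildePerm hd r c n w = w := by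
  induction n with
  | zero => rfl
  | succ n ih =>
    rw [tildePerm, Perm.mul_apply, phiPerm_apply_of_notMem hd r c (hw n (by omega)),
      ih fun j hj => hw j (by omega)]

theorem disjoint_phiSet (hr : r < d) {j k : ℕ} (h : j ≠ k) :
    Disjoint (phiSet hd r j) (phiSet hd r k) := by
  rcases lt_or_gt_of_ne h with h | h
  · exact (disjoint_phiSet_spineSet hd r hr h).mono_right (phiSet_subset hd r k)
  · exact ((disjoint_phiSet_spineSet hd r hr h).mono_right (phiSet_subset hd r j)).symm

theorem tildePerm_apply_of_mem (hr : r < d) {n j : ℕ} (hj : j < n) (c : BGroup d r)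
    {w : InfWord d} (hw : w ∈ phiSet hd r j) : tildePerm hd r c n w = phiPerm hd r j c w := by
  induction n with
  | zero => omega
  | succ n ih =>
    rw [tildePerm, Perm.mul_apply]
    rcases (show j = n ∨ j < n by omega) with rfl | h
    · have h1 := mem_of_mem_supportedOn (phiPerm_mem_supportedOn hd r j c) hw
      exact tildePerm_apply_of_notMem hd r c fun i hi h2 =>
        Set.disjoint_left.1 (disjoint_phiSet hd r hr hi.ne) h2 h1
    · rw [phiPerm_apply_of_notMem hd r c
        (Set.disjoint_left.1 (disjoint_phiSet hd r hr h.ne) hw), ih h]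

theorem phiPerm_apply_of_le (j : ℕ) (c : BGroup d r) (w : InfWord d) {i : ℕ} (hi : j + 2 ≤ i) :
    phiPerm hd r j c w i = w i := act_apply_of_le _ _ hi

/-- A word is moved by `c̃` at a single place. -/
theorem tildePerm_apply_cases (hr : r < d) (n : ℕ) (c : BGroup d r) (w : InfWord d) :
    tildePerm hd r c n w = w ∨ ∃ j < n, w ∈ phiSet hd r j ∧
      tildePerm hd r c n w ∈ phiSet hd r j ∧ ∀ i, j + 2 ≤ i → tildePerm hd r c n w i = w i := by
  by_cases h : ∃ j < n, w ∈ phiSet hd r j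
  · obtain ⟨j, hj, hw⟩ := h
    right
    rw [tildePerm_apply_of_mem hd r hr hj c hw]
    exact ⟨j, hj, hw, mem_of_mem_supportedOn (phiPerm_mem_supportedOn hd r j c) hw,
      fun i hi => phiPerm_apply_of_le hd r j c w hi⟩
  · push Not at h
    exact Or.inl (tildePerm_apply_of_notMem hd r c h)

/-! ### The letterwise involution of the infinite words -/

/-- The letterwise action of `δ` on the infinite words. -/
def deltaInf : Perm (InfWord d) := Equiv.piCongrRight fun _ => delta hd

theorem deltaInf_apply (w : InfWord d) (i : ℕ) : deltaInf hd w i = delta hd (w i) := rfl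

theorem deltaInf_mul_self : deltaInf hd * deltaInf hd = 1 := by
  ext1 w
  funext i
  exact DFunLike.congr_fun (delta_mul_delta hd) (w i)

theorem delta_delta (x : Fin d) : delta hd (delta hd x) = x :=
  DFunLike.congr_fun (delta_mul_delta hd) x

theorem delta_first : delta hd ⟨0, by omega⟩ = lastLetter hd := by
  rw [delta, Perm.mul_apply, swap_apply_of_ne_of_ne (a := (⟨1, by omega⟩ : Fin d)),
    swap_apply_left]
  · rfl
  · simp
  · simp only [ne_eq, Fin.mk.injEq]; omega

theorem delta_last : delta hd (lastLetter hd) = ⟨0, by omega⟩ := by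
  rw [← delta_first, delta_delta]

theorem delta_second : delta hd ⟨1, by omega⟩ = ⟨d - 2, by omega⟩ := by
  rw [delta, Perm.mul_apply, swap_apply_left, swap_apply_of_ne_of_ne]
  · simp only [ne_eq, Fin.mk.injEq]; omega
  · simp only [ne_eq, Fin.mk.injEq]; omega

theorem deltaInf_mul_act {l : ℕ} (σ : Perm (Word d l)) :
    deltaInf hd * act d l σ * deltaInf hd =
      act d l (diagHom d l (delta hd) * σ * diagHom d l (delta hd)) := by
  ext1 w
  funext i
  rcases lt_or_ge i l with h | h
  · rw [act_apply, app_of_lt _ _ h, Perm.mul_apply, Perm.mul_apply, deltaInf_apply, act_apply,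
      app_of_lt _ _ h]
    rfl
  · rw [act_apply_of_le _ _ h, Perm.mul_apply, Perm.mul_apply, deltaInf_apply,
      act_apply_of_le _ _ h, deltaInf_apply, delta_delta]

theorem eps_inv : (eps hd)⁻¹ = eps hd := inv_eq_of_mul_eq_one_left (eps_mul_eps hd)

theorem conjEps_apply (g : PGroup d) : conjEps hd g = eps hd * g * eps hd := by
  rw [conjEps, MulAut.conj_apply, inv_inv, eps_inv]

theorem toPerm_eps (n : ℕ) : toPerm d (n + 1) (eps hd n) = diagHom d (n + 1) (delta hd) := rfl

theorem toSeq_conjEps (g : PGroup d) (n : ℕ) :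
    toSeq d (conjEps hd g) n = deltaInf hd * toSeq d g n * deltaInf hd := by
  rw [toSeq_apply, toSeq_apply, deltaInf_mul_act, conjEps_apply]
  change act d (n + 1) (toPerm d (n + 1) (eps hd n * g n * eps hd n)) = _
  rw [map_mul (toPerm d (n + 1)), map_mul (toPerm d (n + 1)), toPerm_eps]

/-! ### `ε` does not belong to `N` -/

/-- The elements of `P` preserving the eventually constant words with tails `x_2` or `x_{d-1}`
up to a bounded shift. -/
def PreservesTails (g : PGroup d) : Prop :=
  ∃ L : ℕ, ∀ x : Fin d, x = ⟨1, by omega⟩ ∨ x = ⟨d - 2, by omega⟩ → ∀ (l n : ℕ) (w : InfWord d),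
    (∀ j, l ≤ j → w j = x) → ∀ j, l + L ≤ j → toSeq d g n w j = x

theorem PreservesTails.mul {g h : PGroup d} (hg : PreservesTails hd g) (hh : PreservesTails hd h) :
    PreservesTails hd (g * h) := by
  obtain ⟨L, hL⟩ := hg
  obtain ⟨L', hL'⟩ := hh
  refine ⟨L' + L, fun x hx l n w hw j hj => ?_⟩
  rw [map_mul, Pi.mul_apply, Perm.mul_apply]
  exact hL x hx (l + L') n _ (fun j hj => hL' x hx l n w hw j hj) j (by omega)

theorem PreservesTails.conjEps {g : PGroup d} (hg : PreservesTails hd g) :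
    PreservesTails hd (conjEps hd g) := by
  obtain ⟨L, hL⟩ := hg
  refine ⟨L, fun x hx l n w hw j hj => ?_⟩
  have h2 : delta hd ⟨d - 2, by omega⟩ = ⟨1, by omega⟩ := by rw [← delta_second hd, delta_delta hd]
  -- δ exchanges x_2 and x_(d-1), so both tails are needed for stability under ε.
  have hx' : delta hd x = ⟨1, by omega⟩ ∨ delta hd x = ⟨d - 2, by omega⟩ := by
    rcases hx with rfl | rfl
    · exact Or.inr (delta_second hd)
    · exact Or.inl h2
  rw [toSeq_conjEps, Perm.mul_apply, Perm.mul_apply, deltaInf_apply hd,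
    hL (delta hd x) hx' l n (deltaInf hd w) (fun j hj => by rw [deltaInf_apply hd, hw j hj]) j hj,
    delta_delta hd]

theorem preservesTails_delta (ω : Omega d 1) : PreservesTails hd (Delta ω) := by
  refine ⟨1, fun x _ l n w hw j hj => ?_⟩
  rw [← deltaFrom_zero, toSeq_deltaFrom, if_pos (Nat.zero_le n), act_apply_of_le _ _ (by omega)]
  exact hw j (by omega)

/-- A word with letter x ≠ x_d from position l on has a prefix x_d^i only for i ≤ l, so `c̃` changes
nothing from position l+2 on. -/
theorem preservesTails_tilde (hr : r < d) (c : BGroup d r) :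
    PreservesTails hd (tilde hd r c) := by
  refine ⟨2, fun x hx l n w hw j hj => ?_⟩
  rw [toSeq_tilde]
  rcases tildePerm_apply_cases hd r hr n c w with h | ⟨i, -, h1, -, h2⟩
  · rw [h]; exact hw j (by omega)
  · have hil : i ≤ l := by
      by_contra! hlt
      have h3 := h1.1 l hlt
      rw [hw l le_rfl] at h3
      rcases hx with rfl | rfl
      · simp only [lastLetter, Fin.mk.injEq] at h3; omega
      · simp only [lastLetter, Fin.mk.injEq] at h3; omega
    rw [h2 j (by omega)]
    exact hw j (by omega)

/-- The group of the elements which, with their inverses, preserve tails. -/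
def tailGroup : Subgroup (PGroup d) where
  carrier := {g | PreservesTails hd g ∧ PreservesTails hd g⁻¹}
  one_mem' := by
    have h : PreservesTails hd (1 : PGroup d) := ⟨0, fun x _ l n w hw j hj => by
      rw [map_one]; exact hw j hj⟩
    exact ⟨h, by rwa [inv_one]⟩
  mul_mem' hx hy := ⟨hx.1.mul hd hy.1, by rw [mul_inv_rev]; exact hy.2.mul hd hx.2⟩
  inv_mem' hx := ⟨hx.2, by rw [inv_inv]; exact hx.1⟩

theorem N_le_tailGroup (hr : r < d) : N hd r ≤ tailGroup hd := by
  have h : telescopeGroup hd r ≤ tailGroup hd := by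
    rw [telescopeGroup, Subgroup.closure_le]
    rintro _ (⟨ω, rfl⟩ | ⟨c, rfl⟩)
    · refine ⟨preservesTails_delta hd ω, ?_⟩
      rw [← deltaFrom_zero, ← map_inv, deltaFrom_zero]
      exact preservesTails_delta hd _
    · refine ⟨preservesTails_tilde hd r hr c, ?_⟩
      rw [← tildeFrom_zero hd r hr, ← map_inv]
      exact preservesTails_tilde hd r hr _
  refine sup_le h ?_
  rintro _ ⟨g, hg, rfl⟩
  refine ⟨(h hg).1.conjEps hd, ?_⟩
  change PreservesTails hd (AltTelescope.conjEps hd g)⁻¹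
  rw [← map_inv]
  exact (h hg).2.conjEps hd

/-- The coordinate of ε with index L turns the first L+1 letters of the constant word x_2 into
x_(d-1), so no bound L works for all coordinates. -/
theorem eps_notMem_N (hr : r < d) : eps hd ∉ N hd r := by
  intro h
  obtain ⟨L, hL⟩ := (N_le_tailGroup hd r hr h).1
  have h1 := hL ⟨1, by omega⟩ (Or.inl rfl) 0 L (fun _ => ⟨1, by omega⟩) (fun _ _ => rfl) L (by omega)
  rw [toSeq_apply, toPerm_eps, act_apply, app_of_lt _ _ (by omega)] at h1
  change delta hd ⟨1, by omega⟩ = _ at h1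
  rw [delta_second] at h1
  simp only [Fin.mk.injEq] at h1
  omega

/-- A rotation of three letters, acting on the first letter. -/
def firstRotor : Omega d 1 :=
  ofSign (threeCycle (fun _ => lastLetter hd) (fun _ => ⟨0, by omega⟩) (fun _ => ⟨1, by omega⟩)) <|
    sign_threeCycle (fun h => lastLetter_ne hd (show 0 + 1 < d by omega) (congrFun h 0))
      (fun h => by simpa using congrFun h 0)

theorem act_firstRotor {k : ℕ} {w : InfWord d} (hw : w ∈ spineSet hd (k + 1)) :
    act d 1 (toPerm d 1 (firstRotor hd)) w 0 = ⟨0, by omega⟩ := by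
  have h1 : pre 1 w = fun _ => lastLetter hd :=
    pre_eq_const_iff.2 fun i hi => hw i (by omega)
  rw [act_apply, h1, firstRotor, toPerm_ofSign, threeCycle_apply_fst, app_of_lt _ _ (by omega)]
  · exact fun h => lastLetter_ne hd (show 0 + 1 < d by omega) (congrFun h 0)
  · exact fun h => lastLetter_ne hd (show 1 + 1 < d by omega) (congrFun h 0)

/-! ### The groups `N^[k]`, density and the congruence subgroup property -/

variable (hr : r < d)

/-- The group `N^[k] = ⟨G^[k], (G^[k])^ε⟩`. -/
def NFrom (k : ℕ) : Subgroup (PGroup d) :=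
  telescopeFrom hd r hr k ⊔ (telescopeFrom hd r hr k).map (conjEps hd).toMonoidHom

/-- The elements of `P` with trivial coordinates of index less than `k`. -/
def coordKer (d k : ℕ) : Subgroup (PGroup d) where
  carrier := {g | ∀ i < k, g i = 1}
  one_mem' _ _ := rfl
  mul_mem' hg hh i hi := by rw [Pi.mul_apply, hg i hi, hh i hi, one_mul]
  inv_mem' hg i hi := by rw [Pi.inv_apply, hg i hi, inv_one]

/-- The elements of `P` with trivial coordinates of index at least `k`. -/
def coordFin (d k : ℕ) : Subgroup (PGroup d) where
  carrier := {g | ∀ i, k ≤ i → g i = 1}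
  one_mem' _ _ := rfl
  mul_mem' hg hh i hi := by rw [Pi.mul_apply, hg i hi, hh i hi, one_mul]
  inv_mem' hg i hi := by rw [Pi.inv_apply, hg i hi, inv_one]

theorem coordFin_conj {k : ℕ} {g : PGroup d} (hg : g ∈ coordFin d k) (h : PGroup d) :
    h * g * h⁻¹ ∈ coordFin d k := fun i hi => by
  rw [Pi.mul_apply, Pi.mul_apply, hg i hi, Pi.inv_apply, mul_one, mul_inv_cancel]

theorem coordKer_conj {k : ℕ} {g : PGroup d} (hg : g ∈ coordKer d k) (h : PGroup d) :
    h * g * h⁻¹ ∈ coordKer d k := fun i hi => by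
  rw [Pi.mul_apply, Pi.mul_apply, hg i hi, Pi.inv_apply, mul_one, mul_inv_cancel]

instance (k : ℕ) : (coordFin d k).Normal := ⟨fun _ hg h => coordFin_conj hg h⟩

theorem telescopeFrom_le_coordKer (k : ℕ) : telescopeFrom hd r hr k ≤ coordKer d k := by
  have := nonempty_fin hd
  have key : ∀ g : PGroup d, (∀ i < k, toSeq d g i = 1) → g ∈ coordKer d k := fun g hg i hi =>
    toPerm_injective _ _ (act_injective _ ((hg i hi).trans (by simp)))
  rw [telescopeFrom, Subgroup.closure_le]
  rintro _ (⟨ω, rfl⟩ | ⟨c, rfl⟩)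
  · exact key _ fun i hi => by rw [toSeq_deltaFrom, if_neg (by omega)]
  · exact key _ fun i hi => by rw [toSeq_tildeFrom, if_neg (by omega)]

theorem NFrom_le_coordKer (k : ℕ) : NFrom hd r hr k ≤ coordKer d k := by
  refine sup_le (telescopeFrom_le_coordKer hd r hr k) ?_
  rintro _ ⟨g, hg, rfl⟩
  exact coordKer_conj (telescopeFrom_le_coordKer hd r hr k hg) _

variable (hr2 : 2 ≤ r) (hrd : r + 3 ≤ d)

theorem factor_mem_coordFin (k : ℕ) (ω : Omega d (k + 1)) : factor d k ω ∈ coordFin d (k + 1) :=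
  fun i hi => Pi.mulSingle_eq_of_ne (by omega) _

theorem coordFin_mono {k l : ℕ} (h : k ≤ l) : coordFin d k ≤ coordFin d l :=
  fun _ hg i hi => hg i (h.trans hi)

include hr2 hrd in
theorem telescopeGroup_le_sup (k : ℕ) :
    telescopeGroup hd r ≤ coordFin d k ⊔ telescopeFrom hd r hr k := by
  induction k with
  | zero => rw [← telescopeFrom_zero hd r hr]; exact le_sup_right
  | succ k ih =>
    refine ih.trans (sup_le ((coordFin_mono (Nat.le_succ k)).trans le_sup_left) ?_)
    rw [telescopeFrom_eq hd r hr hr2 hrd]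
    refine sup_le_sup_right ?_ _
    rintro _ ⟨ω, rfl⟩
    exact factor_mem_coordFin k ω

include hr2 hrd in
-- The decomposition of G is transported by ε because `coordFin d k` is normal in P.
theorem N_le_sup (k : ℕ) : N hd r ≤ coordFin d k ⊔ NFrom hd r hr k := by
  refine sup_le ((telescopeGroup_le_sup hd r hr hr2 hrd k).trans
    (sup_le_sup_left le_sup_left _)) ?_
  rw [Subgroup.map_le_iff_le_comap]
  refine (telescopeGroup_le_sup hd r hr hr2 hrd k).trans (sup_le ?_ ?_)
  · exact fun g hg => Subgroup.mem_sup_left (coordFin_conj hg _)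
  · exact fun g hg => Subgroup.mem_sup_right (Subgroup.mem_sup_right ⟨g, hg, rfl⟩)

include hr2 hrd in
/-- An element of `N` with trivial coordinates of index less than `k` belongs to `N^[k]`. -/
theorem mem_NFrom {k : ℕ} {g : PGroup d} (hg : g ∈ N hd r) (hk : g ∈ coordKer d k) :
    g ∈ NFrom hd r hr k := by
  obtain ⟨l, hl, h, hh, rfl⟩ := Subgroup.mem_sup_of_normal_left.1 (N_le_sup hd r hr hr2 hrd k hg)
  have : l = 1 := by
    funext i
    rcases lt_or_ge i k with hi | hi
    · have h1 := hk i hi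
      rwa [Pi.mul_apply, NFrom_le_coordKer hd r hr k hh i hi, mul_one] at h1
    · exact hl i hi
  rwa [this, one_mul]

include hr hr2 hrd in
/-- The group `N` is dense in `P`. -/
theorem exists_mem_telescopeGroup (p : PGroup d) (k : ℕ) :
    ∃ g ∈ telescopeGroup hd r, ∀ i < k, g i = p i := by
  suffices ∃ g ∈ telescopeGroup hd r, g ∈ coordFin d k ∧ ∀ i < k, g i = p i by
    obtain ⟨g, hg, -, h⟩ := this
    exact ⟨g, hg, h⟩
  induction k with
  | zero => exact ⟨1, one_mem _, one_mem _, fun i hi => by omega⟩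
  | succ k ih =>
    obtain ⟨g, hg, h1, h2⟩ := ih
    refine ⟨g * factor d k (p k), mul_mem hg ?_, mul_mem (coordFin_mono (Nat.le_succ k) h1)
      (factor_mem_coordFin k _), fun i hi => ?_⟩
    · rw [← telescopeFrom_zero hd r hr]
      exact telescopeFrom_anti hd r hr hr2 hrd (Nat.zero_le k) (factor_mem hd r hr hr2 hrd k _)
    · rcases (show i = k ∨ i < k by omega) with rfl | h
      · simp [h1 i le_rfl]
      · simp [h2 i h, Pi.mulSingle_eq_of_ne h.ne]

/-- Only the growth of the orders matters: it forces homomorphisms from Ω_k to a fixed finite group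
to be trivial for large k. -/
theorem lt_card_omega (hd : 5 ≤ d) (k : ℕ) : k < Nat.card (Omega d (k + 1)) := by
  have h5 := card_word_ge hd k
  have : Nontrivial (Word d (k + 1)) := Finite.one_lt_card_iff_nontrivial.1 (by omega)
  have h1 : 2 * Nat.card (Omega d (k + 1)) = (Nat.card (Word d (k + 1))).factorial := by
    rw [← Nat.card_perm]
    exact two_mul_nat_card_alternatingGroup
  have h2 : k < Nat.card (Word d (k + 1)) := by
    rw [card_word]
    exact (Nat.lt_succ_self k).trans (Nat.lt_pow_self (by omega))
  obtain ⟨n, hn⟩ : ∃ n, Nat.card (Word d (k + 1)) = n + 1 := ⟨_, (Nat.sub_add_cancel (by omega)).symm⟩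
  rw [hn, Nat.factorial_succ] at h1
  have h3 := Nat.self_le_factorial n
  nlinarith

/-- The conjugator sends the first letter x_d to x_1, so the two elements move words with different
first letters. As the conjugator lies in Δ_(k+1)(Ω_(k+2)), any homomorphism trivial there makes the
images of c̃ and c̃' commute. -/
theorem tildeFrom_commute (k : ℕ) (c c' : BGroup d r) :
    tildeFrom hd r hr (k + 1) c * (deltaFrom d (k + 1) (iota (Nat.le_add_left 1 (k + 1))
      (firstRotor hd)) * tildeFrom hd r hr (k + 1) c' *
      (deltaFrom d (k + 1) (iota (Nat.le_add_left 1 (k + 1)) (firstRotor hd)))⁻¹) =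
    (deltaFrom d (k + 1) (iota (Nat.le_add_left 1 (k + 1)) (firstRotor hd)) *
      tildeFrom hd r hr (k + 1) c' * (deltaFrom d (k + 1) (iota (Nat.le_add_left 1 (k + 1))
      (firstRotor hd)))⁻¹) * tildeFrom hd r hr (k + 1) c := by
  have := nonempty_fin hd
  apply toSeq_injective
  funext n
  simp only [map_mul, map_inv, Pi.mul_apply, Pi.inv_apply, toSeq_deltaFrom, toSeq_tildeFrom]
  split
  · have h : k + 1 ≤ n := ‹_›
    rw [act_iota]
    refine commute_of_supportedOn (disjoint_of_letter (k := 0) fun w w' hw hw' e => ?_)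
      (tildeTail_mem_supportedOn hd r h c) (conj_mem_supportedOn
        (T := {w : InfWord d | w 0 = ⟨0, by omega⟩})
        (tildeTail_mem_supportedOn hd r h c') fun w hw => act_firstRotor hd hw)
    have h1 : w 0 = lastLetter hd := hw 0 (by omega)
    have h2 : w' 0 = ⟨0, by omega⟩ := hw'
    rw [h1, h2] at e
    exact lastLetter_ne hd (show 0 + 1 < d by omega) e
  · simp

include hr2 hrd in
theorem telescopeFrom_le_telescopeGroup (k : ℕ) :
    telescopeFrom hd r hr k ≤ telescopeGroup hd r := by
  rw [← telescopeFrom_zero hd r hr]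
  exact telescopeFrom_anti hd r hr hr2 hrd (Nat.zero_le k)

include hr2 hrd in
/-- A homomorphism from the telescope group to a finite group is trivial on almost all the
groups `G^[k]`. -/
theorem exists_forall_map_eq_one {Q : Type*} [Group Q] [Finite Q] (f : telescopeGroup hd r →* Q) :
    ∃ k, ∀ l, k ≤ l → ∀ g (hg : g ∈ telescopeGroup hd r), g ∈ telescopeFrom hd r hr l →
      f ⟨g, hg⟩ = 1 := by
  -- With l = k+1 > |Q|, the simple group Ω_(k+2) has more elements than Q.
  refine ⟨Nat.card Q + 1, fun l hl => ?_⟩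
  obtain ⟨k, rfl⟩ : ∃ k, l = k + 1 := ⟨l - 1, by omega⟩
  have hle := telescopeFrom_le_telescopeGroup hd r hr hr2 hrd (k + 1)
  let fδ : Omega d (k + 2) →* Q := f.comp ((deltaFrom d (k + 1)).codRestrict _
    fun ω => hle (deltaFrom_mem hd r hr (k + 1) ω))
  let fτ : BGroup d r →* Q := f.comp ((tildeFrom hd r hr (k + 1)).codRestrict _
    fun c => hle (tildeFrom_mem hd r hr (k + 1) c))
  have := isSimpleGroup_omega hd (k + 1)
  have hδ : ∀ ω, fδ ω = 1 := map_eq_one_of_card_lt fδ (by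
    have h : k + 1 < Nat.card (Omega d (k + 2)) := lt_card_omega hd (k + 1)
    omega)
  -- The conjugator D is already killed, so the images of the c̃^[k+1] commute; B is perfect.
  have hτ : ∀ c, fτ c = 1 := by
    apply map_eq_one_of_commute (commutator_BGroup hd r hr hr2)
    intro c c'
    set ω : Omega d (k + 2) := iota (Nat.le_add_left 1 (k + 1)) (firstRotor hd)
    have h1 := tildeFrom_commute hd r hr k c c'
    let D : telescopeGroup hd r := ⟨deltaFrom d (k + 1) ω, hle (deltaFrom_mem hd r hr (k + 1) ω)⟩
    let T : BGroup d r → telescopeGroup hd r := fun c =>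
      ⟨tildeFrom hd r hr (k + 1) c, hle (tildeFrom_mem hd r hr (k + 1) c)⟩
    have h2 : T c * (D * T c' * D⁻¹) = (D * T c' * D⁻¹) * T c := Subtype.ext h1
    have h3 : f D = 1 := hδ ω
    have h4 := congrArg f h2
    simp only [map_mul, map_inv, h3, one_mul, inv_one, mul_one] at h4
    exact h4
  have key : telescopeFrom hd r hr (k + 1) ≤ f.ker.map (telescopeGroup hd r).subtype := by
    rw [telescopeFrom, Subgroup.closure_le]
    rintro _ (⟨ω, rfl⟩ | ⟨c, rfl⟩)
    · exact ⟨⟨_, hle (deltaFrom_mem hd r hr (k + 1) ω)⟩, hδ ω, rfl⟩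
    · exact ⟨⟨_, hle (tildeFrom_mem hd r hr (k + 1) c)⟩, hτ c, rfl⟩
  intro g hg hg'
  obtain ⟨⟨g', h1⟩, h2, rfl⟩ := key hg'
  exact h2

include hr hr2 hrd in
/-- The congruence subgroup property of `N`. -/
theorem exists_forall_coordKer_map_eq_one {Q : Type*} [Group Q] [Finite Q] (f : N hd r →* Q) :
    ∃ k, ∀ g : N hd r, (g : PGroup d) ∈ coordKer d k → f g = 1 := by
  have hle : telescopeGroup hd r ≤ N hd r := le_sup_left
  -- One bound comes from f on G, the other from f on G^ε, pulled back to G by τ.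
  obtain ⟨k1, h1⟩ := exists_forall_map_eq_one hd r hr hr2 hrd (f.comp (Subgroup.inclusion hle))
  obtain ⟨k2, h2⟩ := exists_forall_map_eq_one hd r hr hr2 hrd
    (f.comp ((tau hd r).toMonoidHom.comp (Subgroup.inclusion hle)))
  refine ⟨max k1 k2, ?_⟩
  have key : NFrom hd r hr (max k1 k2) ≤ f.ker.map (N hd r).subtype := by
    refine sup_le ?_ ?_
    · intro g hg
      have hg' := telescopeFrom_le_telescopeGroup hd r hr hr2 hrd _ hg
      exact ⟨⟨g, hle hg'⟩, h1 _ (le_max_left _ _) g hg' hg, rfl⟩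
    · rintro _ ⟨g, hg, rfl⟩
      have hg' := telescopeFrom_le_telescopeGroup hd r hr hr2 hrd _ hg
      exact ⟨tau hd r ⟨g, hle hg'⟩, h2 _ (le_max_right _ _) g hg' hg, rfl⟩
  intro g hg
  obtain ⟨g', h, e⟩ := key (mem_NFrom hd r hr hr2 hrd g.2 hg)
  rwa [← Subtype.ext e]

end

end AltTelescope

open Equiv CategoryTheory

namespace AltTelescope

/-! ### Profinite completions -/

section Completion

open ProfiniteGrp.ProfiniteCompletion

variable {Γ Λ : Type} [Group Γ] [Group Λ]

/-- The canonical map to the profinite completion. -/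
def toCompletion (Γ : Type) [Group Γ] :
    Γ →* ProfiniteGrp.profiniteCompletion.obj (GrpCat.of Γ) :=
  (eta (GrpCat.of Γ)).hom

theorem denseRange_toCompletion : DenseRange (toCompletion Γ) :=
  denseRange (GrpCat.of Γ)

theorem lift_toCompletion {P : ProfiniteGrp.{0}} (f : Γ →* P) (g : Γ) :
    lift (GrpCat.ofHom f) (toCompletion Γ g) = f g := by
  have := ConcreteCategory.congr_hom (lift_eta (GrpCat.ofHom f)) g
  exact this

theorem profiniteMap_toCompletion (f : Γ →* Λ) (g : Γ) :
    profiniteMap f (toCompletion Γ g) = toCompletion Λ (f g) :=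
  lift_toCompletion ((toCompletion Λ).comp f) g

/-- Continuous maps agreeing on the image of the group in its completion agree. -/
theorem eq_of_toCompletion {Y : Type*} [TopologicalSpace Y] [T2Space Y]
    {f g : ProfiniteGrp.profiniteCompletion.obj (GrpCat.of Γ) → Y} (hf : Continuous f)
    (hg : Continuous g) (h : ∀ x, f (toCompletion Γ x) = g (toCompletion Γ x)) (x) : f x = g x :=
  congrFun (denseRange_toCompletion.equalizer hf hg (funext h)) x

/-- The projection of the completion to a finite quotient. -/
def completionProj (K : FiniteIndexNormalSubgroup Γ)
    (x : ProfiniteGrp.profiniteCompletion.obj (GrpCat.of Γ)) : Γ ⧸ K.toSubgroup :=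
  (show ProfiniteGrp.limit (diagram (GrpCat.of Γ)) from x).val K

theorem completionProj_toCompletion (K : FiniteIndexNormalSubgroup Γ) (g : Γ) :
    completionProj K (toCompletion Γ g) = QuotientGroup.mk g := rfl

theorem isOpen_completionProj (K : FiniteIndexNormalSubgroup Γ)
    (x : ProfiniteGrp.profiniteCompletion.obj (GrpCat.of Γ)) :
    IsOpen {y | completionProj K y = completionProj K x} := by
  let : TopologicalSpace (Γ ⧸ K.toSubgroup) := ⊥
  have : DiscreteTopology (Γ ⧸ K.toSubgroup) := ⟨rfl⟩
  have : Continuous (completionProj K) := (continuous_apply K).comp continuous_subtype_val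
  exact (isOpen_discrete {completionProj K x}).preimage this

theorem eq_one_of_completionProj (x : ProfiniteGrp.profiniteCompletion.obj (GrpCat.of Γ))
    (h : ∀ K, completionProj K x = 1) : x = 1 :=
  ProfiniteGrp.limit_ext _ _ _ h

theorem isIso_of_bijective {A B : ProfiniteGrp.{0}} (f : A ⟶ B) (h : Function.Bijective f) :
    IsIso f := by
  have : IsIso ((forget ProfiniteGrp.{0}).map f) := (isIso_iff_bijective _).2 h
  exact isIso_of_reflects_iso f (forget ProfiniteGrp.{0})

end Completion

/-! ### The completion of N is P. -/

noncomputable section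

variable {d : ℕ} (hd : 5 ≤ d) (r : ℕ) (hr : r < d) (hr2 : 2 ≤ r) (hrd : r + 3 ≤ d)

theorem completionToP_toCompletion (g : N hd r) :
    completionToP hd r (toCompletion (N hd r) g) = (g : PGroup d) :=
  lift_toCompletion (P := ProfiniteGrp.of (PGroup d)) (N hd r).subtype g

/-- `completionToP` as a function to `P`. -/
def toP (x : ProfiniteGrp.profiniteCompletion.obj (GrpCat.of (N hd r))) : PGroup d :=
  completionToP hd r x

theorem continuous_toP : Continuous (toP hd r) := (completionToP hd r).hom.continuous_toFun

theorem toP_toCompletion (g : N hd r) : toP hd r (toCompletion (N hd r) g) = (g : PGroup d) :=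
  completionToP_toCompletion hd r g

theorem isOpen_agree {k : ℕ} (p : PGroup d) : IsOpen {q : PGroup d | ∀ i < k, q i = p i} := by
  have : {q : PGroup d | ∀ i < k, q i = p i} =
      ⋂ i ∈ Finset.range k, (fun q : PGroup d => q i) ⁻¹' {p i} := by
    ext q; simp
  rw [this]
  exact isOpen_biInter_finset fun i _ => (isOpen_discrete _).preimage (continuous_apply i)

include hr hr2 hrd in
theorem completionToP_injective : Function.Injective (completionToP hd r) := by
  rw [injective_iff_map_eq_one]
  intro x hx
  apply eq_one_of_completionProj
  intro K
  have : Finite (N hd r ⧸ K.toSubgroup) := inferInstance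
  obtain ⟨k, hk⟩ := exists_forall_coordKer_map_eq_one hd r hr hr2 hrd (QuotientGroup.mk' K.toSubgroup)
  -- An element g of N is chosen close to x both modulo K and in the first k coordinates. The latter
  -- are trivial, so the congruence subgroup property puts g, and hence x, in the kernel modulo K.
  obtain ⟨y, hy, g, rfl⟩ := (denseRange_toCompletion (Γ := N hd r)).inter_open_nonempty _
    (((isOpen_agree (k := k) 1).preimage (continuous_toP hd r)).inter (isOpen_completionProj K x))
    ⟨x, fun i _ => congrFun hx i, rfl⟩
  have h1 := hk g (by
    have := hy.1
    rwa [Set.mem_preimage, toP_toCompletion] at this)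
  have h2 : completionProj K (toCompletion _ g) = completionProj K x := hy.2
  rw [← h2, completionProj_toCompletion]
  exact h1

include hr hr2 hrd in
theorem dense_N : Dense (N hd r : Set (PGroup d)) := by
  rw [dense_iff_inter_open]
  rintro U hU ⟨p, hp⟩
  obtain ⟨I, u, h1, h2⟩ := isOpen_pi_iff.1 hU p hp
  obtain ⟨k, hk⟩ : ∃ k, ∀ i ∈ I, i < k := ⟨I.sup id + 1, fun i hi =>
    Nat.lt_succ_of_le (Finset.le_sup (f := id) hi)⟩
  obtain ⟨g, hg, h⟩ := exists_mem_telescopeGroup hd r hr hr2 hrd p k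
  exact ⟨g, h2 fun i hi => by rw [h i (hk i hi)]; exact (h1 i hi).2,
    (le_sup_left : telescopeGroup hd r ≤ N hd r) hg⟩

include hr hr2 hrd in
-- The image is compact, hence closed, and contains the dense subgroup N.
theorem completionToP_surjective : Function.Surjective (completionToP hd r) := by
  have h1 : IsClosed (Set.range (toP hd r)) :=
    (isCompact_range (continuous_toP hd r)).isClosed
  have h2 : Dense (Set.range (toP hd r)) := (dense_N hd r hr hr2 hrd).mono
    fun g hg => ⟨_, toP_toCompletion hd r ⟨g, hg⟩⟩
  exact Set.range_eq_univ.1 (h1.closure_eq ▸ h2.closure_eq)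

include hr hr2 hrd in
theorem isIso_completionToP : IsIso (completionToP hd r) :=
  isIso_of_bijective _ ⟨completionToP_injective hd r hr hr2 hrd,
    completionToP_surjective hd r hr hr2 hrd⟩

instance residuallyFinite_PGroup (d : ℕ) : Group.ResiduallyFinite (PGroup d) := by
  apply Group.residuallyFinite_of_forall_exists_finite_monoidHom
  intro g hg
  obtain ⟨n, hn⟩ := Function.ne_iff.1 hg
  exact ⟨Omega d (n + 1), inferInstance, inferInstance, Pi.evalMonoidHom _ n, hn⟩

/-! ### The automorphism `τ` -/

theorem coe_tau (g : N hd r) : (tau hd r g : PGroup d) = conjEps hd g := rfl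

theorem center_omega (hd : 5 ≤ d) {l : ℕ} {z : Omega d (l + 1)} (h : ∀ ω, z * ω = ω * z) :
    z = 1 := by
  have h1 : Subgroup.center (alternatingGroup (Word d (l + 1))) = ⊥ :=
    alternatingGroup.center_eq_bot ((by norm_num : 4 ≤ 5).trans (card_word_ge hd l))
  have h2 : (show alternatingGroup (Word d (l + 1)) from z) ∈
      Subgroup.center (alternatingGroup (Word d (l + 1))) :=
    Subgroup.mem_center_iff.2 fun ω => (h ω).symm
  rw [h1] at h2
  exact h2

include hr hr2 hrd in
/-- The centralizer of `N` in `P` is trivial. -/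
theorem eq_one_of_centralizes {z : PGroup d} (h : ∀ g ∈ N hd r, z * g = g * z) : z = 1 := by
  funext n
  refine center_omega hd fun ω => ?_
  -- N contains every factor of P, and each factor has trivial center.
  have h1 := telescopeFrom_le_telescopeGroup hd r hr hr2 hrd n (factor_mem hd r hr hr2 hrd n ω)
  have h2 := congrFun (h _ ((le_sup_left : telescopeGroup hd r ≤ N hd r) h1)) n
  simpa using h2

include hr hr2 hrd in
-- If g induced τ, then ε g would centralize N, hence be trivial, and ε would lie in N.
theorem tau_notMem_range : tau hd r ∉ (MulAut.conj : N hd r →* _).range := by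
  rintro ⟨g, hg⟩
  have h1 : eps hd * (g : PGroup d) = 1 := by
    refine eq_one_of_centralizes hd r hr hr2 hrd fun x hx => ?_
    have h2 := congrArg Subtype.val (DFunLike.congr_fun hg ⟨x, hx⟩)
    rw [coe_tau, conjEps_apply] at h2
    change (g : PGroup d) * x * (g : PGroup d)⁻¹ = _ at h2
    have h3 : (g : PGroup d) * x = eps hd * x * eps hd * g := by rw [← h2]; group
    rw [mul_assoc, h3, ← mul_assoc, ← mul_assoc, ← mul_assoc, eps_mul_eps, one_mul, mul_assoc]
  have h2 : eps hd = (g : PGroup d)⁻¹ := eq_inv_of_mul_eq_one_left h1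
  exact eps_notMem_N hd r hr (h2 ▸ inv_mem g.2)

include hr hr2 hrd in
-- Take γ over ε. Both sides, mapped to P, are continuous and agree on N.
theorem exists_completion_conj :
    ∃ γ : ProfiniteGrp.profiniteCompletion.obj (GrpCat.of (N hd r)),
      completionToP hd r γ = eps hd ∧
      ∀ x, profiniteMap (tau hd r).toMonoidHom x = γ⁻¹ * x * γ := by
  obtain ⟨γ, hγ⟩ := completionToP_surjective hd r hr hr2 hrd (eps hd)
  refine ⟨γ, hγ, fun x => ?_⟩
  apply completionToP_injective hd r hr hr2 hrd
  rw [map_mul, map_mul, map_inv, hγ]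
  have h1 : Continuous fun x => toP hd r (profiniteMap (tau hd r).toMonoidHom x) :=
    (continuous_toP hd r).comp (profiniteMap (tau hd r).toMonoidHom).hom.continuous_toFun
  have h2 : Continuous fun x => (eps hd)⁻¹ * toP hd r x * eps hd :=
    (continuous_const.mul (continuous_toP hd r)).mul continuous_const
  refine eq_of_toCompletion h1 h2 (fun g => ?_) x
  rw [profiniteMap_toCompletion, toP_toCompletion, toP_toCompletion]
  change conjEps hd g = _
  rw [conjEps_apply, eps_inv]

end

end AltTelescope

open Equiv

namespace AltTelescope

/-! ### Four generators of N. -/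

noncomputable section

variable {d : ℕ} (hd : 5 ≤ d) (r : ℕ)

/-- The words of length two with first letter different from `x_d`. -/
abbrev OffSpine : Type := {w : Word d 2 // w 0 ≠ lastLetter hd}

/-- The even permutations of the words of length two with first letter different from `x_d`. -/
def offSpineHom : alternatingGroup (OffSpine hd) →* Omega d 2 :=
  altMap (Perm.viaEmbeddingHom (Function.Embedding.subtype _))

theorem toPerm_offSpineHom (z : alternatingGroup (OffSpine hd)) :
    toPerm d 2 (offSpineHom hd z) = (z : Perm (OffSpine hd)).viaEmbedding (Function.Embedding.subtype _) := rfl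

theorem act_offSpineHom_mem_supportedOn (z : alternatingGroup (OffSpine hd)) :
    act d 2 (toPerm d 2 (offSpineHom hd z)) ∈ supportedOn {w | w 0 ≠ lastLetter hd} := by
  intro w hw
  rw [act_apply, toPerm_offSpineHom, Perm.viaEmbedding_apply_of_notMem, app_pre_drop]
  rintro ⟨⟨v, hv⟩, h⟩
  change v = _ at h
  subst h
  exact hw hv

theorem commute_factor_zero (ω : Omega d 1) {g : PGroup d} (hg : g ∈ coordKer d 1) :
    Commute (factor d 0 ω) g := by
  funext n
  by_cases h : n = 0
  · subst h
    rw [Pi.mul_apply, Pi.mul_apply, hg 0 (by omega), one_mul, mul_one]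
  · simp [Pi.mulSingle_eq_of_ne h]

theorem conjEps_deltaFrom (k : ℕ) (ω : Omega d (k + 1)) :
    conjEps hd (deltaFrom d k ω) = deltaFrom d k (eps hd k * ω * eps hd k) := by
  have := nonempty_fin hd
  apply toSeq_injective
  funext n
  rw [toSeq_conjEps, toSeq_deltaFrom, toSeq_deltaFrom]
  split
  · rw [deltaInf_mul_act]; rfl
  · rw [mul_one, deltaInf_mul_self]

variable (hr : r < d)

theorem commute_tildeFrom_offSpine (c : BGroup d r) (z : alternatingGroup (OffSpine hd)) :
    Commute (tildeFrom hd r hr 1 c) (deltaFrom d 1 (offSpineHom hd z)) := by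
  have := nonempty_fin hd
  apply toSeq_injective
  funext n
  rw [map_mul, map_mul, Pi.mul_apply, Pi.mul_apply, toSeq_deltaFrom, toSeq_tildeFrom]
  split
  · refine commute_of_supportedOn (disjoint_of_letter (k := 0) fun w w' hw hw' e => ?_)
      (tildeTail_mem_supportedOn hd r ‹_› c) (act_offSpineHom_mem_supportedOn hd z)
    exact hw' (e ▸ hw 0 (by omega))
  · rfl

/-- The homomorphism `((ω, c), z) ↦ ω · c̃^[1] · Δ(z)`. -/
def seedHom : (Omega d 1 × BGroup d r) × alternatingGroup (OffSpine hd) →* PGroup d :=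
  MonoidHom.noncommCoprod
    (MonoidHom.noncommCoprod (factor d 0) (tildeFrom hd r hr 1) fun ω c =>
      commute_factor_zero ω (telescopeFrom_le_coordKer hd r hr 1 (tildeFrom_mem hd r hr 1 c)))
    ((deltaFrom d 1).comp (offSpineHom hd)) fun x z =>
      (commute_factor_zero x.1
        (telescopeFrom_le_coordKer hd r hr 1 (deltaFrom_mem hd r hr 1 _))).mul_left
        (commute_tildeFrom_offSpine hd r hr x.2 z)

theorem seedHom_apply (ω : Omega d 1) (c : BGroup d r) (z : alternatingGroup (OffSpine hd)) :
    seedHom hd r hr ((ω, c), z) =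
      factor d 0 ω * tildeFrom hd r hr 1 c * deltaFrom d 1 (offSpineHom hd z) := rfl

theorem le_card_offSpine (hrd : r + 3 ≤ d) : (r + 1) * d ≤ Nat.card (OffSpine hd) := by
  have : (r + 1) * d = Nat.card (Fin (r + 1) × Fin d) := by simp
  rw [this]
  refine Nat.card_le_card_of_injective
    (fun p => (⟨![⟨p.1, by omega⟩, p.2], fun h => ?_⟩ : OffSpine hd)) fun p q h => ?_
  · simp only [lastLetter, Matrix.cons_val_zero, Fin.mk.injEq] at h
    have := p.1.2
    omega
  · have h' := congrArg Subtype.val h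
    have h0 := congrFun h' 0
    have h1 := congrFun h' 1
    simp only [Matrix.cons_val_zero, Fin.mk.injEq, Matrix.cons_val_one] at h0 h1
    exact Prod.ext (Fin.ext h0) h1

variable (hr2 : 2 ≤ r) (hrd : r + 3 ≤ d)

include hr2 hrd in
-- The three alternating groups are two-generated, and the second and third are simple and each
-- larger than the product of the preceding ones. The Goursat lemma therefore combines the
-- generating pairs.
theorem exists_pair_seedHom :
    ∃ x y, Subgroup.closure {x, y} = (seedHom hd r hr).range := by
  have hα := le_card_offSpine hd r hrd
  have hα' : d + r * d ≤ Nat.card (OffSpine hd) := by linarith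
  have hB := card_pair r hr
  have hrd' : d < r * d := by nlinarith
  have hnA : Nontrivial (Word d 1) :=
    Finite.one_lt_card_iff_nontrivial.1 (by have := card_word_ge hd 0; simp_all; omega)
  have hnB : Nontrivial {p : Fin d × Fin d // (p.1 : ℕ) < r} :=
    Finite.one_lt_card_iff_nontrivial.1 (by omega)
  have hnC : Nontrivial (OffSpine hd) := Finite.one_lt_card_iff_nontrivial.1 (by omega)
  have hA : 2 * Nat.card (Omega d 1) = d.factorial := by
    have : 2 * Nat.card (alternatingGroup (Word d 1)) = _ := two_mul_nat_card_alternatingGroup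
    rwa [Nat.card_perm, card_word, pow_one] at this
  have hBc : 2 * Nat.card (BGroup d r) = (r * d).factorial := by
    rw [← hB, ← Nat.card_perm]
    exact two_mul_nat_card_alternatingGroup
  have hCc : 2 * Nat.card (alternatingGroup (OffSpine hd)) =
      (Nat.card (OffSpine hd)).factorial := by
    rw [← Nat.card_perm]
    exact two_mul_nat_card_alternatingGroup
  have hAB : Nat.card (Omega d 1) < Nat.card (BGroup d r) := by
    have := (Nat.factorial_lt (show 0 < d by omega)).2 hrd'
    omega
  have hABC : Nat.card (Omega d 1 × BGroup d r) < Nat.card (alternatingGroup (OffSpine hd)) := by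
    -- d! (rd)! ≤ (d + rd)! ≤ |`OffSpine`|!; halving each factorial leaves a factor 2 to spare.
    have h1 := Nat.le_of_dvd (Nat.factorial_pos _) (Nat.factorial_mul_factorial_dvd_factorial_add d (r * d))
    have h2 := h1.trans (Nat.factorial_le hα')
    rw [← hA, ← hBc, ← hCc] at h2
    rw [Nat.card_prod]
    have h3 : 0 < Nat.card (Omega d 1) * Nat.card (BGroup d r) :=
      Nat.mul_pos Nat.card_pos Nat.card_pos
    nlinarith
  have hsB := isSimpleGroup_BGroup hd r hr hr2
  have hsC : IsSimpleGroup (alternatingGroup (OffSpine hd)) :=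
    alternatingGroup.isSimpleGroup (by omega)
  obtain ⟨a, a', ha⟩ : IsTwoGenerated (Omega d 1) :=
    isTwoGenerated_alternatingGroup (le_trans (by norm_num) (card_word_ge hd 0))
  obtain ⟨b, b', hb⟩ : IsTwoGenerated (BGroup d r) := isTwoGenerated_alternatingGroup (by omega)
  obtain ⟨c, c', hc⟩ : IsTwoGenerated (alternatingGroup (OffSpine hd)) :=
    isTwoGenerated_alternatingGroup (by omega)
  refine ⟨seedHom hd r hr ((a, b), c), seedHom hd r hr ((a', b'), c'), ?_⟩
  rw [← Set.image_pair, ← MonoidHom.map_closure,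
    closure_pair_prod_eq_top hABC (closure_pair_prod_eq_top hAB ha hb) hc, MonoidHom.range_eq_map]

/-- The seed yields the even permutations of the two-letter words not beginning with x_d, its
ε-conjugate those of the words not beginning with x_1. Together they generate Alt(X²). -/
theorem deltaFrom_mem_of_seedHom_le {H : Subgroup (PGroup d)} (hH : (seedHom hd r hr).range ≤ H)
    (hH' : (seedHom hd r hr).range.map (conjEps hd).toMonoidHom ≤ H) (ω : Omega d 2) :
    deltaFrom d 1 ω ∈ H := by
  set U := (H.comap (deltaFrom d 1)).map (toPerm d 2) with hU
  have h1 : ∀ a b c : Word d 2, a 0 ≠ lastLetter hd → b 0 ≠ lastLetter hd →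
      c 0 ≠ lastLetter hd → a ≠ b → a ≠ c → b ≠ c → ∃ ω, toPerm d 2 ω = threeCycle a b c ∧
        deltaFrom d 1 ω ∈ H ∧ deltaFrom d 1 (eps hd 1 * ω * eps hd 1) ∈ H := by
    intro a b c ha hb hc hab hac hbc
    let z : alternatingGroup (OffSpine hd) := ⟨threeCycle ⟨a, ha⟩ ⟨b, hb⟩ ⟨c, hc⟩,
      Perm.mem_alternatingGroup.2 (sign_threeCycle (fun h => hab (congrArg Subtype.val h))
        (fun h => hbc (congrArg Subtype.val h)))⟩
    have hz : deltaFrom d 1 (offSpineHom hd z) ∈ (seedHom hd r hr).range :=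
      ⟨((1, 1), z), by rw [seedHom_apply, map_one, map_one, one_mul, one_mul]⟩
    refine ⟨offSpineHom hd z, ?_, hH hz, ?_⟩
    · rw [toPerm_offSpineHom]
      exact viaEmbedding_threeCycle _ _ _ _
    · rw [← conjEps_deltaFrom]
      exact hH' ⟨_, hz, rfl⟩
  have h2 : ∀ a b c : Word d 2, a 0 ≠ lastLetter hd → b 0 ≠ lastLetter hd →
      c 0 ≠ lastLetter hd → a ≠ b → a ≠ c → b ≠ c → HasThreeCycle U a b c := by
    intro a b c ha hb hc hab hac hbc
    obtain ⟨ω, h, hω, -⟩ := h1 a b c ha hb hc hab hac hbc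
    exact ⟨⟨hab, hac, hbc⟩, ω, hω, h⟩
  have h3 : ∀ a b c : Word d 2, a 0 ≠ ⟨0, by omega⟩ → b 0 ≠ ⟨0, by omega⟩ →
      c 0 ≠ ⟨0, by omega⟩ → a ≠ b → a ≠ c → b ≠ c → HasThreeCycle U a b c := by
    intro a b c ha hb hc hab hac hbc
    set D := diagHom d 2 (delta hd) with hD
    have hDD : ∀ v, D (D v) = v := fun v => funext fun i => delta_delta hd (v i)
    have hDinv : D⁻¹ = D := inv_eq_of_mul_eq_one_left (Equiv.ext hDD)
    have hne : ∀ v : Word d 2, v 0 ≠ ⟨0, by omega⟩ → D v 0 ≠ lastLetter hd := by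
      intro v hv h
      apply hv
      rw [← delta_last hd, ← h]
      exact (delta_delta hd (v 0)).symm
    obtain ⟨ω, h, -, hω⟩ := h1 (D a) (D b) (D c) (hne a ha) (hne b hb) (hne c hc)
      (D.injective.ne hab) (D.injective.ne hac) (D.injective.ne hbc)
    refine ⟨⟨hab, hac, hbc⟩, _, hω, ?_⟩
    have e := conj_threeCycle D (D a) (D b) (D c)
    rw [hDinv, hDD, hDD, hDD] at e
    rw [map_mul, map_mul, toPerm_eps, h, ← hD, e]
  -- Two words beginning with x_2 lie in both sets, and any third word lies in at least one of them.
  -- So all (z z' a) are available.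
  set z : Word d 2 := ![⟨1, by omega⟩, ⟨0, by omega⟩] with hz
  set z' : Word d 2 := ![⟨1, by omega⟩, ⟨1, by omega⟩] with hz'
  have hzz : z ≠ z' := fun h => by simpa [hz, hz'] using congrFun h 1
  have hz0 : z 0 ≠ ⟨0, by omega⟩ ∧ z 0 ≠ lastLetter hd :=
    ⟨by simp [hz], (lastLetter_ne hd (by omega)).symm⟩
  have hz0' : z' 0 ≠ ⟨0, by omega⟩ ∧ z' 0 ≠ lastLetter hd :=
    ⟨by simp [hz'], (lastLetter_ne hd (by omega)).symm⟩
  have h4 : ∀ a, a ≠ z → a ≠ z' → HasThreeCycle U z z' a := by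
    intro a ha ha'
    by_cases h : a 0 = lastLetter hd
    · exact h3 z z' a hz0.1 hz0'.1 (h ▸ lastLetter_ne hd (by omega)) hzz ha.symm ha'.symm
    · exact h2 z z' a hz0.2 hz0'.2 h hzz ha.symm ha'.symm
  have h5 : alternatingGroup (Word d 2) ≤ U := by
    refine alternatingGroup_le_of_threeCycles fun a b c hab hac hbc =>
      (HasThreeCycle.of_base z (fun i j hi hj hij => ?_) hab hac hbc).2
    by_cases hi' : i = z'
    · subst hi'; exact h4 j hj hij.symm
    by_cases hj' : j = z'
    · subst hj'; exact (h4 i hi hij).reverse.rotate.rotate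
    exact ((h4 i hi hi').reverse.shared (h4 j hj hj').swap hij).swap
  obtain ⟨ω', hω', e⟩ := h5 ω.2
  rwa [← toPerm_injective _ _ e]

include hr2 hrd in
-- Once Δ_2(Ω_2) is available, the generators Δ_1(ω) and `c̃` are recovered from the first factor of
-- P and from c̃^[2] by `deltaFrom_eq` and `tildeFrom_eq`; index 1 in the code is level 2.
theorem N_eq_seedHom : N hd r = (seedHom hd r hr).range ⊔
    (seedHom hd r hr).range.map (conjEps hd).toMonoidHom := by
  apply le_antisymm
  · set H := (seedHom hd r hr).range ⊔ (seedHom hd r hr).range.map (conjEps hd).toMonoidHom with hH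
    have hinv : H.map (conjEps hd).toMonoidHom ≤ H := by
      rw [hH, Subgroup.map_sup]
      refine sup_le le_sup_right ?_
      rintro _ ⟨_, ⟨x, hx, rfl⟩, rfl⟩
      refine Subgroup.mem_sup_left ?_
      change conjEps hd (conjEps hd x) ∈ _
      rwa [conjEps_conjEps]
    have hT : telescopeGroup hd r ≤ H := by
      have hδ := deltaFrom_mem_of_seedHom_le hd r hr (H := H) le_sup_left le_sup_right
      rw [← telescopeFrom_zero hd r hr, telescopeFrom, Subgroup.closure_le]
      rintro _ (⟨ω, rfl⟩ | ⟨c, rfl⟩)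
      · rw [deltaFrom_eq hd]
        refine mul_mem (Subgroup.mem_sup_left ⟨((ω, 1), 1), ?_⟩) (hδ _)
        rw [seedHom_apply, map_one, map_one, map_one, mul_one, mul_one]
      · rw [tildeFrom_eq]
        refine mul_mem (hδ _) (Subgroup.mem_sup_left ⟨((1, c), 1), ?_⟩)
        rw [seedHom_apply, map_one, map_one, map_one, mul_one, one_mul]
    exact sup_le hT ((Subgroup.map_mono hT).trans hinv)
  · have hle : (seedHom hd r hr).range ≤ telescopeGroup hd r := by
      rintro _ ⟨⟨⟨ω, c⟩, z⟩, rfl⟩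
      rw [seedHom_apply]
      have h0 := telescopeFrom_le_telescopeGroup hd r hr hr2 hrd 0
      have h1 := telescopeFrom_le_telescopeGroup hd r hr hr2 hrd 1
      exact mul_mem (mul_mem (h0 (factor_mem hd r hr hr2 hrd 0 ω)) (h1 (tildeFrom_mem hd r hr 1 c)))
        (h1 (deltaFrom_mem hd r hr 1 _))
    exact sup_le_sup hle (Subgroup.map_mono hle)

include hr hr2 hrd in
theorem exists_four_generators :
    ∃ s : Fin 4 → PGroup d, Subgroup.closure (Set.range s) = N hd r := by
  obtain ⟨x, y, hxy⟩ := exists_pair_seedHom hd r hr hr2 hrd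
  refine ⟨![x, y, conjEps hd x, conjEps hd y], ?_⟩
  rw [N_eq_seedHom hd r hr hr2 hrd, ← hxy, MonoidHom.map_closure, Set.image_pair,
    ← Subgroup.closure_union]
  congr 1
  simp only [Matrix.range_cons, Matrix.range_empty]
  ext g
  simp
  tauto

end

end AltTelescope

open Equiv CategoryTheory

namespace AltTelescope

/-! ### Functoriality of the profinite completion. -/

section Completion

variable {Γ Λ Θ : Type} [Group Γ] [Group Λ] [Group Θ]

theorem continuous_profiniteMap (f : Γ →* Λ) : Continuous (profiniteMap f) :=
  (profiniteMap f).hom.continuous_toFun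

theorem profiniteMap_comp (f : Γ →* Λ) (g : Λ →* Θ) (x) :
    profiniteMap (g.comp f) x = profiniteMap g (profiniteMap f x) :=
  eq_of_toCompletion (continuous_profiniteMap _)
    ((continuous_profiniteMap g).comp (continuous_profiniteMap f))
    (fun y => by
      rw [Function.comp_apply, profiniteMap_toCompletion, profiniteMap_toCompletion,
        profiniteMap_toCompletion]
      rfl) x

theorem profiniteMap_id (x) : profiniteMap (MonoidHom.id Γ) x = x :=
  eq_of_toCompletion (continuous_profiniteMap _) continuous_id
    (fun y => by rw [profiniteMap_toCompletion]; rfl) x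

theorem profiniteMap_surjective_of_mulEquiv (e : Γ ≃* Λ) :
    Function.Surjective (profiniteMap e.toMonoidHom) := fun y =>
  ⟨profiniteMap e.symm.toMonoidHom y, by
    rw [← profiniteMap_comp]
    have : e.toMonoidHom.comp e.symm.toMonoidHom = MonoidHom.id Λ := by ext; simp
    rw [this, profiniteMap_id]⟩

theorem isClosed_range_profiniteMap (f : Γ →* Λ) :
    IsClosed ((profiniteMap f).hom.toMonoidHom.range :
      Set (ProfiniteGrp.profiniteCompletion.obj (GrpCat.of Λ))) :=
  (isCompact_range (continuous_profiniteMap f)).isClosed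

/-- The image of the completion of a normal subgroup is normal. -/
theorem normal_range_profiniteMap (S : Subgroup Γ) [S.Normal] :
    (profiniteMap S.subtype).hom.toMonoidHom.range.Normal := by
  set I := (profiniteMap S.subtype).hom.toMonoidHom.range with hI
  -- The elements conjugating the closed subgroup I into itself form a closed set, so it suffices
  -- that the dense image of Γ does so.
  have hclosed : IsClosed {γ | ∀ x, γ * profiniteMap S.subtype x * γ⁻¹ ∈ I} := by
    have : {γ | ∀ x, γ * profiniteMap S.subtype x * γ⁻¹ ∈ I} =
        ⋂ x, (fun γ => γ * profiniteMap S.subtype x * γ⁻¹) ⁻¹' (I : Set _) := by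
      ext γ; simp
    rw [this]
    exact isClosed_iInter fun x => (isClosed_range_profiniteMap S.subtype).preimage
      ((continuous_id.mul continuous_const).mul continuous_inv)
  have hrange : ∀ g x, toCompletion Γ g * profiniteMap S.subtype x * (toCompletion Γ g)⁻¹ ∈ I := by
    intro g x
    refine ⟨profiniteMap (MulAut.conjNormal g : MulAut S).toMonoidHom x, ?_⟩
    refine eq_of_toCompletion (Y := ProfiniteGrp.profiniteCompletion.obj (GrpCat.of Γ))
      (f := fun x => profiniteMap S.subtype (profiniteMap (MulAut.conjNormal g : MulAut S).toMonoidHom x))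
      (g := fun x => toCompletion Γ g * profiniteMap S.subtype x * (toCompletion Γ g)⁻¹)
      ((continuous_profiniteMap _).comp (continuous_profiniteMap _))
      ((continuous_const.mul (continuous_profiniteMap _)).mul continuous_const) (fun y => ?_) x
    rw [profiniteMap_toCompletion, profiniteMap_toCompletion, profiniteMap_toCompletion,
      ← map_inv, ← map_mul, ← map_mul]
    rfl
  constructor
  rintro _ ⟨x, rfl⟩ γ
  have : γ ∈ closure (Set.range (toCompletion Γ)) := denseRange_toCompletion γ
  refine (hclosed.closure_subset_iff.2 ?_) this x
  rintro _ ⟨g, rfl⟩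
  exact hrange g

end Completion

/-! ### The semidirect product N ⋊ ⟨τ⟩ as a counterexample. -/

noncomputable section

variable {d : ℕ} (hd : 5 ≤ d) (r : ℕ)

theorem tau_mul_tau : tau hd r * tau hd r = 1 :=
  MulEquiv.ext fun g => Subtype.ext (conjEps_conjEps hd g)

theorem eq_one_or_eq_tau (t : Subgroup.zpowers (tau hd r)) :
    (t : MulAut (N hd r)) = 1 ∨ (t : MulAut (N hd r)) = tau hd r := by
  obtain ⟨_, n, rfl⟩ := t
  rcases Int.even_or_odd' n with ⟨k, rfl | rfl⟩
  · left
    simp only [zpow_mul, zpow_two, tau_mul_tau, one_zpow]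
  · right
    simp only [zpow_add, zpow_mul, zpow_two, tau_mul_tau, one_zpow, one_mul, zpow_one]

instance : Finite (Subgroup.zpowers (tau hd r)) := by
  refine Set.Finite.subset (Set.toFinite {1, tau hd r}) fun t ht => ?_
  exact eq_one_or_eq_tau hd r ⟨t, ht⟩

variable (hr : r < d) (hr2 : 2 ≤ r) (hrd : r + 3 ≤ d)

include hr hr2 hrd in
theorem tau_ne_one : tau hd r ≠ 1 := fun h =>
  tau_notMem_range hd r hr hr2 hrd (h ▸ one_mem _)

section Lift

variable {K : Type*} [Group K] (x : K) (hx : x * x = 1)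

open scoped Classical in
/-- The homomorphism `⟨τ⟩ → K` with `τ ↦ x`. -/
def zpowersLift : Subgroup.zpowers (tau hd r) →* K :=
  MonoidHom.mk' (fun t => if (t : MulAut (N hd r)) = 1 then 1 else x) fun s t => by
    have hτ := tau_ne_one hd r hr hr2 hrd
    rcases eq_one_or_eq_tau hd r s with hs | hs <;> rcases eq_one_or_eq_tau hd r t with ht | ht <;>
      simp [hs, ht, hτ, tau_mul_tau, hx]

theorem zpowersLift_of_eq_one {t : Subgroup.zpowers (tau hd r)} (ht : (t : MulAut (N hd r)) = 1) :
    zpowersLift hd r hr hr2 hrd x hx t = 1 := if_pos ht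

theorem zpowersLift_of_eq_tau {t : Subgroup.zpowers (tau hd r)}
    (ht : (t : MulAut (N hd r)) = tau hd r) : zpowersLift hd r hr hr2 hrd x hx t = x :=
  if_neg fun h => tau_ne_one hd r hr hr2 hrd (ht.symm.trans h)

variable (f : N hd r →* K) (hf : ∀ g, f (tau hd r g) = x * f g * x)

/-- The homomorphism on `N ⋊ ⟨τ⟩` extending `f` with `τ ↦ x`. -/
def semiLift : Semi hd r →* K :=
  SemidirectProduct.lift f (zpowersLift hd r hr hr2 hrd x hx) fun t => by
    refine MonoidHom.ext fun g => ?_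
    change f ((t : MulAut (N hd r)) g) = zpowersLift hd r hr hr2 hrd x hx t * f g *
      (zpowersLift hd r hr hr2 hrd x hx t)⁻¹
    rcases eq_one_or_eq_tau hd r t with ht | ht
    · rw [zpowersLift_of_eq_one hd r hr hr2 hrd x hx ht, ht]; simp
    · rw [zpowersLift_of_eq_tau hd r hr hr2 hrd x hx ht, ht, hf, inv_eq_of_mul_eq_one_left hx]

theorem semiLift_inl (g : N hd r) :
    semiLift hd r hr hr2 hrd x hx f hf (SemidirectProduct.inl g) = f g :=
  SemidirectProduct.lift_inl _ _ _ _

theorem semiLift_inr {t : Subgroup.zpowers (tau hd r)} (ht : (t : MulAut (N hd r)) = tau hd r) :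
    semiLift hd r hr hr2 hrd x hx f hf (SemidirectProduct.inr t) = x :=
  (SemidirectProduct.lift_inr _ _ _ _).trans (zpowersLift_of_eq_tau hd r hr hr2 hrd x hx ht)

/-- A kernel element outside N would express x through f. -/
theorem semiLift_injective (hinj : Function.Injective f) (hx' : x ∉ f.range) :
    Function.Injective (semiLift hd r hr hr2 hrd x hx f hf) := by
  rw [injective_iff_map_eq_one]
  intro y hy
  have e : semiLift hd r hr hr2 hrd x hx f hf y =
      f y.left * zpowersLift hd r hr hr2 hrd x hx y.right := rfl
  rw [e] at hy
  rcases eq_one_or_eq_tau hd r y.right with ht | ht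
  · rw [zpowersLift_of_eq_one hd r hr hr2 hrd x hx ht, mul_one] at hy
    exact SemidirectProduct.ext (hinj (hy.trans (map_one f).symm)) (Subtype.ext ht)
  · rw [zpowersLift_of_eq_tau hd r hr hr2 hrd x hx ht] at hy
    have h : x = (f y.left)⁻¹ := eq_inv_of_mul_eq_one_right hy
    exact (hx' ⟨y.left⁻¹, by rw [map_inv, h]⟩).elim

end Lift

/-- The homomorphism `N ⋊ ⟨τ⟩ → P` with `τ ↦ ε`. -/
def semiToP : Semi hd r →* PGroup d :=
  semiLift hd r hr hr2 hrd (eps hd) (eps_mul_eps hd) (N hd r).subtype fun g =>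
    conjEps_apply hd g

theorem semiToP_inl (g : N hd r) :
    semiToP hd r hr hr2 hrd (SemidirectProduct.inl g) = (g : PGroup d) :=
  semiLift_inl hd r hr hr2 hrd _ _ _ _ g

theorem semiToP_injective : Function.Injective (semiToP hd r hr hr2 hrd) :=
  semiLift_injective hd r hr hr2 hrd _ _ _ _ (Subgroup.subtype_injective _)
    (by rw [Subgroup.range_subtype]; exact eps_notMem_N hd r hr)

include hr hr2 hrd in
theorem residuallyFinite_semi : Group.ResiduallyFinite (Semi hd r) := by
  apply Group.residuallyFinite_of_forall_exists_finite_monoidHom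
  intro g hg
  obtain ⟨n, hn⟩ := Function.ne_iff.1
    ((map_ne_one_iff _ (semiToP_injective hd r hr hr2 hrd)).2 hg)
  exact ⟨Omega d (n + 1), inferInstance, inferInstance,
    (Pi.evalMonoidHom _ n).comp (semiToP hd r hr hr2 hrd), hn⟩

include hr hr2 hrd in
theorem fg_N : Group.FG (N hd r) := by
  obtain ⟨s, hs⟩ := exists_four_generators hd r hr hr2 hrd
  exact (Group.fg_iff_subgroup_fg _).2 ((Subgroup.fg_iff _).2 ⟨_, hs, Set.finite_range s⟩)

include hr hr2 hrd in
theorem fg_range_inl : (SemidirectProduct.inl : N hd r →* Semi hd r).range.FG := by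
  have := fg_N hd r hr hr2 hrd
  exact (Group.fg_iff_subgroup_fg _).1 inferInstance

include hr hr2 hrd in
theorem fg_semi : Group.FG (Semi hd r) := by
  have h2 : (SemidirectProduct.inr : _ →* Semi hd r).range.FG :=
    (Group.fg_iff_subgroup_fg _).1 inferInstance
  have h3 := (fg_range_inl hd r hr hr2 hrd).sup h2
  rw [Group.fg_def]
  convert h3
  rw [eq_comm, eq_top_iff]
  intro x _
  rw [← SemidirectProduct.inl_left_mul_inr_right x]
  exact mul_mem (Subgroup.mem_sup_left ⟨_, rfl⟩) (Subgroup.mem_sup_right ⟨_, rfl⟩)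

instance normal_range_inl : (SemidirectProduct.inl : N hd r →* Semi hd r).range.Normal := by
  rw [SemidirectProduct.range_inl_eq_ker_rightHom]; infer_instance

include hr hr2 hrd in
-- With a complement K, write τ = n k. Since k centralizes N, τ acts on N as conjugation by n and
-- would be inner.
theorem not_isDirectFactor_range_inl :
    ¬ IsDirectFactor (SemidirectProduct.inl : N hd r →* Semi hd r).range := by
  rintro ⟨K, hS, hK, hc⟩
  apply tau_notMem_range hd r hr hr2 hrd
  set t : Subgroup.zpowers (tau hd r) := ⟨tau hd r, Subgroup.mem_zpowers _⟩ with ht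
  have h1 : (SemidirectProduct.inr t : Semi hd r) ∈
      (SemidirectProduct.inl : N hd r →* Semi hd r).range ⊔ K := by
    rw [hc.sup_eq_top]; trivial
  obtain ⟨_, ⟨n, rfl⟩, k, hk, e⟩ := Subgroup.mem_sup_of_normal_left.1 h1
  refine ⟨n, ?_⟩
  ext1 m
  apply SemidirectProduct.inl_injective (φ := (Subgroup.zpowers (tau hd r)).subtype)
  have h2 := Subgroup.commute_of_normal_of_disjoint _ _ hS hK hc.disjoint
    (SemidirectProduct.inl m) k ⟨m, rfl⟩ hk
  have h3 := SemidirectProduct.inl_aut (φ := (Subgroup.zpowers (tau hd r)).subtype) t m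
  have h4 : k * SemidirectProduct.inl m * k⁻¹ = SemidirectProduct.inl m := by
    rw [← h2.eq, mul_inv_cancel_right]
  rw [MulAut.conj_apply, map_mul, map_mul, map_inv]
  change _ = SemidirectProduct.inl (((Subgroup.zpowers (tau hd r)).subtype t) m)
  rw [h3, map_inv, ← e]
  nth_rw 1 [← h4]
  group

include hr hr2 hrd in
-- The complement is the kernel of the extension F : Ĝ → P of τ ↦ ε: restricted along N̂ → Ĝ, F is
-- the bijection `completionToP`.
theorem isClosedDirectFactor_completion : IsClosedDirectFactor
    (profiniteMap (SemidirectProduct.inl : N hd r →* Semi hd r).range.subtype).hom.toMonoidHom.range := by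
  set S := (SemidirectProduct.inl : N hd r →* Semi hd r).range with hS
  let F : ProfiniteGrp.profiniteCompletion.obj (GrpCat.of (Semi hd r)) →* PGroup d :=
    (ProfiniteGrp.ProfiniteCompletion.lift (P := ProfiniteGrp.of (PGroup d))
      (GrpCat.ofHom (semiToP hd r hr hr2 hrd))).hom.toMonoidHom
  have hF : Continuous F := (ProfiniteGrp.ProfiniteCompletion.lift
    (P := ProfiniteGrp.of (PGroup d)) (GrpCat.ofHom (semiToP hd r hr hr2 hrd))).hom.continuous_toFun
  have hcomp : ∀ x, F (profiniteMap SemidirectProduct.inl x) = completionToP hd r x := by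
    intro x
    refine eq_of_toCompletion (Y := PGroup d) (f := fun x => F (profiniteMap SemidirectProduct.inl x))
      (g := toP hd r) (hF.comp (continuous_profiniteMap _)) (continuous_toP hd r) (fun y => ?_) x
    rw [profiniteMap_toCompletion, toP_toCompletion, ← semiToP_inl hd r hr hr2 hrd]
    exact lift_toCompletion (P := ProfiniteGrp.of (PGroup d)) _ _
  let e : N hd r ≃* S := MonoidHom.ofInjective SemidirectProduct.inl_injective
  have he : S.subtype.comp e.toMonoidHom = SemidirectProduct.inl := by ext1; rfl
  refine ⟨isClosed_range_profiniteMap _, F.ker, ?_, normal_range_profiniteMap S,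
    F.normal_ker, ?_⟩
  · exact isClosed_singleton.preimage hF
  · refine IsCompl.of_eq ?_ ?_
    · rw [eq_bot_iff]
      rintro _ ⟨⟨y, rfl⟩, hx⟩
      obtain ⟨n, rfl⟩ := profiniteMap_surjective_of_mulEquiv e y
      change F (profiniteMap S.subtype (profiniteMap e.toMonoidHom n)) = 1 at hx
      rw [← profiniteMap_comp, he, hcomp,
        map_eq_one_iff _ (completionToP_injective hd r hr hr2 hrd)] at hx
      rw [hx, map_one, map_one]; exact one_mem _
    · rw [eq_top_iff]
      intro γ _
      obtain ⟨n, hn⟩ := completionToP_surjective hd r hr hr2 hrd (F γ)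
      rw [← mul_inv_cancel_left (profiniteMap SemidirectProduct.inl n) γ]
      refine mul_mem (Subgroup.mem_sup_left ⟨profiniteMap e.toMonoidHom n, ?_⟩)
        (Subgroup.mem_sup_right ?_)
      · rw [← he]; exact (profiniteMap_comp _ _ _).symm
      · change F _ = 1
        rw [map_mul, map_inv, hcomp, hn, inv_mul_cancel]

include hr hr2 hrd in
theorem isGoldsteinGuralnickCounterexample : IsGoldsteinGuralnickCounterexample
    (SemidirectProduct.inl : N hd r →* Semi hd r).range where
  fg := fg_semi hd r hr hr2 hrd
  residuallyFinite := residuallyFinite_semi hd r hr hr2 hrd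
  fg_subgroup := fg_range_inl hd r hr hr2 hrd
  normal := inferInstance
  isClosedDirectFactor := isClosedDirectFactor_completion hd r hr hr2 hrd
  not_isDirectFactor := not_isDirectFactor_range_inl hd r hr hr2 hrd

end

end AltTelescope

open Equiv Filter Topology

/-! ### A criterion for amenability -/

section Amenable

variable {G K : Type*} [Group G] [Group K]

/-- A group acting freely by left multiplication through `e` is an equivariant image of the group
it acts on. -/
theorem exists_equivariant_retraction {e : G →* K} (he : Function.Injective e) :
    ∃ ρ : K → G, ∀ g x, ρ (e g * x) = g * ρ x := by
  -- ρ x is the element of G carrying the chosen representative of the coset of x to x.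
  let R := QuotientGroup.rightRel e.range
  have hrep : ∀ x : K, ∃ g, e g = x * (Quotient.out (Quotient.mk R x))⁻¹ := fun x => by
    have := QuotientGroup.rightRel_apply.1 (Quotient.mk_out (s := R) x)
    exact this
  choose ρ hρ using hrep
  refine ⟨ρ, fun g x => he ?_⟩
  have h : Quotient.mk R (e g * x) = Quotient.mk R x := by
    refine Quotient.sound (QuotientGroup.rightRel_apply.2 ?_)
    exact ⟨g⁻¹, by rw [map_inv]; group⟩
  rw [hρ, h, map_mul, hρ, mul_assoc]

/-- A group is amenable if it has a sequence of asymptotically invariant means. -/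
theorem isAmenable_of_asymptotically_invariant {e : G →* K} (he : Function.Injective e)
    {S : Set G} (hS : Subgroup.closure S = ⊤) (L : ℕ → (K → ℝ) →ₗ[ℝ] ℝ)
    (hpos : ∀ m h, 0 ≤ h → 0 ≤ L m h) (hone : ∀ m, L m 1 = 1)
    (hinv : ∀ s ∈ S, ∀ h : K → ℝ, 0 ≤ h → h ≤ 1 →
      Tendsto (fun m => L m (fun x => h (e s * x)) - L m h) atTop (𝓝 0)) : IsAmenable G := by
  obtain ⟨ρ, hρ⟩ := exists_equivariant_retraction he
  let ind : Set G → K → ℝ := fun A => Set.indicator (ρ ⁻¹' A) 1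
  have hind0 : ∀ A, 0 ≤ ind A := fun A x => Set.indicator_nonneg (fun _ _ => zero_le_one) x
  have hind1 : ∀ A, ind A ≤ 1 := fun A x => Set.indicator_le_self' (fun _ _ => zero_le_one) x
  have hle : ∀ m A, L m (ind A) ≤ 1 := fun m A => by
    have := hpos m (1 - ind A) (sub_nonneg.2 (hind1 A))
    rw [map_sub, hone] at this
    linarith
  -- The measure of A is the ultralimit of the means of ρ⁻¹(A).
  have hlim : ∀ A, ∃ x, Tendsto (fun m => L m (ind A)) (hyperfilter ℕ : Filter ℕ) (𝓝 x) := by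
    intro A
    obtain ⟨x, -, hx⟩ := (isCompact_Icc (a := (0 : ℝ)) (b := 1)).ultrafilter_le_nhds
      ((hyperfilter ℕ).map fun m => L m (ind A))
      (by
        rw [le_principal_iff, Ultrafilter.mem_coe, Ultrafilter.mem_map]
        exact Filter.univ_mem' fun m => ⟨hpos m _ (hind0 A), hle m A⟩)
    exact ⟨x, hx⟩
  choose μ hμ using hlim
  have htrans : ∀ g A, (∀ A, μ ((fun x => g * x) '' A) = μ A) →
      μ ((fun x => g⁻¹ * x) '' A) = μ A := fun g A hg => by
    rw [← hg, Set.image_image]; simp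
  -- The elements preserving μ form a subgroup, so generators suffice.
  let H : Subgroup G :=
    { carrier := {g | ∀ A, μ ((fun x => g * x) '' A) = μ A}
      one_mem' := fun A => by simp
      mul_mem' := fun {g g'} hg hg' A => by
        rw [← hg' A, ← hg ((fun x => g' * x) '' A), Set.image_image]; simp only [mul_assoc]
      inv_mem' := fun {g} hg A => htrans g A hg }
  have hH : H = ⊤ := by
    rw [eq_top_iff, ← hS, Subgroup.closure_le]
    intro s hs A
    have h1 : ind A = fun x => ind ((fun x => s * x) '' A) (e s * x) := by
      funext x
      have : e s * x ∈ ρ ⁻¹' ((fun x => s * x) '' A) ↔ x ∈ ρ ⁻¹' A := by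
        simp [hρ]
      by_cases hx : x ∈ ρ ⁻¹' A
      · simp only [ind, Set.indicator_of_mem hx, Set.indicator_of_mem (this.2 hx), Pi.one_apply]
      · simp only [ind, Set.indicator_of_notMem hx, Set.indicator_of_notMem (mt this.1 hx)]
    have h2 := (hinv s hs (ind ((fun x => s * x) '' A)) (hind0 _) (hind1 _)).mono_left
      (Nat.hyperfilter_le_atTop)
    rw [← h1] at h2
    have h3 := tendsto_nhds_unique h2 ((hμ A).sub (hμ _))
    linarith
  refine ⟨μ, fun A => ge_of_tendsto' (hμ A) fun m => hpos m _ (hind0 A), ?_, ?_, ?_⟩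
  · refine tendsto_nhds_unique (hμ _) ?_
    have : ind Set.univ = 1 := by simp [ind]
    simp only [this, hone]
    exact tendsto_const_nhds
  · intro A B hAB
    refine tendsto_nhds_unique (hμ _) (((hμ A).add (hμ B)).congr fun m => ?_)
    rw [← map_add]
    congr 1
    exact (Set.indicator_union_of_disjoint (hAB.preimage ρ) (1 : K → ℝ)).symm
  · exact fun g => (hH ▸ Subgroup.mem_top g : g ∈ H)

end Amenable

/-! ### Products of angular densities -/

namespace AltTelescope

noncomputable section

open Finset

variable {B V : Type*} [Group B] [Fintype B] [DecidableEq B] [Fintype V]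

/-- The unit vector at angle `t` between the point mass at `1` and a constant function. -/
def angular (t : ℝ) (b : B) : ℝ :=
  if b = 1 then Real.cos t else Real.sin t / √(Fintype.card B - 1)

/-- The angle of the constant function. -/
def uniformAngle (B : Type*) [Fintype B] : ℝ := Real.arccos (1 / √(Fintype.card B))

/-- The vectors move on a great circle through two orthogonal unit vectors. -/
theorem sum_angular_mul_angular [Nontrivial B] (t s : ℝ) :
    ∑ b : B, angular t b * angular s b = Real.cos (t - s) := by
  have hcard : (1 : ℝ) < Fintype.card B := by exact_mod_cast Fintype.one_lt_card
  rw [← Finset.add_sum_erase _ _ (mem_univ (1 : B))]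
  have h : ∀ b ∈ univ.erase (1 : B), angular t b * angular s b =
      Real.sin t * Real.sin s / (Fintype.card B - 1) := fun b hb => by
    rw [angular, angular, if_neg (ne_of_mem_erase hb), if_neg (ne_of_mem_erase hb), div_mul_div_comm,
      Real.mul_self_sqrt (by linarith)]
  rw [sum_congr rfl h, sum_const, card_erase_of_mem (mem_univ _), card_univ, nsmul_eq_mul,
    Nat.cast_sub Fintype.card_pos, Nat.cast_one, Real.cos_sub, angular, angular, if_pos rfl,
    if_pos rfl]
  have : (Fintype.card B - 1 : ℝ) ≠ 0 := by linarith
  field_simp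

theorem angular_zero {b : B} (hb : b ≠ 1) : angular 0 b = 0 := by
  rw [angular, if_neg hb, Real.sin_zero, zero_div]

theorem angular_uniformAngle [Nontrivial B] (b : B) :
    angular (uniformAngle B) b = 1 / √(Fintype.card B) := by
  have hcard : (1 : ℝ) < Fintype.card B := by exact_mod_cast Fintype.one_lt_card
  have h1 : 1 < √(Fintype.card B : ℝ) := by
    rw [Real.lt_sqrt (by norm_num)]; simpa using hcard
  have h2 : 1 / √(Fintype.card B : ℝ) ≤ 1 := by rw [div_le_one (by linarith)]; exact h1.le
  have h3 : 0 ≤ 1 / √(Fintype.card B : ℝ) := by positivity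
  rw [angular, uniformAngle]
  split
  · exact Real.cos_arccos (by linarith) h2
  · have e : 1 - (1 / √(Fintype.card B : ℝ)) ^ 2 = (Fintype.card B - 1) / Fintype.card B := by
      rw [div_pow, one_pow, Real.sq_sqrt (by linarith)]
      field_simp
    rw [Real.sin_arccos, e, Real.sqrt_div (by linarith)]
    have : √(Fintype.card B - 1 : ℝ) ≠ 0 := (Real.sqrt_pos.2 (by linarith)).ne'
    field_simp

/-- The product of the vectors with angles `a v`. -/
def amplitude (a : V → ℝ) (ξ : V → B) : ℝ := ∏ v, angular (a v) (ξ v)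

theorem eq_one_of_amplitude_ne_zero {a : V → ℝ} {ξ : V → B} (h : amplitude a ξ ≠ 0) {v : V}
    (hv : a v = 0) : ξ v = 1 := by
  by_contra h1
  exact h (prod_eq_zero (mem_univ v) (by rw [hv, angular_zero h1]))

theorem amplitude_comp (a : V → ℝ) (π : Perm V) (ξ : V → B) :
    amplitude (fun v => a (π v)) (fun v => ξ (π v)) = amplitude a ξ :=
  Equiv.prod_comp π fun v => angular (a v) (ξ v)

/-- At the uniform angle the vector is constant, so translating the label there has no effect. -/
theorem amplitude_shift [Nontrivial B] {a : V → ℝ} (π : Perm V) {η : V → B}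
    (hη : ∀ v, η v ≠ 1 → a (π v) = uniformAngle B) (ξ : V → B) :
    amplitude a (fun v => η (π.symm v) * ξ (π.symm v)) = amplitude (fun v => a (π v)) ξ := by
  rw [amplitude, ← Equiv.prod_comp π]
  refine prod_congr rfl fun v _ => ?_
  rw [symm_apply_apply]
  by_cases h : η v = 1
  · rw [h, one_mul]
  · simp only [hη v h, angular_uniformAngle]

variable [DecidableEq V]

theorem sum_amplitude_mul_amplitude [Nontrivial B] (a a' : V → ℝ) :
    ∑ ξ : V → B, amplitude a ξ * amplitude a' ξ = ∏ v, Real.cos (a v - a' v) := by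
  simp only [amplitude, ← prod_mul_distrib, ← sum_angular_mul_angular (B := B)]
  rw [prod_univ_sum, Fintype.piFinset_univ]

theorem sum_amplitude_sq [Nontrivial B] (a : V → ℝ) : ∑ ξ : V → B, amplitude a ξ ^ 2 = 1 := by
  simp only [pow_two, sum_amplitude_mul_amplitude, sub_self, Real.cos_zero, prod_const_one]

theorem one_sub_sum_le_prod {ι : Type*} (s : Finset ι) {x : ι → ℝ} (hx : ∀ i, |x i| ≤ 1) :
    1 - ∑ i ∈ s, (1 - x i) ≤ ∏ i ∈ s, x i := by
  classical
  induction s using Finset.induction_on with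
  | empty => simp
  | insert i s hi ih =>
    rw [sum_insert hi, prod_insert hi]
    have h1 : ∏ i ∈ s, x i ≤ 1 := by
      refine (le_abs_self _).trans ?_
      rw [abs_prod]
      exact prod_le_one (fun _ _ => abs_nonneg _) fun i _ => hx i
    have h2 := (abs_le.1 (hx i)).2
    nlinarith [mul_nonneg (sub_nonneg.2 h1) (sub_nonneg.2 h2)]

/-- For unit vectors with inner product I, Cauchy–Schwarz bounds the left side by 2√(1 − I²), and I
= ∏ cos(a v − a' v) ≥ 1 − ½ ∑ (a v − a' v)². -/
theorem sum_abs_sq_sub_sq_le [Nontrivial B] (a a' : V → ℝ) :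
    ∑ ξ : V → B, |amplitude a ξ ^ 2 - amplitude a' ξ ^ 2| ≤ 2 * √(∑ v, (a v - a' v) ^ 2) := by
  set I := ∏ v, Real.cos (a v - a' v) with hI
  have hI1 : I ≤ 1 := by
    refine (le_abs_self _).trans ?_
    rw [hI, abs_prod]
    exact prod_le_one (fun _ _ => abs_nonneg _) fun _ _ => Real.abs_cos_le_one _
  have hI2 : 1 - (∑ v, (a v - a' v) ^ 2) / 2 ≤ I := by
    refine le_trans ?_ (one_sub_sum_le_prod univ fun v => Real.abs_cos_le_one _)
    rw [sum_div]
    refine sub_le_sub_left (sum_le_sum fun v _ => ?_) 1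
    have := Real.one_sub_sq_div_two_le_cos (x := a v - a' v)
    linarith
  have hdiff : ∑ ξ : V → B, |amplitude a ξ - amplitude a' ξ| ^ 2 = 2 - 2 * I := by
    simp only [sq_abs, sub_sq, sum_add_distrib, sum_sub_distrib, sum_amplitude_sq, mul_assoc,
      ← mul_sum, sum_amplitude_mul_amplitude]
    ring
  have hsum : ∑ ξ : V → B, |amplitude a ξ + amplitude a' ξ| ^ 2 = 2 + 2 * I := by
    simp only [sq_abs, add_sq, sum_add_distrib, sum_amplitude_sq, mul_assoc,
      ← mul_sum, sum_amplitude_mul_amplitude]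
    ring
  have hcs := sum_mul_sq_le_sq_mul_sq univ
    (fun ξ : V → B => |amplitude a ξ - amplitude a' ξ|) fun ξ => |amplitude a ξ + amplitude a' ξ|
  rw [hdiff, hsum] at hcs
  have e : ∀ ξ : V → B, |amplitude a ξ ^ 2 - amplitude a' ξ ^ 2| =
      |amplitude a ξ - amplitude a' ξ| * |amplitude a ξ + amplitude a' ξ| := fun ξ => by
    rw [← abs_mul]; ring_nf
  simp only [e]
  refine abs_le_of_sq_le_sq' ?_ (by positivity) |>.2
  rw [mul_pow, Real.sq_sqrt (sum_nonneg fun _ _ => sq_nonneg _)]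
  nlinarith

end

end AltTelescope

open Equiv

namespace AltTelescope

noncomputable section

/-! ### Terminal runs of a word -/

section Runs

variable {d : ℕ} (hd : 5 ≤ d) {M : ℕ}

/-- From the position `i` on the letters of `v` are all `x_1` or all `x_d`. -/
def IsRun (i : ℕ) (v : Word d (M + 3)) : Prop :=
  ∃ z : Fin d, (z = ⟨0, by omega⟩ ∨ z = lastLetter hd) ∧ ∀ k : Fin (M + 3), i ≤ k → v k = z

theorem IsRun.mono {i j : ℕ} (h : i ≤ j) {v : Word d (M + 3)} (hv : IsRun hd i v) :
    IsRun hd j v := by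
  obtain ⟨z, hz, hk⟩ := hv
  exact ⟨z, hz, fun k hk' => hk k (h.trans hk')⟩

open scoped Classical in
/-- The number of positions before the last two from which `v` is constant. -/
def runCount (v : Word d (M + 3)) : ℕ := ((Finset.range (M + 1)).filter fun i => IsRun hd i v).card

theorem runCount_const : runCount hd (fun _ : Fin (M + 3) => lastLetter hd) = M + 1 := by
  classical
  rw [runCount, Finset.filter_true_of_mem, Finset.card_range]
  exact fun i _ => ⟨_, Or.inr rfl, fun _ _ => rfl⟩

theorem isRun_of_runCount_ne_zero {v : Word d (M + 3)} (h : runCount hd v ≠ 0) : IsRun hd M v := by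
  classical
  obtain ⟨i, hi⟩ := Finset.card_ne_zero.1 h
  rw [Finset.mem_filter, Finset.mem_range] at hi
  exact hi.2.mono hd (by omega)

theorem isRun_delta {i : ℕ} {v : Word d (M + 3)} (h : IsRun hd i v) :
    IsRun hd i (diagHom d (M + 3) (delta hd) v) := by
  obtain ⟨z, hz, hk⟩ := h
  refine ⟨delta hd z, ?_, fun k hk' => congrArg (delta hd) (hk k hk')⟩
  rcases hz with rfl | rfl
  · exact Or.inr (delta_first hd)
  · exact Or.inl (delta_last hd)

theorem diag_delta_delta (l : ℕ) (v : Word d l) :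
    diagHom d l (delta hd) (diagHom d l (delta hd) v) = v := funext fun i => delta_delta hd (v i)

theorem runCount_delta (v : Word d (M + 3)) :
    runCount hd (diagHom d (M + 3) (delta hd) v) = runCount hd v := by
  classical
  rw [runCount, runCount]
  congr 1
  refine Finset.filter_congr fun i _ => ⟨fun h => ?_, isRun_delta hd⟩
  have := isRun_delta hd h
  rwa [diag_delta_delta] at this

/-- The permutation moves a word only in two consecutive letters after a prefix `x_d^j`. -/
def SpineLocal (π : Perm (Word d (M + 3))) : Prop :=
  ∀ v, π v = v ∨ ∃ j : Fin (M + 2),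
    (∀ i : Fin (M + 3), (i : ℕ) < j → v i = lastLetter hd ∧ π v i = lastLetter hd ∧
      v j.castSucc ≠ lastLetter hd ∧ π v j.castSucc ≠ lastLetter hd) ∧
    ∀ i : Fin (M + 3), (j : ℕ) + 2 ≤ i → π v i = v i

variable {π : Perm (Word d (M + 3))}

/-- Altering the last letter would require x_d at position M and another letter at M+1, impossible
in a run from M on. This is why runs are counted only up to position M in words of length M+3. -/
theorem SpineLocal.apply_last (hπ : SpineLocal hd π) {v : Word d (M + 3)} (hv : IsRun hd M v) :
    π v (Fin.last _) = v (Fin.last _) := by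
  rcases hπ v with h | ⟨j, h1, h2⟩
  · rw [h]
  rcases (show (j : ℕ) + 2 ≤ M + 2 ∨ (j : ℕ) = M + 1 by omega) with hj | hj
  · exact h2 _ hj
  · obtain ⟨z, -, hz⟩ := hv
    have h3 := h1 ⟨M, by omega⟩ (by simp [hj])
    rw [hz _ (by simp), hz _ (by simp [hj])] at h3
    exact (h3.2.2.1 h3.1).elim

theorem not_isRun {v : Word d (M + 3)} {j : Fin (M + 2)}
    (h : ∀ i : Fin (M + 3), (i : ℕ) < j → v i = lastLetter hd ∧ v j.castSucc ≠ lastLetter hd)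
    {i : ℕ} (hi : i < j) : ¬ IsRun hd i v := by
  rintro ⟨z, -, hz⟩
  have h3 := h ⟨i, by omega⟩ hi
  rw [hz _ (by simp), hz _ (by simp; omega)] at h3
  exact h3.2 h3.1

theorem runCount_le_of_iff {v v' : Word d (M + 3)} {j : ℕ}
    (h : ∀ i, i < j ∨ j + 2 ≤ i → (IsRun hd i v ↔ IsRun hd i v')) :
    runCount hd v ≤ runCount hd v' + 2 := by
  classical
  have : ((Finset.range (M + 1)).filter fun i => IsRun hd i v) ⊆
      ((Finset.range (M + 1)).filter fun i => IsRun hd i v') ∪ {j, j + 1} := by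
    intro i hi
    rw [Finset.mem_filter] at hi
    rw [Finset.mem_union, Finset.mem_filter, Finset.mem_insert, Finset.mem_singleton]
    by_cases h' : i < j ∨ j + 2 ≤ i
    · exact Or.inl ⟨hi.1, (h i h').1 hi.2⟩
    · right; omega
  refine (Finset.card_le_card this).trans ((Finset.card_union_le _ _).trans ?_)
  exact Nat.add_le_add_left Finset.card_le_two _

theorem SpineLocal.isRun_iff {v : Word d (M + 3)} {j : Fin (M + 2)}
    (h1 : ∀ i : Fin (M + 3), (i : ℕ) < j → v i = lastLetter hd ∧ π v i = lastLetter hd ∧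
      v j.castSucc ≠ lastLetter hd ∧ π v j.castSucc ≠ lastLetter hd)
    (h2 : ∀ i : Fin (M + 3), (j : ℕ) + 2 ≤ i → π v i = v i) (i : ℕ)
    (hi : i < (j : ℕ) ∨ (j : ℕ) + 2 ≤ i) : IsRun hd i v ↔ IsRun hd i (π v) := by
  rcases hi with hi | hi
  · exact iff_of_false (not_isRun hd (fun i hi => ⟨(h1 i hi).1, (h1 i hi).2.2.1⟩) hi)
      (not_isRun hd (fun i hi => ⟨(h1 i hi).2.1, (h1 i hi).2.2.2⟩) hi)
  · refine exists_congr fun z => and_congr_right fun _ => forall₂_congr fun k hk => ?_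
    rw [h2 k (hi.trans hk)]

theorem SpineLocal.sq_runCount_sub_le (hπ : SpineLocal hd π) (v : Word d (M + 3)) :
    ((runCount hd v : ℝ) - runCount hd (π v)) ^ 2 ≤ 4 := by
  rcases hπ v with h | ⟨j, h1, h2⟩
  · rw [h, sub_self]; norm_num
  have hiff := SpineLocal.isRun_iff hd h1 h2
  have h3 : (runCount hd v : ℝ) ≤ runCount hd (π v) + 2 := by
    exact_mod_cast runCount_le_of_iff hd hiff
  have h4 : (runCount hd (π v) : ℝ) ≤ runCount hd v + 2 := by
    exact_mod_cast runCount_le_of_iff hd fun i hi => (hiff i hi).symm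
  nlinarith

/-- The word `x_d^j x y z z ⋯ z`. -/
def nearRun (p : Fin (M + 2) × Fin d × Fin d × Fin d) : Word d (M + 3) := fun k =>
  if (k : ℕ) < p.1 then lastLetter hd else if (k : ℕ) = p.1 then p.2.1
    else if (k : ℕ) = p.1 + 1 then p.2.2.1 else p.2.2.2

/-- The count changes only if a run of v or of its image reaches back to the altered letters j, j+1;
then all later letters coincide. -/
theorem SpineLocal.mem_range_nearRun (hπ : SpineLocal hd π) {v : Word d (M + 3)}
    (hv : runCount hd v ≠ runCount hd (π v)) : v ∈ Set.range (nearRun hd (M := M)) := by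
  rcases hπ v with h | ⟨j, h1, h2⟩
  · rw [h] at hv; exact (hv rfl).elim
  have hiff := SpineLocal.isRun_iff hd h1 h2
  have h3 : ∃ i, i ≤ (j : ℕ) + 1 ∧ (IsRun hd i v ∨ IsRun hd i (π v)) := by
    by_contra! hcon
    apply hv
    classical
    rw [runCount, runCount]
    congr 1
    refine Finset.filter_congr fun i _ => ?_
    rcases Nat.lt_or_ge ((j : ℕ) + 1) i with hi | hi
    · exact hiff i (Or.inr hi)
    · exact iff_of_false (hcon i hi).1 (hcon i hi).2
  obtain ⟨z, hz⟩ : ∃ z, ∀ k : Fin (M + 3), (j : ℕ) + 2 ≤ k → v k = z := by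
    obtain ⟨i, hi, ⟨z, -, hz⟩ | ⟨z, -, hz⟩⟩ := h3
    · exact ⟨z, fun k hk => hz k (by omega)⟩
    · exact ⟨z, fun k hk => by rw [← h2 k hk, hz k (by omega)]⟩
  refine ⟨(j, v j.castSucc, v j.succ, z), ?_⟩
  funext k
  simp only [nearRun]
  split_ifs with c1 c2 c3
  · exact (h1 k c1).1.symm
  · congr 1; ext; simp [c2]
  · congr 1; ext; simp [c3]
  · exact (hz k (by omega)).symm

theorem SpineLocal.sum_sq_runCount_sub_le (hπ : SpineLocal hd π) :
    ∑ v, ((runCount hd v : ℝ) - runCount hd (π v)) ^ 2 ≤ 4 * ((M + 2) * d ^ 3) := by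
  classical
  have hsub : (Finset.univ.filter fun v => runCount hd v ≠ runCount hd (π v)) ⊆
      Finset.univ.image (nearRun hd (M := M)) := by
    intro v hv
    obtain ⟨p, hp⟩ := hπ.mem_range_nearRun hd (Finset.mem_filter.1 hv).2
    exact Finset.mem_image.2 ⟨p, Finset.mem_univ _, hp⟩
  have hcard : ((Finset.univ.filter fun v => runCount hd v ≠ runCount hd (π v)).card : ℝ) ≤
      (M + 2) * d ^ 3 := by
    have h1 := (Finset.card_le_card hsub).trans Finset.card_image_le
    have h2 : (Finset.univ : Finset (Fin (M + 2) × Fin d × Fin d × Fin d)).card =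
        (M + 2) * d ^ 3 := by
      simp; ring
    rw [h2] at h1
    exact_mod_cast h1
  rw [← Finset.sum_filter_of_ne (p := fun v => runCount hd v ≠ runCount hd (π v))]
  · refine (Finset.sum_le_card_nsmul _ _ 4 fun v _ => hπ.sq_runCount_sub_le hd v).trans ?_
    rw [nsmul_eq_mul, mul_comm]
    exact mul_le_mul_of_nonneg_left hcard (by norm_num)
  · intro v _ hv h
    rw [h, sub_self] at hv
    simp at hv

/-- The angle attached to a word: proportional to the length of its terminal run. -/
def slope (θ : ℝ) (v : Word d (M + 3)) : ℝ := θ * runCount hd v / (M + 1)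

theorem slope_const (θ : ℝ) : slope hd θ (fun _ : Fin (M + 3) => lastLetter hd) = θ := by
  rw [slope, runCount_const]
  push_cast
  field_simp

/-- O(M) words contribute O(1/M²) each. -/
theorem SpineLocal.sum_sq_slope_sub_le (hπ : SpineLocal hd π) (θ : ℝ) :
    ∑ v, (slope hd θ v - slope hd θ (π v)) ^ 2 ≤ 8 * θ ^ 2 * d ^ 3 * (1 / ((M : ℝ) + 1)) := by
  have h1 : ∀ v, (slope hd θ v - slope hd θ (π v)) ^ 2 =
      (θ / (M + 1)) ^ 2 * ((runCount hd v : ℝ) - runCount hd (π v)) ^ 2 := fun v => by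
    rw [slope, slope]; ring
  simp only [h1, ← Finset.mul_sum]
  refine (mul_le_mul_of_nonneg_left (hπ.sum_sq_runCount_sub_le hd) (sq_nonneg _)).trans ?_
  have h2 : (0 : ℝ) < M + 1 := by positivity
  have h3 : (M + 2 : ℝ) ≤ 2 * (M + 1) := by linarith
  have h4 : 8 * θ ^ 2 * (d : ℝ) ^ 3 * (1 / ((M : ℝ) + 1)) =
      (θ / (M + 1)) ^ 2 * (4 * ((2 * (M + 1)) * d ^ 3)) := by field_simp; ring
  rw [h4]
  gcongr

end Runs

/-- Sequences of permutations of words of length `m + 1`, constant from the index `m` on. -/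
def levelHom (d m : ℕ) : (Fin (m + 1) → Perm (Word d (m + 1))) →* (ℕ → Perm (InfWord d)) where
  toFun γ n := act d (m + 1) (γ ⟨min n m, by omega⟩)
  map_one' := by funext n; simp
  map_mul' γ γ' := by funext n; simp

/-! ### Permutations with prescribed directions at the ends of words -/

variable {d : ℕ} (hd : 5 ≤ d) (r : ℕ)

/-- The permutation `c̃` seen from the letter `x_d`, its conjugate seen from `x_1`. -/
def dirPerm (x : Fin d) (c : BGroup d r) (l : ℕ) : Perm (InfWord d) :=
  if x = lastLetter hd then tildePerm hd r c l
  else if x = ⟨0, by omega⟩ then deltaInf hd * tildePerm hd r c l * deltaInf hd else 1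

theorem dirPerm_lastLetter (c : BGroup d r) (l : ℕ) :
    dirPerm hd r (lastLetter hd) c l = tildePerm hd r c l := if_pos rfl

theorem dirPerm_delta (x : Fin d) (c : BGroup d r) (l : ℕ) :
    dirPerm hd r (delta hd x) c l = deltaInf hd * dirPerm hd r x c l * deltaInf hd := by
  have h0 : lastLetter hd ≠ ⟨0, by omega⟩ := lastLetter_ne hd (by omega)
  have hD : ∀ f, deltaInf hd * (deltaInf hd * f * deltaInf hd) * deltaInf hd = f := fun f => by
    rw [mul_assoc, mul_assoc, mul_assoc, deltaInf_mul_self, mul_one, ← mul_assoc,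
      deltaInf_mul_self, one_mul]
  by_cases h1 : x = lastLetter hd
  · subst h1
    rw [delta_last, dirPerm_lastLetter, dirPerm, if_neg h0.symm, if_pos rfl]
  by_cases h2 : x = ⟨0, by omega⟩
  · subst h2
    rw [delta_first, dirPerm_lastLetter, dirPerm, if_neg h0.symm, if_pos rfl, hD]
  rw [dirPerm, if_neg, if_neg, dirPerm, if_neg h1, if_neg h2, mul_one, deltaInf_mul_self]
  · rw [← delta_last hd]; exact (delta hd).injective.ne h1
  · rw [← delta_first hd]; exact (delta hd).injective.ne h2

theorem tildePerm_one (hr : r < d) (l : ℕ) : tildePerm hd r 1 l = 1 := by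
  have h1 := tildePerm_mul hd r hr l 1 1
  rwa [mul_one, left_eq_mul] at h1

theorem dirPerm_one (hr : r < d) (x : Fin d) (l : ℕ) : dirPerm hd r x 1 l = 1 := by
  rw [dirPerm, tildePerm_one hd r hr, mul_one, deltaInf_mul_self]
  simp

/-- The sequence of permutations acting below a word `v` by the direction given by the last letter
of `v` and by `ξ v`. -/
def directed {M : ℕ} (ξ : Word d (M + 3) → BGroup d r) : ℕ → Perm (InfWord d) := fun n =>
  if M + 3 ≤ n then
    graft d (M + 3) fun v => dirPerm hd r (v (Fin.last _)) (ξ v) (n - (M + 3))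
  else 1

theorem exists_levelHom_eq {m : ℕ} {g : ℕ → Perm (InfWord d)}
    (h : ∀ n ≤ m, ∃ l ≤ m + 1, g n ∈ (act d l).range) :
    ∃ γ, ∀ n, levelHom d m γ n = g (min n m) := by
  have h' : ∀ n : Fin (m + 1), ∃ σ : Perm (Word d (m + 1)), act d (m + 1) σ = g n := fun n => by
    obtain ⟨l, hl, σ, hσ⟩ := h n (by omega)
    exact ⟨prefixHom hl σ, by rw [act_prefixHom, hσ]⟩
  choose γ hγ using h'
  exact ⟨γ, fun n => hγ _⟩

theorem deltaInf_mul_graft {m : ℕ} (F : Word d m → Perm (InfWord d)) :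
    deltaInf hd * graft d m F = graft d m (fun v => deltaInf hd *
      F (diagHom d m (delta hd) v) * deltaInf hd) * deltaInf hd := by
  ext1 w
  have hpre : pre m (deltaInf hd w) = diagHom d m (delta hd) (pre m w) := rfl
  have hdrop : drop m (deltaInf hd w) = deltaInf hd (drop m w) := rfl
  have hD : ∀ w, deltaInf hd (deltaInf hd w) = w := fun w =>
    DFunLike.congr_fun (deltaInf_mul_self hd) w
  rw [Perm.mul_apply, Perm.mul_apply, graft_apply, graft_apply, hpre, diag_delta_delta, hdrop,
    Perm.mul_apply, Perm.mul_apply, hD]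
  funext i
  rw [deltaInf_apply]
  rcases lt_or_ge i m with h | h
  · rw [app_of_lt _ _ h, app_of_lt _ _ h]; rfl
  · rw [app_of_le _ _ h, app_of_le _ _ h]; rfl

/-- The constant sequence of the letterwise involution. -/
def deltaSeq : ℕ → Perm (InfWord d) := fun _ => deltaInf hd

theorem deltaSeq_mul_self : deltaSeq hd * deltaSeq hd = 1 := funext fun _ => deltaInf_mul_self hd

theorem deltaSeq_mul_directed {M : ℕ} (ξ : Word d (M + 3) → BGroup d r) :
    deltaSeq hd * directed hd r ξ =
      directed hd r (fun v => ξ (diagHom d (M + 3) (delta hd) v)) * deltaSeq hd := by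
  funext n
  change deltaInf hd * directed hd r ξ n = directed hd r _ n * deltaInf hd
  rw [directed, directed]
  split
  · rw [deltaInf_mul_graft]
    congr 3
    funext v
    change deltaInf hd * dirPerm hd r (delta hd (v (Fin.last _))) _ _ * deltaInf hd = _
    rw [← dirPerm_delta, delta_delta]
  · rw [mul_one, one_mul]

theorem deltaSeq_mul_levelHom (m : ℕ) (γ : Fin (m + 1) → Perm (Word d (m + 1))) :
    deltaSeq hd * levelHom d m γ = levelHom d m (fun i => diagHom d (m + 1) (delta hd) * γ i *
      diagHom d (m + 1) (delta hd)) * deltaSeq hd := by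
  funext n
  change deltaInf hd * act d (m + 1) _ = act d (m + 1) _ * deltaInf hd
  rw [← deltaInf_mul_act, mul_assoc, deltaInf_mul_self, mul_one]

/-- Left multiplication by `g` acts on the elements `directed ξ`, up to elements of finite level,
by a permutation of words and a translation over the word `x_d^m`. -/
def Absorbs (M : ℕ) (g : ℕ → Perm (InfWord d)) : Prop :=
  ∃ (π : Perm (Word d (M + 3))) (η : Word d (M + 3) → BGroup d r)
    (γ : Fin (M + 3 + 1) → Perm (Word d (M + 3 + 1))), SpineLocal hd π ∧
    (∀ v, η v ≠ 1 → π v = fun _ => lastLetter hd) ∧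
    ∀ ξ : Word d (M + 3) → BGroup d r, (∀ v, ξ v ≠ 1 → IsRun hd M v) →
      g * directed hd r ξ =
        directed hd r (fun v => η (π.symm v) * ξ (π.symm v)) * levelHom d (M + 3) γ

/-- π carries labels along. Directions depend on the last letter alone, which π preserves wherever
the label is nontrivial. -/
theorem act_mul_directed (hr : r < d) {M n : ℕ} (hn : M + 3 ≤ n) {π : Perm (Word d (M + 3))}
    (hπ : SpineLocal hd π) {ξ : Word d (M + 3) → BGroup d r} (hξ : ∀ v, ξ v ≠ 1 → IsRun hd M v) :
    act d (M + 3) π * directed hd r ξ n =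
      directed hd r (fun v => ξ (π.symm v)) n * act d (M + 3) π := by
  rw [directed, directed, if_pos hn, if_pos hn, act_mul_graft]
  congr 2
  funext v
  change dirPerm hd r (π.symm v _) (ξ (π.symm v)) _ = _
  by_cases h : ξ (π.symm v) = 1
  · rw [h, dirPerm_one hd r hr, dirPerm_one hd r hr]
  · have := hπ.apply_last hd (hξ _ h)
    rw [apply_symm_apply] at this
    rw [this]

theorem absorbs_delta (hr : r < d) (M : ℕ) (ω : Omega d 1) :
    Absorbs hd r M (toSeq d (Delta ω)) := by
  have hseq : ∀ n, toSeq d (Delta ω) n = act d 1 (toPerm d 1 ω) := fun n => by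
    rw [← deltaFrom_zero, toSeq_deltaFrom, if_pos (Nat.zero_le n)]
  obtain ⟨γ, hγ⟩ := exists_levelHom_eq (m := M + 3) (g := toSeq d (Delta ω))
    fun n _ => ⟨1, by omega, _, (hseq n).symm⟩
  have hπ : SpineLocal hd (prefixHom (show 1 ≤ M + 3 by omega) (toPerm d 1 ω)) := fun v => by
    -- With j = 0 the prefix condition is vacuous, and only the first letter moves.
    refine Or.inr ⟨0, fun i hi => by simp at hi, fun i hi => ?_⟩
    exact dif_neg (by simp at hi; omega)
  refine ⟨_, 1, γ, hπ, fun v hv => (hv rfl).elim, fun ξ hξ => ?_⟩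
  funext n
  rw [Pi.mul_apply, Pi.mul_apply, hγ, hseq, hseq]
  rcases lt_or_ge n (M + 3) with hn | hn
  · rw [directed, directed, if_neg (by omega), if_neg (by omega), mul_one, one_mul]
  · rw [← act_prefixHom (show 1 ≤ M + 3 by omega), act_mul_directed hd r hr hn hπ hξ]
    simp only [Pi.one_apply, one_mul]

theorem spineLocal_of_act_eq (hr : r < d) {M : ℕ} {c : BGroup d r} {π : Perm (Word d (M + 3))}
    (hπ : act d (M + 3) π = tildePerm hd r c (M + 2)) : SpineLocal hd π := by
  intro v
  have hv : ∀ i : Fin (M + 3), π v i = tildePerm hd r c (M + 2) (app v fun _ => lastLetter hd) i :=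
    fun i => by rw [← hπ, act_app, app_of_lt _ _ i.2]
  have hv' : ∀ i : Fin (M + 3), v i = app v (fun _ => lastLetter hd) (i : ℕ) := fun i => by
    rw [app_of_lt _ _ i.2]
  rcases tildePerm_apply_cases hd r hr (M + 2) c (app v fun _ => lastLetter hd) with
    h | ⟨j, hj, h1, h2, h3⟩
  · exact Or.inl (funext fun i => by rw [hv, h, ← hv'])
  · have hne : ∀ {w : InfWord d}, w ∈ phiSet hd r j → w j ≠ lastLetter hd := fun hw h => by
      have := hw.2
      rw [h] at this
      simp only [lastLetter] at this
      omega
    refine Or.inr ⟨⟨j, hj⟩, fun i hi => ⟨?_, ?_, ?_, ?_⟩, fun i hi => ?_⟩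
    · rw [hv']; exact h1.1 i hi
    · rw [hv]; exact h2.1 i hi
    · rw [hv']; exact hne h1
    · rw [hv]; exact hne h2
    · rw [hv, hv', h3 _ hi]

/-- Factor `c̃` into its action π on words of length M+3, one φ straddling that length, and the tail
beneath x_d^(M+3). The tail becomes a translation of one label, φ commutes with the labelled
element, and π permutes the labels. -/
theorem absorbs_tilde (hr : r < d) (M : ℕ) (c : BGroup d r) :
    Absorbs hd r M (toSeq d (tilde hd r c)) := by
  obtain ⟨γ, hγ⟩ := exists_levelHom_eq (m := M + 3) (g := tildePerm hd r c)
    fun n hn => ⟨n + 1, by omega, tildePerm_mem_act hd r n c⟩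
  obtain ⟨π, hπ⟩ := tildePerm_mem_act hd r (M + 2) c
  have hloc := spineLocal_of_act_eq hd r hr hπ
  have hfix : π (fun _ => lastLetter hd) = fun _ => lastLetter hd := by
    have hnot : ∀ j < M + 2, (fun _ => lastLetter hd) ∉ phiSet hd r j := by
      rintro j - ⟨-, h⟩
      simp only [lastLetter] at h
      omega
    have := tildePerm_apply_of_notMem hd r c hnot
    rw [← hπ] at this
    have h2 := congrArg (pre (M + 3)) this
    rw [pre_act] at h2
    exact h2
  obtain ⟨η, hη1, hη2⟩ : ∃ η : Word d (M + 3) → BGroup d r,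
      η (fun _ => lastLetter hd) = c ∧ ∀ v, (v ≠ fun _ => lastLetter hd) → η v = 1 :=
    ⟨fun v => if v = fun _ => lastLetter hd then c else 1, if_pos rfl, fun v hv => if_neg hv⟩
  refine ⟨π, η, γ, hloc, fun v hv => ?_, fun ξ hξ => ?_⟩
  · by_cases h : v = fun _ => lastLetter hd
    · rw [h, hfix]
    · exact (hv (hη2 v h)).elim
  funext n
  rw [Pi.mul_apply, Pi.mul_apply, hγ, toSeq_tilde]
  rcases lt_or_ge n (M + 3) with hn | hn
  · rw [directed, directed, if_neg (by omega), if_neg (by omega), mul_one, one_mul,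
      min_eq_left hn.le]
  set ξ' : Word d (M + 3) → BGroup d r := fun v => η v * ξ v with hξ'
  have hadm : ∀ v, ξ' v ≠ 1 → IsRun hd M v := fun v hv => by
    by_cases h : v = fun _ => lastLetter hd
    · rw [h]; exact ⟨_, Or.inr rfl, fun _ _ => rfl⟩
    · rw [hξ'] at hv
      simp only [hη2 v h, one_mul] at hv
      exact hξ v hv
  have h1 : tildePerm hd r c n = tildePerm hd r c (M + 3) * tildeTail hd r (M + 3) n c := by
    rw [tildeTail]; group
  have h2 : tildeTail hd r (M + 3) n c * directed hd r ξ n = directed hd r ξ' n := by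
    rw [directed, directed, if_pos hn, if_pos hn]
    obtain ⟨k, rfl⟩ := Nat.exists_eq_add_of_le hn
    rw [tildeTail_eq_graft, ← map_mul, Nat.add_sub_cancel_left]
    congr 1
    funext v
    rw [Pi.mul_apply, hξ']
    by_cases h : v = fun _ => lastLetter hd
    · subst h
      simp only [Pi.mulSingle_eq_same, hη1]
      rw [dirPerm_lastLetter, dirPerm_lastLetter, tildePerm_mul hd r hr]
    · simp only [Pi.mulSingle_eq_of_ne h, hη2 v h, one_mul]
  -- This φ moves words with x_d at position M+1 and a different letter at M+2; labelled words have
  -- equal letters there.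
  have h3 : phiPerm hd r (M + 2) c * directed hd r ξ' n =
      directed hd r ξ' n * phiPerm hd r (M + 2) c := by
    have hsupp : directed hd r ξ' n ∈ supportedOn (pre (M + 3) ⁻¹' {v | ξ' v ≠ 1}) := by
      rw [directed, if_pos hn]
      refine graft_mem_supportedOn fun v hv => ?_
      rw [not_not.1 hv, dirPerm_one hd r hr]
    refine commute_of_supportedOn (Set.disjoint_left.2 fun w hw hw' => ?_)
      (phiPerm_mem_supportedOn hd r (M + 2) c) hsupp
    obtain ⟨z, -, hz⟩ := hadm _ hw'
    have e1 : w (M + 1) = z := hz ⟨M + 1, by omega⟩ (by simp)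
    have e2 : w (M + 2) = z := hz ⟨M + 2, by omega⟩ (by simp)
    have e3 := hw.2
    rw [e2, ← e1, hw.1 (M + 1) (by omega)] at e3
    simp only [lastLetter] at e3
    omega
  rw [h1, mul_assoc, h2, tildePerm, mul_assoc, h3, ← mul_assoc, ← hπ,
    act_mul_directed hd r hr hn hloc hadm, min_eq_right hn, tildePerm, ← hπ, mul_assoc]

end

end AltTelescope

open Equiv Filter Topology

namespace AltTelescope

/-! ### Asymptotically invariant means on sequences of permutations. -/

noncomputable section

variable {d : ℕ} (hd : 5 ≤ d) (r : ℕ)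

/-- The average over the products of `directed ξ` with elements of finite level and powers of the
letterwise involution. -/
def levelMean {M : ℕ} (ξ : Word d (M + 3) → BGroup d r) :
    ((ℕ → Perm (InfWord d)) → ℝ) →ₗ[ℝ] ℝ :=
  (2 * Fintype.card (Fin (M + 3 + 1) → Perm (Word d (M + 3 + 1))) : ℝ)⁻¹ •
    ∑ γ, (LinearMap.proj (R := ℝ) (φ := fun _ => ℝ) (directed hd r ξ * levelHom d (M + 3) γ) +
      LinearMap.proj (R := ℝ) (φ := fun _ => ℝ) (directed hd r ξ * levelHom d (M + 3) γ * deltaSeq hd))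

variable {M : ℕ}

theorem levelMean_apply (ξ : Word d (M + 3) → BGroup d r) (h : (ℕ → Perm (InfWord d)) → ℝ) :
    levelMean hd r ξ h =
      (2 * Fintype.card (Fin (M + 3 + 1) → Perm (Word d (M + 3 + 1))) : ℝ)⁻¹ *
      ∑ γ, (h (directed hd r ξ * levelHom d (M + 3) γ) +
        h (directed hd r ξ * levelHom d (M + 3) γ * deltaSeq hd)) := by
  simp [levelMean, LinearMap.sum_apply]

theorem levelMean_nonneg (ξ : Word d (M + 3) → BGroup d r) {h : (ℕ → Perm (InfWord d)) → ℝ}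
    (hh : 0 ≤ h) : 0 ≤ levelMean hd r ξ h := by
  rw [levelMean_apply]
  exact mul_nonneg (by positivity) (Finset.sum_nonneg fun γ _ => add_nonneg (hh _) (hh _))

theorem levelMean_one (ξ : Word d (M + 3) → BGroup d r) : levelMean hd r ξ 1 = 1 := by
  rw [levelMean_apply]
  simp only [Pi.one_apply, Finset.sum_const, Finset.card_univ, nsmul_eq_mul]
  have : (Fintype.card (Fin (M + 3 + 1) → Perm (Word d (M + 3 + 1))) : ℝ) ≠ 0 :=
    Nat.cast_ne_zero.2 Fintype.card_ne_zero
  generalize (Fintype.card (Fin (M + 3 + 1) → Perm (Word d (M + 3 + 1))) : ℝ) = x at *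
  field_simp
  norm_num

theorem abs_levelMean_le (ξ : Word d (M + 3) → BGroup d r) {h : (ℕ → Perm (InfWord d)) → ℝ}
    (h0 : 0 ≤ h) (h1 : h ≤ 1) : |levelMean hd r ξ h| ≤ 1 := by
  rw [abs_of_nonneg (levelMean_nonneg hd r ξ h0)]
  have := levelMean_nonneg hd r ξ (sub_nonneg.2 h1)
  rw [map_sub, levelMean_one] at this
  linarith

/-- The finite-level factor γ is absorbed by averaging over a finite group. -/
theorem levelMean_mul_left {g : ℕ → Perm (InfWord d)} {ξ ξ' : Word d (M + 3) → BGroup d r} {γ}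
    (hg : g * directed hd r ξ = directed hd r ξ' * levelHom d (M + 3) γ)
    (h : (ℕ → Perm (InfWord d)) → ℝ) :
    levelMean hd r ξ (fun x => h (g * x)) = levelMean hd r ξ' h := by
  rw [levelMean_apply, levelMean_apply]
  congr 1
  refine Fintype.sum_equiv (Equiv.mulLeft γ) _ _ fun γ' => ?_
  simp only [coe_mulLeft, map_mul, ← mul_assoc, hg]

/-- Moving the involution to the right conjugates the finite-level elements and interchanges the two
summands, so invariance under τ will be exact. -/
theorem levelMean_deltaSeq_mul (ξ : Word d (M + 3) → BGroup d r)
    (h : (ℕ → Perm (InfWord d)) → ℝ) :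
    levelMean hd r ξ (fun x => h (deltaSeq hd * x)) =
      levelMean hd r (fun v => ξ (diagHom d (M + 3) (delta hd) v)) h := by
  rw [levelMean_apply, levelMean_apply]
  congr 1
  set D := diagHom d (M + 3 + 1) (delta hd) with hD
  have hDD : D * D = 1 := Equiv.ext fun v => diag_delta_delta hd _ v
  let e : Perm (Fin (M + 3 + 1) → Perm (Word d (M + 3 + 1))) :=
    Function.Involutive.toPerm (fun γ i => D * γ i * D) fun γ => by
      funext i
      simp only [mul_assoc, hDD, mul_one]
      rw [← mul_assoc, hDD, one_mul]
  refine Fintype.sum_equiv e _ _ fun γ => ?_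
  have h1 : deltaSeq hd * (directed hd r ξ * levelHom d (M + 3) γ) =
      directed hd r (fun v => ξ (diagHom d (M + 3) (delta hd) v)) * levelHom d (M + 3) (e γ) *
        deltaSeq hd := by
    rw [← mul_assoc, deltaSeq_mul_directed, mul_assoc, deltaSeq_mul_levelHom, ← mul_assoc]
    rfl
  rw [h1, ← mul_assoc (deltaSeq hd), h1, mul_assoc _ (deltaSeq hd), deltaSeq_mul_self, mul_one,
    add_comm]

/-- The density on the functions `ξ`. -/
def density (ξ : Word d (M + 3) → BGroup d r) : ℝ :=
  amplitude (slope hd (uniformAngle (BGroup d r))) ξ ^ 2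

theorem density_nonneg (ξ : Word d (M + 3) → BGroup d r) : 0 ≤ density hd r ξ := sq_nonneg _

theorem isRun_of_density_ne_zero {ξ : Word d (M + 3) → BGroup d r} (h : density hd r ξ ≠ 0)
    (v : Word d (M + 3)) (hv : ξ v ≠ 1) : IsRun hd M v := by
  refine isRun_of_runCount_ne_zero hd fun h0 => hv ?_
  refine eq_one_of_amplitude_ne_zero (fun h1 => h ?_) (v := v)
    (a := slope hd (uniformAngle (BGroup d r))) ?_
  · rw [density, h1]; norm_num
  · rw [slope, h0]; simp

theorem density_delta (ξ : Word d (M + 3) → BGroup d r) :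
    density hd r (fun v => ξ (diagHom d (M + 3) (delta hd) v)) = density hd r ξ := by
  have h : (fun v : Word d (M + 3) => slope hd (uniformAngle (BGroup d r))
      (diagHom d (M + 3) (delta hd) v)) = slope hd (uniformAngle (BGroup d r)) :=
    funext fun v => by rw [slope, slope, runCount_delta]
  have h1 := amplitude_comp (slope hd (uniformAngle (BGroup d r)))
    (diagHom d (M + 3) (delta hd)) ξ
  rw [h] at h1
  rw [density, density, h1]

/-- The mean with density `density` on the functions `ξ`. -/
def mean (M : ℕ) : ((ℕ → Perm (InfWord d)) → ℝ) →ₗ[ℝ] ℝ :=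
  ∑ ξ : Word d (M + 3) → BGroup d r, density hd r ξ • levelMean hd r ξ

theorem mean_apply (h : (ℕ → Perm (InfWord d)) → ℝ) :
    mean hd r M h = ∑ ξ : Word d (M + 3) → BGroup d r, density hd r ξ * levelMean hd r ξ h := by
  simp [mean, LinearMap.sum_apply]

theorem mean_deltaSeq_mul (h : (ℕ → Perm (InfWord d)) → ℝ) :
    mean hd r M (fun x => h (deltaSeq hd * x)) = mean hd r M h := by
  rw [mean_apply, mean_apply]
  let e : Perm (Word d (M + 3) → BGroup d r) := Function.Involutive.toPerm
    (fun ξ v => ξ (diagHom d (M + 3) (delta hd) v)) fun ξ =>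
      funext fun v => congrArg ξ (diag_delta_delta hd _ v)
  rw [← Equiv.sum_comp e]
  refine Finset.sum_congr rfl fun ξ _ => ?_
  have he : e ξ = fun v => ξ (diagHom d (M + 3) (delta hd) v) := rfl
  rw [levelMean_deltaSeq_mul, he, density_delta]
  simp only [diag_delta_delta]

variable (hr : r < d) (hr2 : 2 ≤ r)

include hd hr hr2 in
theorem nontrivial_BGroup : Nontrivial (BGroup d r) :=
  (isSimpleGroup_BGroup hd r hr hr2).toNontrivial

include hr hr2 in
theorem sum_density : ∑ ξ : Word d (M + 3) → BGroup d r, density hd r ξ = 1 :=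
  have := nontrivial_BGroup hd r hr hr2
  sum_amplitude_sq _

include hr hr2 in
-- After reindexing by ξ ↦ g·ξ the two means differ only in their densities, with angles `a` and `a
-- ∘ π`. The translation η disappears because it acts where the angle is uniform.
theorem Absorbs.abs_mean_sub_le {g : ℕ → Perm (InfWord d)} (hg : Absorbs hd r M g)
    {h : (ℕ → Perm (InfWord d)) → ℝ} (h0 : 0 ≤ h) (h1 : h ≤ 1) :
    |mean hd r M (fun x => h (g * x)) - mean hd r M h| ≤
      2 * √(8 * uniformAngle (BGroup d r) ^ 2 * d ^ 3 * (1 / ((M : ℝ) + 1))) := by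
  have := nontrivial_BGroup hd r hr hr2
  obtain ⟨π, η, γ, hπ, hη, habs⟩ := hg
  set a : Word d (M + 3) → ℝ := slope hd (uniformAngle (BGroup d r)) with ha
  let α : Perm (Word d (M + 3) → BGroup d r) :=
    (Equiv.mulLeft η).trans (π.arrowCongr (Equiv.refl _))
  have hα : ∀ ξ, α ξ = fun v => η (π.symm v) * ξ (π.symm v) := fun ξ => rfl
  have hdens : ∀ ξ, density hd r (α ξ) = amplitude (fun v => a (π v)) ξ ^ 2 := fun ξ => by
    rw [density, hα, amplitude_shift]
    intro v hv
    rw [hη v hv, slope_const]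
  have e1 : mean hd r M (fun x => h (g * x)) = ∑ ξ, density hd r ξ * levelMean hd r (α ξ) h := by
    rw [mean_apply]
    refine Finset.sum_congr rfl fun ξ _ => ?_
    by_cases hξ : density hd r ξ = 0
    · rw [hξ, zero_mul, zero_mul]
    · rw [levelMean_mul_left hd r (habs ξ (isRun_of_density_ne_zero hd r hξ)), hα]
  have e2 : mean hd r M h = ∑ ξ, density hd r (α ξ) * levelMean hd r (α ξ) h := by
    rw [mean_apply, ← Equiv.sum_comp α]
  rw [e1, e2, ← Finset.sum_sub_distrib]
  refine (Finset.abs_sum_le_sum_abs _ _).trans ?_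
  have e3 : ∀ ξ, |density hd r ξ * levelMean hd r (α ξ) h -
      density hd r (α ξ) * levelMean hd r (α ξ) h| ≤
      |amplitude a ξ ^ 2 - amplitude (fun v => a (π v)) ξ ^ 2| := fun ξ => by
    rw [← sub_mul, abs_mul, hdens]
    exact mul_le_of_le_one_right (abs_nonneg _) (abs_levelMean_le hd r _ h0 h1)
  refine (Finset.sum_le_sum fun ξ _ => e3 ξ).trans ((sum_abs_sq_sub_sq_le _ _).trans ?_)
  gcongr
  exact hπ.sum_sq_slope_sub_le hd _

include hr hr2 in
theorem tendsto_mean_sub {g : ℕ → Perm (InfWord d)} (hg : ∀ M, Absorbs hd r M g)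
    {h : (ℕ → Perm (InfWord d)) → ℝ} (h0 : 0 ≤ h) (h1 : h ≤ 1) :
    Tendsto (fun M => mean hd r M (fun x => h (g * x)) - mean hd r M h) atTop (𝓝 0) := by
  refine squeeze_zero_norm (fun M => (hg M).abs_mean_sub_le hd r hr hr2 h0 h1) ?_
  have h2 := (((tendsto_one_div_add_atTop_nhds_zero_nat (𝕜 := ℝ)).const_mul
    (8 * uniformAngle (BGroup d r) ^ 2 * (d : ℝ) ^ 3)).sqrt).const_mul 2
  simpa using h2

variable (hrd : r + 3 ≤ d)

/-- The action of `N ⋊ ⟨τ⟩` on sequences of permutations of infinite words. -/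
def semiToSeq : Semi hd r →* (ℕ → Perm (InfWord d)) :=
  semiLift hd r hr hr2 hrd (deltaSeq hd) (deltaSeq_mul_self hd) ((toSeq d).comp (N hd r).subtype)
    fun g => funext fun n => toSeq_conjEps hd g n

/-- The coordinate with index 0 of an element of P moves only the first letter, while `deltaSeq`
also changes the second letter of x_d x_d ⋯. -/
theorem semiToSeq_injective : Function.Injective (semiToSeq hd r hr hr2 hrd) := by
  have := nonempty_fin hd
  refine semiLift_injective hd r hr hr2 hrd _ _ _ _
    (toSeq_injective.comp (Subgroup.subtype_injective _)) ?_
  rintro ⟨g, hg⟩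
  have h1 := congrFun (DFunLike.congr_fun (congrFun hg 0) fun _ => lastLetter hd) 1
  change act d 1 (toPerm d 1 ((g : PGroup d) 0)) _ 1 = delta hd (lastLetter hd) at h1
  rw [act_apply_of_le _ _ le_rfl, delta_last] at h1
  exact lastLetter_ne hd (by omega) h1

/-- G^ε arises from G by conjugation with τ, so invariance has to be checked only for Δ, `c̃` and τ.
-/
theorem closure_semi (t : Subgroup.zpowers (tau hd r)) (ht : (t : MulAut (N hd r)) = tau hd r) :
    Subgroup.closure ({x : Semi hd r | ∃ g : N hd r, x = SemidirectProduct.inl g ∧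
      ((g : PGroup d) ∈ Set.range Delta ∪ Set.range (tilde hd r))} ∪
      {SemidirectProduct.inr t}) = ⊤ := by
  set H := Subgroup.closure ({x : Semi hd r | ∃ g : N hd r, x = SemidirectProduct.inl g ∧
      ((g : PGroup d) ∈ Set.range Delta ∪ Set.range (tilde hd r))} ∪
      {SemidirectProduct.inr t}) with hH
  have hinr : SemidirectProduct.inr t ∈ H := Subgroup.subset_closure (Or.inr rfl)
  have hT : telescopeGroup hd r ≤ (H.comap SemidirectProduct.inl).map (N hd r).subtype := by
    rw [telescopeGroup, Subgroup.closure_le]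
    intro g hg
    have hgN : g ∈ N hd r := (le_sup_left : telescopeGroup hd r ≤ N hd r)
      (Subgroup.subset_closure hg)
    exact ⟨⟨g, hgN⟩, Subgroup.subset_closure (Or.inl ⟨⟨g, hgN⟩, rfl, hg⟩), rfl⟩
  have hN : N hd r ≤ (H.comap SemidirectProduct.inl).map (N hd r).subtype := by
    refine sup_le hT ?_
    rintro _ ⟨g, hg, rfl⟩
    obtain ⟨g, hg', rfl⟩ := hT hg
    refine ⟨tau hd r g, ?_, rfl⟩
    have h1 := SemidirectProduct.inl_aut (φ := (Subgroup.zpowers (tau hd r)).subtype) t g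
    rw [map_inv] at h1
    have h2 := mul_mem (mul_mem hinr hg') (inv_mem hinr)
    rw [← h1] at h2
    change SemidirectProduct.inl ((t : MulAut (N hd r)) g) ∈ H at h2
    rw [ht] at h2
    exact h2
  have hinl : ∀ g : N hd r, SemidirectProduct.inl g ∈ H := fun g => by
    obtain ⟨g', hg', e⟩ := hN g.2
    rwa [← Subtype.ext e]
  rw [eq_top_iff]
  intro x _
  rw [← SemidirectProduct.inl_left_mul_inr_right x]
  refine mul_mem (hinl _) ?_
  rcases eq_one_or_eq_tau hd r x.right with h | h
  · rw [(Subtype.ext h : x.right = 1), map_one]; exact one_mem _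
  · rwa [(Subtype.ext (h.trans ht.symm) : x.right = t)]

include hr hr2 hrd in
theorem isAmenable_semi : IsAmenable (Semi hd r) := by
  set t : Subgroup.zpowers (tau hd r) := ⟨tau hd r, Subgroup.mem_zpowers _⟩ with ht
  refine isAmenable_of_asymptotically_invariant (semiToSeq_injective hd r hr hr2 hrd)
    (closure_semi hd r t rfl) (fun M => mean hd r M) (fun M h h0 => ?_) (fun M => ?_) ?_
  · rw [mean_apply]
    exact Finset.sum_nonneg fun ξ _ =>
      mul_nonneg (density_nonneg hd r ξ) (levelMean_nonneg hd r ξ h0)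
  · simp only [mean_apply, levelMean_one, mul_one, sum_density hd r hr hr2]
  · rintro _ (⟨g, rfl, hg⟩ | rfl) h h0 h1
    · have e : semiToSeq hd r hr hr2 hrd (SemidirectProduct.inl g) = toSeq d g :=
        semiLift_inl hd r hr hr2 hrd _ _ _ _ g
      rw [e]
      refine tendsto_mean_sub hd r hr hr2 (fun M => ?_) h0 h1
      rcases hg with ⟨ω, hω⟩ | ⟨c, hc⟩
      · rw [← hω]; exact absorbs_delta hd r hr M ω
      · rw [← hc]; exact absorbs_tilde hd r hr M c
    · have e : semiToSeq hd r hr hr2 hrd (SemidirectProduct.inr t) = deltaSeq hd :=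
        semiLift_inr hd r hr hr2 hrd _ _ _ _ rfl
      rw [e]
      simp only [mean_deltaSeq_mul, sub_self]
      exact tendsto_const_nhds

end

end AltTelescope

theorem mainTheorem9 (d r : ℕ) (hd : 5 ≤ d) (hr : 2 ≤ r) (hrd : r + 3 ≤ d) :
    (∃ s : Fin 4 → AltTelescope.PGroup d,
        Subgroup.closure (Set.range s) = AltTelescope.N hd r) ∧
      Group.ResiduallyFinite (AltTelescope.N hd r) ∧
      CategoryTheory.IsIso (AltTelescope.completionToP hd r) ∧
      AltTelescope.tau hd r ∉ (MulAut.conj : AltTelescope.N hd r →* _).range ∧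
      (∃ γ : ProfiniteGrp.profiniteCompletion.obj (GrpCat.of (AltTelescope.N hd r)),
        AltTelescope.completionToP hd r γ = AltTelescope.eps hd ∧
        ∀ x, profiniteMap (AltTelescope.tau hd r).toMonoidHom x = γ⁻¹ * x * γ) ∧
      IsGoldsteinGuralnickCounterexample
        (SemidirectProduct.inl : AltTelescope.N hd r →* AltTelescope.Semi hd r).range ∧
      IsAmenable (AltTelescope.Semi hd r) := by
  have hlt : r < d := by omega
  exact ⟨AltTelescope.exists_four_generators hd r hlt hr hrd, inferInstance,
    AltTelescope.isIso_completionToP hd r hlt hr hrd, AltTelescope.tau_notMem_range hd r hlt hr hrd,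
    AltTelescope.exists_completion_conj hd r hlt hr hrd,
    AltTelescope.isGoldsteinGuralnickCounterexample hd r hlt hr hrd, AltTelescope.isAmenable_semi hd r hlt hr hrd⟩
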